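/- Let $T>0$, let $A\in\mathbb R^{d\times d}$, $B\in\mathbb R^{d\times m}$, $C\in\mathbb R^{p\times d}$ be constant matrices and let $N$ be a continuous $d\times d$ matrix valued function on $[0,T]$; $^*$ denotes transposition. For $\tau\in[0,T)$, $\Xi=(\hat\xi,\tilde\xi)\in\mathbb R^d\times L^2(0,\tau;\mathbb R^d)$ (only $\hat\xi$ if $\tau=0$) and $u\in L^2(\tau,T;\mathbb R^m)$, the equation $$w'(t)=Aw(t)+\int_\tau^tN(t-s)w(s)\,ds+Bu(t)+\int_0^\tau N(t-s)\tilde\xi(s)\,ds,\quad t\in[\tau,T],\qquad w(\tau)=\hat\xi,$$ has a unique (Carathéodory) solution $w$, which we extend by $w=\tilde\xi$ on $(0,\tau)$. For a continuous reference signal $y:[0,T]\to\mathbb R^p$ put $$J_\tau(\Xi;u)=\int_\tau^T\big[\|Cw(t)-y(t)\|^2+\|u(t)\|^2\big]dt,\qquad W_\tau(\Xi)=\min_{u\in L^2(\tau,T;\mathbb R^m)}J_\tau(\Xi;u).$$ There are matrices $P_0(\tau)=P_0^*(\tau)$ $(0\le\tau\le T)$, $P_1(s,\tau)$ $(0\le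 s\le\tau\le T)$, $P_2(s,\nu,\tau)=P_2^*(\nu,s,\tau)$ $(0\le s,\nu\le\tau\le T)$, which do not depend on $y$ or on $\Xi$, are continuous and have continuous derivatives with respect to $\tau$ (denoted by a dot, one-sided at end points) on these sets, and satisfy there $$\begin{aligned} &\dot P_0(\tau)+A^*P_0(\tau)+P_0(\tau)A+P_1(\tau,\tau)+P_1^*(\tau,\tau)-P_0(\tau)BB^*P_0(\tau)+C^*C=0,\\ &\dot P_1(s,\tau)+A^*P_1(s,\tau)+P_0(\tau)N(\tau-s)+P_2(\tau,s,\tau)-P_0(\tau)BB^*P_1(s,\tau)=0,\\ &\dot P_2(s,\nu,\tau)+N^*(\tau-s)P_1(\nu,\tau)+P_1^*(s,\tau)N(\tau-\nu)-P_1^*(s,\tau)BB^*P_1(\nu,\tau)=0,\\ &P_0(T)=0,\qquad P_1(s,T)=0,\qquad P_2(s,\nu,T)=0; \end{aligned}$$ and, for every continuous $y$, there are $d_1(\tau)\in\mathbb R^d$, $M(\tau)\in\mathbb R$ $(0\le\tau\le T)$ and $d_2(s,\tau)\in\mathbb R^d$ $(0\le s\le\tau\le T)$, which do not depend on $\Xi$,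 depend on $y$ only through $y|_{[\tau,T]}$ (with $d_1$ linear in $y$), vanish if $y=0$, are continuous with continuous derivatives with respect to $\tau$, and satisfy $$\begin{aligned} &\dot d_1(\tau)+(A^*-P_0(\tau)BB^*)d_1(\tau)+d_2(\tau,\tau)-C^*y(\tau)=0,&&d_1(T)=0,\\ &\dot d_2(s,\tau)+N^*(\tau-s)d_1(\tau)-P_1^*(s,\tau)BB^*d_1(\tau)=0,&&d_2(s,T)=0,\\ &\dot M(\tau)=\|B^*d_1(\tau)\|^2-\|y(\tau)\|^2,&&M(T)=0, \end{aligned}$$ such that for every continuous $y$, every $\tau\in[0,T)$ and every $\Xi=(\hat\xi,\tilde\xi)$ the following holds. (1) The minimum $W_\tau(\Xi)$ exists and $$\begin{aligned}W_\tau(\Xi)={}&\langle\hat\xi,P_0(\tau)\hat\xi\rangle+2\Big\langle\hat\xi,\int_0^\tau P_1(s,\tau)\tilde\xi(s)\,ds\Big\rangle+\int_0^\tau\!\!\int_0^\tau\langle\tilde\xi(s),P_2(s,\nu,\tau)\tilde\xi(\nu)\rangle\,d\nu\,ds\\&+2\langle\hat\xi,d_1(\tau)\rangle+2\int_0^\tau\langle\tilde\xi(s),d_2(s,\tau)\rangle\,ds+M(\tau).\end{aligned}$$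 (2) There is a unique optimal control $u^+_\tau$ (unique up to null sets, and with a continuous representative on $[\tau,T]$, which is the one meant below). It satisfies $$u^+_\tau(\tau)=-B^*\Big[P_0(\tau)\hat\xi+\int_0^\tau P_1(s,\tau)\tilde\xi(s)\,ds+d_1(\tau)\Big]$$ and, if $w$ is the corresponding solution, extended by $\tilde\xi$ on $(0,\tau)$, then for all $t\in[\tau,T]$ $$u^+_\tau(t)=-B^*\Big[P_0(t)w(t)+\int_0^tP_1(s,t)w(s)\,ds+d_1(t)\Big].$$ In particular, for $\tau=0$ this represents the optimal tracking control on $[0,T]$. -/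

import Mathlib

open MeasureTheory Set
open scoped InnerProduct

noncomputable section

/-- `ℝⁿ` with its Euclidean norm and inner product. -/
abbrev Vec (n : ℕ) := EuclideanSpace ℝ (Fin n)

/-- Real matrices with `k` rows and `n` columns, as linear maps `ℝⁿ → ℝᵏ`;
the transpose of `M` is the adjoint `M†`. -/
abbrev Mat (k n : ℕ) := Vec n →L[ℝ] Vec k

/-- The data of the tracking problem, apart from the reference signal: the matrices `A`, `B`, `C`,
the memory kernel `N` (only its values on `[0, T]` matter) and the final time `T`. -/
structure TrackingData (d m p : ℕ) where
  A : Mat d d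
  B : Mat d m
  C : Mat p d
  N : ℝ → Mat d d
  T : ℝ

namespace TrackingData

variable {d m p : ℕ} (S : TrackingData d m p)

/-- `w` is, on `[τ, T]`, the (Carathéodory) solution of the Volterra integrodifferential equation
`w'(t) = A w(t) + ∫_τ^t N(t-s) w(s) ds + B u(t) + ∫_0^τ N(t-s) ξm(s) ds`, `w(τ) = ξh`,
i.e. it is continuous and satisfies the integrated equation.  The initial datum is the pair
`(ξh, ξm)` of `ℝᵈ × L²(0, τ; ℝᵈ)`; for `τ = 0` the function `ξm` plays no role. -/
structure IsState (τ : ℝ) (ξh : Vec d) (ξm : ℝ → Vec d) (u : ℝ → Vec m) (w : ℝ → Vec d) :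
    Prop where
  continuousOn : ContinuousOn w (Icc τ S.T)
  equation : ∀ t ∈ Icc τ S.T,
    w t = ξh + ∫ r in τ..t,
      (S.A (w r) + (∫ s in τ..r, S.N (r - s) (w s)) + S.B (u r)
        + (∫ s in (0 : ℝ)..τ, S.N (r - s) (ξm s)))

/-- Square integrable controls on `[τ, T]`. -/
def IsControl (τ : ℝ) (u : ℝ → Vec m) : Prop :=
  MemLp u 2 (volume.restrict (Icc τ S.T))

/-- Memory parts of the initial data at time `τ`: square integrable functions on `(0, τ)`. -/
def IsMemory (_S : TrackingData d m p) (τ : ℝ) (ξm : ℝ → Vec d) : Prop :=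
  MemLp ξm 2 (volume.restrict (Ioo 0 τ))

/-- The cost `∫_τ^T ‖C w(t) - y(t)‖² + ‖u(t)‖² dt`. -/
def cost (y : ℝ → Vec p) (τ : ℝ) (u : ℝ → Vec m) (w : ℝ → Vec d) : ℝ :=
  ∫ t in τ..S.T, (‖S.C (w t) - y t‖ ^ 2 + ‖u t‖ ^ 2)

/-- The set of all values `J_τ((ξh, ξm); u)`, `u ∈ L²(τ, T; ℝᵐ)`; its minimum is the value
function `W_τ(ξh, ξm)`. -/
def costValues (y : ℝ → Vec p) (τ : ℝ) (ξh : Vec d) (ξm : ℝ → Vec d) : Set ℝ :=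
  {c | ∃ u w, S.IsControl τ u ∧ S.IsState τ ξh ξm u w ∧ c = S.cost y τ u w}

/-- `u` is an optimal control for the initial time `τ` and the initial datum `(ξh, ξm)`, and `w` is
the corresponding solution. -/
structure IsOptimal (y : ℝ → Vec p) (τ : ℝ) (ξh : Vec d) (ξm : ℝ → Vec d)
    (u : ℝ → Vec m) (w : ℝ → Vec d) : Prop where
  isControl : S.IsControl τ u
  isState : S.IsState τ ξh ξm u w
  le : ∀ v z, S.IsControl τ v → S.IsState τ ξh ξm v z → S.cost y τ u w ≤ S.cost y τ v z

/-- The set `0 ≤ s ≤ τ ≤ T` of pairs `(s, τ)`. -/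
def triangle : Set (ℝ × ℝ) := {q | 0 ≤ q.1 ∧ q.1 ≤ q.2 ∧ q.2 ≤ S.T}

/-- The set `0 ≤ s, ν ≤ τ ≤ T` of triples `(s, ν, τ)`. -/
def prism : Set (ℝ × ℝ × ℝ) :=
  {q | 0 ≤ q.1 ∧ 0 ≤ q.2.1 ∧ q.1 ≤ q.2.2 ∧ q.2.1 ≤ q.2.2 ∧ q.2.2 ≤ S.T}

/-- `P0' = dP₀/dτ`, `P1' = ∂P₁/∂τ`, `P2' = ∂P₂/∂τ` (one-sided at the ends of the intervals of
definition); the matrices and these derivatives are continuous on the whole of the domains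
`[0, T]`, `0 ≤ s ≤ τ ≤ T` and `0 ≤ s, ν ≤ τ ≤ T`. -/
structure MatricesC1 (P0 : ℝ → Mat d d) (P1 : ℝ → ℝ → Mat d d) (P2 : ℝ → ℝ → ℝ → Mat d d)
    (P0' : ℝ → Mat d d) (P1' : ℝ → ℝ → Mat d d) (P2' : ℝ → ℝ → ℝ → Mat d d) : Prop where
  cont0 : ContinuousOn P0 (Icc 0 S.T)
  cont0' : ContinuousOn P0' (Icc 0 S.T)
  deriv0 : ∀ τ ∈ Icc 0 S.T, HasDerivWithinAt P0 (P0' τ) (Icc 0 S.T) τ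
  cont1 : ContinuousOn (fun q : ℝ × ℝ => P1 q.1 q.2) S.triangle
  cont1' : ContinuousOn (fun q : ℝ × ℝ => P1' q.1 q.2) S.triangle
  deriv1 : ∀ s τ, (s, τ) ∈ S.triangle →
    HasDerivWithinAt (fun t => P1 s t) (P1' s τ) (Icc s S.T) τ
  cont2 : ContinuousOn (fun q : ℝ × ℝ × ℝ => P2 q.1 q.2.1 q.2.2) S.prism
  cont2' : ContinuousOn (fun q : ℝ × ℝ × ℝ => P2' q.1 q.2.1 q.2.2) S.prism
  deriv2 : ∀ s ν τ, (s, ν, τ) ∈ S.prism →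
    HasDerivWithinAt (fun t => P2 s ν t) (P2' s ν τ) (Icc (max s ν) S.T) τ

/-- The system of Riccati type for `P₀(τ)`, `P₁(s, τ)`, `P₂(s, ν, τ)`, with final conditions. -/
structure RiccatiSystem (P0 : ℝ → Mat d d) (P1 : ℝ → ℝ → Mat d d) (P2 : ℝ → ℝ → ℝ → Mat d d)
    (P0' : ℝ → Mat d d) (P1' : ℝ → ℝ → Mat d d) (P2' : ℝ → ℝ → ℝ → Mat d d) : Prop where
  eq0 : ∀ τ ∈ Icc 0 S.T,
    P0' τ + S.A† ∘L P0 τ + P0 τ ∘L S.A + P1 τ τ + (P1 τ τ)†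
      - P0 τ ∘L S.B ∘L S.B† ∘L P0 τ + S.C† ∘L S.C = 0
  eq1 : ∀ s τ, (s, τ) ∈ S.triangle →
    P1' s τ + S.A† ∘L P1 s τ + P0 τ ∘L S.N (τ - s) + P2 τ s τ
      - P0 τ ∘L S.B ∘L S.B† ∘L P1 s τ = 0
  eq2 : ∀ s ν τ, (s, ν, τ) ∈ S.prism →
    P2' s ν τ + (S.N (τ - s))† ∘L P1 ν τ + (P1 s τ)† ∘L S.N (τ - ν)
      - (P1 s τ)† ∘L S.B ∘L S.B† ∘L P1 ν τ = 0
  final0 : P0 S.T = 0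
  final1 : ∀ s ∈ Icc 0 S.T, P1 s S.T = 0
  final2 : ∀ s ∈ Icc 0 S.T, ∀ ν ∈ Icc 0 S.T, P2 s ν S.T = 0

/-- The `C¹` regularity in `τ` of the coefficients `d₁(τ)`, `d₂(s, τ)`, `M(τ)`. -/
structure SignalC1 (d1 : ℝ → Vec d) (d2 : ℝ → ℝ → Vec d) (M : ℝ → ℝ)
    (d1' : ℝ → Vec d) (d2' : ℝ → ℝ → Vec d) (M' : ℝ → ℝ) : Prop where
  cont1 : ContinuousOn d1 (Icc 0 S.T)
  cont1' : ContinuousOn d1' (Icc 0 S.T)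
  deriv1 : ∀ τ ∈ Icc 0 S.T, HasDerivWithinAt d1 (d1' τ) (Icc 0 S.T) τ
  cont2 : ContinuousOn (fun q : ℝ × ℝ => d2 q.1 q.2) S.triangle
  cont2' : ContinuousOn (fun q : ℝ × ℝ => d2' q.1 q.2) S.triangle
  deriv2 : ∀ s τ, (s, τ) ∈ S.triangle →
    HasDerivWithinAt (fun t => d2 s t) (d2' s τ) (Icc s S.T) τ
  contM : ContinuousOn M (Icc 0 S.T)
  contM' : ContinuousOn M' (Icc 0 S.T)
  derivM : ∀ τ ∈ Icc 0 S.T, HasDerivWithinAt M (M' τ) (Icc 0 S.T) τ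

/-- The equations, with final conditions, of the coefficients that depend on the reference
signal `y`. -/
structure SignalSystem (y : ℝ → Vec p) (P0 : ℝ → Mat d d) (P1 : ℝ → ℝ → Mat d d)
    (d1 : ℝ → Vec d) (d2 : ℝ → ℝ → Vec d) (M : ℝ → ℝ)
    (d1' : ℝ → Vec d) (d2' : ℝ → ℝ → Vec d) (M' : ℝ → ℝ) : Prop where
  eq1 : ∀ τ ∈ Icc 0 S.T,
    d1' τ + (S.A† - P0 τ ∘L S.B ∘L S.B†) (d1 τ) + d2 τ τ - (S.C†) (y τ) = 0
  eq2 : ∀ s τ, (s, τ) ∈ S.triangle →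
    d2' s τ + ((S.N (τ - s))†) (d1 τ) - ((P1 s τ)† ∘L S.B ∘L S.B†) (d1 τ) = 0
  eqM : ∀ τ ∈ Icc 0 S.T, M' τ = ‖(S.B†) (d1 τ)‖ ^ 2 - ‖y τ‖ ^ 2
  final1 : d1 S.T = 0
  final2 : ∀ s ∈ Icc 0 S.T, d2 s S.T = 0
  finalM : M S.T = 0

/-- The quadratic form in the datum `(ωh, ωm)` with coefficients `P₀, P₁, P₂, d₁, d₂, M` at the
time `τ`. -/
def quadraticForm (P0 : ℝ → Mat d d) (P1 : ℝ → ℝ → Mat d d) (P2 : ℝ → ℝ → ℝ → Mat d d)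
    (d1 : ℝ → Vec d) (d2 : ℝ → ℝ → Vec d) (M : ℝ → ℝ)
    (τ : ℝ) (ωh : Vec d) (ωm : ℝ → Vec d) : ℝ :=
  inner ℝ ωh (P0 τ ωh)
    + 2 * inner ℝ ωh (∫ s in (0 : ℝ)..τ, P1 s τ (ωm s))
    + (∫ s in (0 : ℝ)..τ, ∫ ν in (0 : ℝ)..τ, inner ℝ (ωm s) (P2 s ν τ (ωm ν)))
    + 2 * inner ℝ ωh (d1 τ)
    + 2 * (∫ s in (0 : ℝ)..τ, inner ℝ (ωm s) (d2 s τ))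
    + M τ

/-- `-B* [P₀(t) ωh + ∫_0^t P₁(s, t) ωm(s) ds + d₁(t)]`. -/
def feedback (P0 : ℝ → Mat d d) (P1 : ℝ → ℝ → Mat d d) (d1 : ℝ → Vec d)
    (t : ℝ) (ωh : Vec d) (ωm : ℝ → Vec d) : Vec m :=
  -((S.B†) (P0 t ωh + (∫ s in (0 : ℝ)..t, P1 s t (ωm s)) + d1 t))

/-- The solution `w` with initial time `τ`, extended to the past `s < τ` by the memory `ξm`.
For `τ = 0` this is `w` on `[0, T]`. -/
def extend (_S : TrackingData d m p) (τ : ℝ) (ξm w : ℝ → Vec d) : ℝ → Vec d :=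
  fun s => if s < τ then ξm s else w s

end TrackingData

end

/-! The pair (current state, memory) is treated as one object. On the compact space Ω = [0, T] ⊔
{star} the datum (ξh, ξm) becomes the functional ω = ξh δ_star + ∫ ξm(s) δ_s ds on C(Ω, ℝᵈ). With
k(t, star) = A and k(t, s) = N(t - s) the equation reads w' = ∫ k(t, ·) dω + B u, while ω moves by
w' δ_star + w(t) δ_t. The matrices P₀, P₁, P₂ are the blocks of one symmetric kernel P(τ) in C(Ω ×
Ω), and d₁, d₂ are the two parts of one x(τ) in C(Ω). The two systems are then a Riccati equation
(`riccatiRHS`) and a linear equation (`signalRHS`) in Banach spaces. The memory is labelled by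
absolute time, so no transport operator occurs and the right-hand sides are locally Lipschitz.

Put V(t, ω) = ω(Pω) + 2 ω(x) + M. The coefficient equations say exactly that along every trajectory
dV/dt = ‖u + B*(Pω + x)(star)‖² - (running cost); this is the completion of squares
`value_derivative_eq`. Integration with zero terminal data gives cost = V(τ, ω₀) + ∫ ‖u - feedback‖²
(`cost_eq_value_add`). Hence V is a lower bound, attained exactly by the controls that agree almost
everywhere with the feedback along their own trajectory. The closed loop is a Volterra equation with
one solution (`exists_closedLoop`), so the optimal control exists and is unique. The delicate point
is the integration: w is differentiable only almost everywhere and the memory part of ω only weakly,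
so V is shown to be absolutely continuous along trajectories
(`absolutelyContinuousOnInterval_value`).

The Riccati equation is quadratic, so global existence needs an a priori bound. The same identity
with y = 0 yields 0 ≤ ω(Pω) ≤ ω(Qω), where Q solves the equation with B = 0, which is affine and
hence globally solvable (`kernelForm_mem_Icc`). Polarisation turns this into ‖P‖ ≤ ‖Q‖
(`norm_le_of_kernelForm_mem_Icc`), and truncating the vector field outside a large ball gives the
solution on all of [0, T]. -/

/-! ### Terminal value problems in Banach spaces -/

section BackwardODE

variable {E : Type*} [NormedAddCommGroup E] [NormedSpace ℝ E]

/-- The radial retraction onto the closed ball of radius `R`. -/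
noncomputable def radialRetraction (R : ℝ) (x : E) : E := (R / max R ‖x‖) • x

lemma radialRetraction_eq_self {R : ℝ} (hR : 0 < R) {x : E} (hx : ‖x‖ ≤ R) :
    radialRetraction R x = x := by
  rw [radialRetraction, max_eq_left hx, div_self hR.ne', one_smul]

lemma norm_radialRetraction_le {R : ℝ} (hR : 0 < R) (x : E) : ‖radialRetraction R x‖ ≤ R := by
  have hm : 0 < max R ‖x‖ := lt_max_of_lt_left hR
  rw [radialRetraction, norm_smul, Real.norm_of_nonneg (by positivity), div_mul_eq_mul_div,
    div_le_iff₀ hm]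
  gcongr
  exact le_max_right _ _

/-- Moving the point with the scaling factor fixed, and then the factor with the point fixed, each
costs at most ‖x - y‖. -/
lemma norm_radialRetraction_sub_le {R : ℝ} (hR : 0 < R) (x y : E) :
    ‖radialRetraction R x - radialRetraction R y‖ ≤ 2 * ‖x - y‖ := by
  have hx : 0 < max R ‖x‖ := lt_max_of_lt_left hR
  have hy : 0 < max R ‖y‖ := lt_max_of_lt_left hR
  have h1 : radialRetraction R x - radialRetraction R y
      = (R / max R ‖x‖) • (x - y) + (R / max R ‖x‖ - R / max R ‖y‖) • y := by
    simp only [radialRetraction, smul_sub, sub_smul]; abel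
  have h2 : ‖(R / max R ‖x‖) • (x - y)‖ ≤ ‖x - y‖ := by
    rw [norm_smul, Real.norm_of_nonneg (by positivity)]
    exact mul_le_of_le_one_left (norm_nonneg _) ((div_le_one hx).2 (le_max_left _ _))
  have h3 : ‖(R / max R ‖x‖ - R / max R ‖y‖) • y‖ ≤ ‖x - y‖ := by
    have e : R / max R ‖x‖ - R / max R ‖y‖
        = (R / max R ‖x‖) * ((max R ‖y‖ - max R ‖x‖) / max R ‖y‖) := by
      field_simp
    rw [e, norm_smul, norm_mul, Real.norm_of_nonneg (show 0 ≤ R / max R ‖x‖ by positivity),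
      norm_div, Real.norm_of_nonneg hy.le]
    have h4 : ‖max R ‖y‖ - max R ‖x‖‖ ≤ ‖x - y‖ := by
      rw [Real.norm_eq_abs, norm_sub_rev]
      refine (abs_max_sub_max_le_max R ‖y‖ R ‖x‖).trans ?_
      simp only [sub_self, abs_zero]
      exact max_le (norm_nonneg _) (abs_norm_sub_norm_le _ _)
    calc R / max R ‖x‖ * (‖max R ‖y‖ - max R ‖x‖‖ / max R ‖y‖) * ‖y‖
        = (R / max R ‖x‖) * (‖y‖ / max R ‖y‖) * ‖max R ‖y‖ - max R ‖x‖‖ := by ring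
      _ ≤ 1 * 1 * ‖x - y‖ := by
          gcongr
          · exact (div_le_one hx).2 (le_max_left _ _)
          · exact (div_le_one hy).2 (le_max_right _ _)
      _ = ‖x - y‖ := by ring
  rw [h1]
  linarith [norm_add_le ((R / max R ‖x‖) • (x - y)) ((R / max R ‖x‖ - R / max R ‖y‖) • y)]

/-- Global existence for a terminal value problem with an a priori bound. -/
theorem exists_backward_solution_of_apriori_bound [CompleteSpace E] {F : ℝ → E → E} {T : ℝ}
    (hT : 0 ≤ T) (x₀ : E) (R₀ : ℝ)
    (hcont : ∀ x, ContinuousOn (F · x) (Icc 0 T))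
    (hlip : ∀ R, ∃ K : ℝ, 0 ≤ K ∧ ∀ t ∈ Icc 0 T, ∀ x y, ‖x‖ ≤ R → ‖y‖ ≤ R →
      ‖F t x - F t y‖ ≤ K * ‖x - y‖)
    (hbound : ∀ a ∈ Icc 0 T, ∀ x : ℝ → E, x T = x₀ →
      (∀ t ∈ Icc a T, HasDerivWithinAt x (F t (x t)) (Icc a T) t) → ∀ t ∈ Icc a T, ‖x t‖ ≤ R₀) :
    ∃ x : ℝ → E, x T = x₀ ∧ ∀ t ∈ Icc 0 T, HasDerivWithinAt x (F t (x t)) (Icc 0 T) t := by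
  -- The inequalities are strict so that reaching the sphere of radius R contradicts the bound R₀,
  -- and so that the terminal value lies inside.
  obtain ⟨R, hR, hR₀, hRx⟩ : ∃ R, 0 < R ∧ R₀ < R ∧ ‖x₀‖ < R :=
    ⟨max 0 (max R₀ ‖x₀‖) + 1, by positivity,
      by linarith [le_max_left R₀ ‖x₀‖, le_max_right 0 (max R₀ ‖x₀‖)],
      by linarith [le_max_right R₀ ‖x₀‖, le_max_right 0 (max R₀ ‖x₀‖)]⟩
  obtain ⟨K, hK0, hK⟩ := hlip R
  obtain ⟨c, hc⟩ := (isCompact_Icc (a := (0 : ℝ)) (b := T)).exists_bound_of_continuousOn (hcont 0)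
  have hc0 : 0 ≤ c := (norm_nonneg _).trans (hc 0 ⟨le_rfl, hT⟩)
  -- The truncated field is bounded by c + K R and 2K-Lipschitz everywhere, so Picard–Lindelöf
  -- covers the whole of [0, T] in one step.
  set G : ℝ → E → E := fun t x => F t (radialRetraction R x) with hG
  have hPL : IsPicardLindelof G (⟨T, hT, le_rfl⟩ : Icc 0 T) x₀ ⟨(c + K * R) * T, by positivity⟩ 0
      ⟨c + K * R, by positivity⟩ ⟨K * 2, by positivity⟩ := by
    refine ⟨fun t ht => ?_, fun x _ => hcont _, fun t ht x _ => ?_, ?_⟩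
    · refine LipschitzOnWith.of_dist_le_mul fun x _ y _ => ?_
      rw [dist_eq_norm, dist_eq_norm]
      refine (hK t ht _ _ (norm_radialRetraction_le hR x) (norm_radialRetraction_le hR y)).trans ?_
      change _ ≤ K * 2 * _
      rw [mul_assoc]
      gcongr
      exact norm_radialRetraction_sub_le hR x y
    · change ‖F t _‖ ≤ c + K * R
      have h1 := hK t ht (radialRetraction R x) 0 (norm_radialRetraction_le hR x)
        (by simpa using hR.le)
      rw [sub_zero] at h1
      have h2 : K * ‖radialRetraction R x‖ ≤ K * R := by
        gcongr; exact norm_radialRetraction_le hR x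
      have h3 := norm_sub_norm_le (F t (radialRetraction R x)) (F t 0)
      linarith [hc t ht]
    · change (c + K * R) * max (T - T) (T - 0) ≤ (c + K * R) * T - 0
      simp [hT]
  obtain ⟨x, hxT, hx⟩ := hPL.exists_eq_forall_mem_Icc_hasDerivWithinAt₀
  have hxc : ContinuousOn x (Icc 0 T) := fun t ht => (hx t ht).continuousWithinAt
  have hlt : ∀ t ∈ Icc 0 T, ‖x t‖ < R := by
    by_contra! hne
    obtain ⟨t₁, ht₁, hxt₁⟩ := hne
    have hcl : IsCompact (Icc 0 T ∩ {t | R ≤ ‖x t‖}) :=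
      isCompact_Icc.of_isClosed_subset
        (hxc.norm.preimage_isClosed_of_isClosed isClosed_Icc isClosed_Ici) inter_subset_left
    -- The latest time outside the open ball: on [t₂, T] the truncation is inactive, so the a priori
    -- bound applies there and excludes ‖x t₂‖ ≥ R.
    obtain ⟨t₂, ⟨ht₂, hxt₂⟩, hmax⟩ := hcl.exists_isGreatest ⟨t₁, ht₁, hxt₁⟩
    have hlt₂ : t₂ < T := by
      refine lt_of_le_of_ne ht₂.2 fun h => ?_
      subst h
      exact absurd hxt₂ (by simpa [hxT] using hRx)
    have habove : ∀ t ∈ Ioc t₂ T, ‖x t‖ ≤ R := fun t ht => by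
      by_contra! h
      exact absurd (hmax ⟨⟨ht₂.1.trans ht.1.le, ht.2⟩, h.le⟩) (not_le.2 ht.1)
    have hle : ∀ t ∈ Icc t₂ T, ‖x t‖ ≤ R := by
      have hcl2 : closure (Ioc t₂ T) = Icc t₂ T := closure_Ioc hlt₂.ne
      intro t ht
      rw [← hcl2] at ht
      refine ContinuousWithinAt.closure_le (s := Ioc t₂ T) ht
        ((hxc.norm t ⟨ht₂.1.trans ?_, ?_⟩).mono fun s hs => ⟨ht₂.1.trans hs.1.le, hs.2⟩)
        continuousWithinAt_const habove
      · exact (hcl2 ▸ ht).1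
      · exact (hcl2 ▸ ht).2
    have hsol : ∀ t ∈ Icc t₂ T, HasDerivWithinAt x (F t (x t)) (Icc t₂ T) t := fun t ht => by
      have h := (hx t ⟨ht₂.1.trans ht.1, ht.2⟩).mono (Icc_subset_Icc_left ht₂.1)
      simpa only [hG, radialRetraction_eq_self hR (hle t ht)] using h
    have := hbound t₂ ht₂ x hxT hsol t₂ ⟨le_rfl, hlt₂.le⟩
    exact absurd hxt₂ (not_le.2 (this.trans_lt hR₀))
  refine ⟨x, hxT, fun t ht => ?_⟩
  have h := hx t ht
  simpa only [hG, radialRetraction_eq_self hR (hlt t ht).le] using h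

/-- Grönwall's bound for a terminal value problem with linear growth. -/
theorem norm_le_of_backward_linear_growth {a T c e : ℝ} (hc : 0 ≤ c) (he : 0 ≤ e)
    {x x' : ℝ → E} (hx : ∀ t ∈ Icc a T, HasDerivWithinAt x (x' t) (Icc a T) t)
    (hx' : ∀ t ∈ Icc a T, ‖x' t‖ ≤ c * ‖x t‖ + e) :
    ∀ t ∈ Icc a T, ‖x t‖ ≤ gronwallBound ‖x T‖ c e (T - a) := by
  intro t ht
  have hmaps : MapsTo Neg.neg (Icc (-T) (-a)) (Icc a T) :=
    fun s hs => ⟨le_neg.1 hs.2, neg_le.1 hs.1⟩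
  have hd : ∀ s ∈ Icc (-T) (-a), HasDerivWithinAt (fun s => x (-s)) (-x' (-s)) (Icc (-T) (-a)) s := by
    intro s hs
    have := (hx (-s) (hmaps hs)).scomp s (hasDerivAt_neg s).hasDerivWithinAt hmaps
    simpa [Function.comp_def] using this
  have h := norm_le_gronwallBound_of_norm_deriv_right_le (f := fun s => x (-s))
    (f' := fun s => -x' (-s)) (δ := ‖x T‖) (K := c) (ε := e) (a := -T) (b := -a)
    (fun s hs => (hd s hs).continuousWithinAt)
    (fun s hs => (hd s ⟨hs.1, hs.2.le⟩).mono_of_mem_nhdsWithin (Icc_mem_nhdsGE_of_mem hs))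
    (by simp) (fun s hs => by simpa using hx' (-s) (hmaps ⟨hs.1, hs.2.le⟩))
    (-t) ⟨neg_le_neg ht.2, neg_le_neg ht.1⟩
  rw [neg_neg] at h
  refine h.trans (gronwallBound_mono (norm_nonneg _) he hc ?_)
  linarith [ht.1]

/-- Global existence for a terminal value problem with linear growth. -/
theorem exists_backward_solution_of_linear_growth [CompleteSpace E] {F : ℝ → E → E} {T : ℝ}
    (hT : 0 ≤ T) (x₀ : E)
    (hcont : ∀ x, ContinuousOn (F · x) (Icc 0 T))
    (hlip : ∀ R, ∃ K : ℝ, 0 ≤ K ∧ ∀ t ∈ Icc 0 T, ∀ x y, ‖x‖ ≤ R → ‖y‖ ≤ R →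
      ‖F t x - F t y‖ ≤ K * ‖x - y‖)
    {c e : ℝ} (hc : 0 ≤ c) (he : 0 ≤ e)
    (hgrowth : ∀ t ∈ Icc 0 T, ∀ x, ‖F t x‖ ≤ c * ‖x‖ + e) :
    ∃ x : ℝ → E, x T = x₀ ∧ ∀ t ∈ Icc 0 T, HasDerivWithinAt x (F t (x t)) (Icc 0 T) t := by
  refine exists_backward_solution_of_apriori_bound hT x₀ (gronwallBound ‖x₀‖ c e T) hcont hlip ?_
  intro a ha x hxT hx t ht
  have h := norm_le_of_backward_linear_growth hc he hx
    (fun t ht => hgrowth t ⟨ha.1.trans ht.1, ht.2⟩ _) t ht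
  rw [hxT] at h
  exact h.trans (gronwallBound_mono (norm_nonneg _) he hc (by linarith [ha.1]))

/-- Uniqueness for a terminal value problem with a locally Lipschitz right-hand side. -/
theorem backward_solution_unique {F : ℝ → E → E} {a T : ℝ}
    (hlip : ∀ R, ∃ K : ℝ, 0 ≤ K ∧ ∀ t ∈ Icc a T, ∀ x y, ‖x‖ ≤ R → ‖y‖ ≤ R →
      ‖F t x - F t y‖ ≤ K * ‖x - y‖)
    {x y : ℝ → E} (hx : ∀ t ∈ Icc a T, HasDerivWithinAt x (F t (x t)) (Icc a T) t)
    (hy : ∀ t ∈ Icc a T, HasDerivWithinAt y (F t (y t)) (Icc a T) t) (hxy : x T = y T) :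
    EqOn x y (Icc a T) := by
  have hxc : ContinuousOn x (Icc a T) := fun t ht => (hx t ht).continuousWithinAt
  have hyc : ContinuousOn y (Icc a T) := fun t ht => (hy t ht).continuousWithinAt
  obtain ⟨R₁, hR₁⟩ := isCompact_Icc.exists_bound_of_continuousOn hxc
  obtain ⟨R₂, hR₂⟩ := isCompact_Icc.exists_bound_of_continuousOn hyc
  obtain ⟨K, hK0, hK⟩ := hlip (max R₁ R₂)
  have hsub : Ioc a T ⊆ Icc a T := Ioc_subset_Icc_self
  refine ODE_solution_unique_of_mem_Icc_left (v := F) (K := ⟨K, hK0⟩)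
    (s := fun _ => Metric.closedBall 0 (max R₁ R₂)) (fun t ht => ?_) hxc (fun t ht => ?_)
    (fun t ht => ?_) hyc (fun t ht => ?_) (fun t ht => ?_) hxy
  · refine LipschitzOnWith.of_dist_le_mul fun u hu v hv => ?_
    rw [dist_eq_norm, dist_eq_norm]
    exact hK t (hsub ht) u v (by simpa using hu) (by simpa using hv)
  · exact (hx t (hsub ht)).mono_of_mem_nhdsWithin (Icc_mem_nhdsLE_of_mem ht)
  · simpa using (hR₁ t (hsub ht)).trans (le_max_left _ _)
  · exact (hy t (hsub ht)).mono_of_mem_nhdsWithin (Icc_mem_nhdsLE_of_mem ht)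
  · simpa using (hR₂ t (hsub ht)).trans (le_max_right _ _)

end BackwardODE

/-! ### Volterra equations with causal Lipschitz right-hand side -/

section Volterra

variable {V : Type*} [NormedAddCommGroup V] [NormedSpace ℝ V]

/-- `w` solves the Volterra equation `w(t) = f(t) + ∫_τ^t (G w)(r) dr` on `[τ, T]`. -/
def IsVolterraSolution (τ T : ℝ) (f : C(ℝ, V)) (G : C(ℝ, V) → C(ℝ, V)) (w : C(ℝ, V)) : Prop :=
  ∀ t ∈ Icc τ T, w t = f t + ∫ r in τ..t, G w r

/-- `G` is causal and Lipschitz with constant `L` on `[τ, T]`. -/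
def IsCausalLipschitz (τ T L : ℝ) (G : C(ℝ, V) → C(ℝ, V)) : Prop :=
  ∀ w z : C(ℝ, V), ∀ r ∈ Icc τ T, ∀ c, (∀ s ∈ Icc τ r, ‖w s - z s‖ ≤ c) →
    ‖G w r - G z r‖ ≤ L * c

/-- The function `t ↦ exp(l t) v(t)` extended from `[τ, T]` to `ℝ`. -/
noncomputable def expWeightExtend {τ T : ℝ} (h : τ ≤ T) (l : ℝ) (v : C(Icc τ T, V)) : C(ℝ, V) where
  toFun t := Real.exp (l * t) • v (projIcc τ T h t)
  continuous_toFun := by fun_prop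

/-- The Picard map of a Volterra equation, conjugated with an exponential weight. -/
noncomputable def volterraPicard {τ T : ℝ} (h : τ ≤ T) (l : ℝ) (f : C(ℝ, V))
    (G : C(ℝ, V) → C(ℝ, V)) (v : C(Icc τ T, V)) : C(Icc τ T, V) where
  toFun t := Real.exp (-(l * t)) • (f t + ∫ r in τ..t, G (expWeightExtend h l v) r)
  continuous_toFun := by
    have : Continuous fun t => ∫ r in τ..t, G (expWeightExtend h l v) r :=
      intervalIntegral.continuous_primitive
        (fun a b => (G (expWeightExtend h l v)).continuous.intervalIntegrable a b) τ
    fun_prop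

lemma norm_expWeightExtend_sub_le {τ T : ℝ} (h : τ ≤ T) {l : ℝ} (hl : 0 ≤ l)
    (v v' : C(Icc τ T, V)) {s r : ℝ} (hsr : s ≤ r) :
    ‖expWeightExtend h l v s - expWeightExtend h l v' s‖ ≤ Real.exp (l * r) * ‖v - v'‖ := by
  change ‖Real.exp (l * s) • v _ - Real.exp (l * s) • v' _‖ ≤ _
  rw [← smul_sub, norm_smul, Real.norm_of_nonneg (Real.exp_pos _).le]
  gcongr
  exact (v - v').norm_coe_le_norm _

/-- The weight gains a factor 1/l, because ∫_τ^t exp(l r) dr ≤ exp(l t)/l. For large l the Picard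
map therefore contracts on the whole interval. -/
lemma dist_volterraPicard_le {τ T L : ℝ} (h : τ ≤ T) (hL : 0 ≤ L) {f : C(ℝ, V)}
    {G : C(ℝ, V) → C(ℝ, V)} (hG : IsCausalLipschitz τ T L G) {l : ℝ} (hl : 0 < l)
    (v v' : C(Icc τ T, V)) :
    dist (volterraPicard h l f G v) (volterraPicard h l f G v') ≤ L / l * dist v v' := by
  rw [ContinuousMap.dist_le (by positivity)]
  intro t
  obtain ⟨t, ht⟩ := t
  have hint : ∀ v : C(Icc τ T, V), IntervalIntegrable (G (expWeightExtend h l v)) volume τ t :=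
    fun v => (G (expWeightExtend h l v)).continuous.intervalIntegrable _ _
  rw [dist_eq_norm, dist_eq_norm]
  change ‖Real.exp (-(l * t)) • (f t + _) - Real.exp (-(l * t)) • (f t + _)‖ ≤ _
  rw [← smul_sub, add_sub_add_left_eq_sub, ← intervalIntegral.integral_sub (hint v) (hint v'),
    norm_smul, Real.norm_of_nonneg (Real.exp_pos _).le]
  have hb : ‖∫ r in τ..t, (G (expWeightExtend h l v) r - G (expWeightExtend h l v') r)‖
      ≤ ∫ r in τ..t, L * ‖v - v'‖ * Real.exp (l * r) := by
    refine intervalIntegral.norm_integral_le_of_norm_le ht.1 (.of_forall fun r hr => ?_)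
      (Continuous.intervalIntegrable (by fun_prop) _ _)
    have := hG (expWeightExtend h l v) (expWeightExtend h l v') r ⟨hr.1.le, hr.2.trans ht.2⟩
      (Real.exp (l * r) * ‖v - v'‖) fun s hs => norm_expWeightExtend_sub_le h hl.le v v' hs.2
    linarith
  have hI : ∫ r in τ..t, Real.exp (l * r) = (Real.exp (l * t) - Real.exp (l * τ)) / l := by
    rw [intervalIntegral.integral_comp_mul_left (fun x => Real.exp x) hl.ne', integral_exp,
      smul_eq_mul]
    field_simp
  rw [intervalIntegral.integral_const_mul, hI] at hb
  calc Real.exp (-(l * t)) * _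
      ≤ Real.exp (-(l * t)) * (L * ‖v - v'‖ * (Real.exp (l * t) / l)) := by
        gcongr
        refine hb.trans ?_
        gcongr
        linarith [Real.exp_pos (l * τ)]
    _ = L / l * ‖v - v'‖ := by
        rw [Real.exp_neg]
        field_simp

/-- Existence and uniqueness for Volterra equations. -/
theorem exists_volterraSolution [CompleteSpace V] {τ T L : ℝ} (h : τ ≤ T) (hL : 0 ≤ L)
    (f : C(ℝ, V)) {G : C(ℝ, V) → C(ℝ, V)} (hG : IsCausalLipschitz τ T L G) :
    ∃ w, IsVolterraSolution τ T f G w ∧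
      ∀ z, IsVolterraSolution τ T f G z → EqOn z w (Icc τ T) := by
  -- Any positive l ≥ 2L gives the contraction constant 1/2; the summand 1 keeps l positive when L =
  -- 0.
  set l : ℝ := 2 * L + 1
  have hl : 0 < l := by positivity
  have hcon : ContractingWith (1 / 2) (volterraPicard h l f G) := by
    refine ⟨NNReal.half_lt_self one_ne_zero, LipschitzWith.of_dist_le_mul fun v v' => ?_⟩
    refine (dist_volterraPicard_le h hL hG hl v v').trans ?_
    refine mul_le_mul_of_nonneg_right ?_ dist_nonneg
    rw [NNReal.coe_div, NNReal.coe_one, NNReal.coe_ofNat, div_le_div_iff₀ hl two_pos]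
    linarith
  have hext : ∀ v : C(Icc τ T, V), ∀ t (ht : t ∈ Icc τ T),
      expWeightExtend h l v t = Real.exp (l * t) • v ⟨t, ht⟩ := fun v t ht => by
    simp [expWeightExtend, projIcc_of_mem h ht]
  have : Nonempty C(Icc τ T, V) := ⟨0⟩
  set v := hcon.fixedPoint
  have hv : volterraPicard h l f G v = v := hcon.fixedPoint_isFixedPt
  refine ⟨expWeightExtend h l v, fun t ht => ?_, fun z hz => ?_⟩
  · rw [hext v t ht]
    nth_rw 1 [← hv]
    change Real.exp (l * t) • Real.exp (-(l * t)) •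
      (f t + ∫ r in τ..t, G (expWeightExtend h l v) r) = _
    rw [smul_smul, ← Real.exp_add, add_neg_cancel, Real.exp_zero, one_smul]
  · let v' : C(Icc τ T, V) := ⟨fun t => Real.exp (-(l * t)) • z t, by fun_prop⟩
    have hv'z : ∀ t ∈ Icc τ T, expWeightExtend h l v' t = z t := fun t ht => by
      rw [hext v' t ht]
      change Real.exp (l * t) • Real.exp (-(l * t)) • z t = _
      rw [smul_smul, ← Real.exp_add, add_neg_cancel, Real.exp_zero, one_smul]
    -- Causality with c = 0: `G` at r sees its argument only on [τ, r], so the behaviour of z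
    -- outside [τ, T] is irrelevant.
    have hGz : ∀ r ∈ Icc τ T, G (expWeightExtend h l v') r = G z r := fun r hr => by
      have := hG (expWeightExtend h l v') z r hr 0 fun s hs => by
        simp [hv'z s ⟨hs.1, hs.2.trans hr.2⟩]
      rwa [mul_zero, norm_le_zero_iff, sub_eq_zero] at this
    have hfix : volterraPicard h l f G v' = v' := by
      ext ⟨t, ht⟩
      change Real.exp (-(l * t)) • (f t + ∫ r in τ..t, G (expWeightExtend h l v') r) =
        Real.exp (-(l * t)) • z t
      rw [hz t ht]
      congr 2
      refine intervalIntegral.integral_congr fun r hr => ?_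
      rw [uIcc_of_le ht.1] at hr
      exact hGz r ⟨hr.1, hr.2.trans ht.2⟩
    have hvv : v' = v := hcon.fixedPoint_unique hfix
    intro t ht
    rw [← hv'z t ht, hvv]

end Volterra

/-! ### Bounded operators as a normed star algebra -/

section Operators

/-- The normed star algebra of bounded operators on `V`, with the topology given by its norm. -/
def Oper (V : Type*) [NormedAddCommGroup V] [InnerProductSpace ℝ V] : Type _ := V →L[ℝ] V

namespace Oper

variable {V : Type*} [NormedAddCommGroup V] [InnerProductSpace ℝ V]

noncomputable instance : NormedRing (Oper V) := inferInstanceAs (NormedRing (V →L[ℝ] V))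
noncomputable instance : NormedAlgebra ℝ (Oper V) :=
  inferInstanceAs (NormedAlgebra ℝ (V →L[ℝ] V))
instance [CompleteSpace V] : CompleteSpace (Oper V) :=
  inferInstanceAs (CompleteSpace (V →L[ℝ] V))
noncomputable instance [CompleteSpace V] : StarRing (Oper V) :=
  inferInstanceAs (StarRing (V →L[ℝ] V))
instance [CompleteSpace V] : CStarRing (Oper V) := inferInstanceAs (CStarRing (V →L[ℝ] V))
instance [CompleteSpace V] : StarModule ℝ (Oper V) :=
  inferInstanceAs (StarModule ℝ (V →L[ℝ] V))

instance : FunLike (Oper V) V V := inferInstanceAs (FunLike (V →L[ℝ] V) V V)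

lemma ext {A B : Oper V} (h : ∀ v, A v = B v) : A = B := ContinuousLinearMap.ext h

lemma add_apply (A B : Oper V) (v : V) : (A + B) v = A v + B v := rfl
lemma sub_apply (A B : Oper V) (v : V) : (A - B) v = A v - B v := rfl
lemma mul_apply (A B : Oper V) (v : V) : (A * B) v = A (B v) := rfl
lemma smul_apply (c : ℝ) (A : Oper V) (v : V) : (c • A) v = c • A v := rfl
lemma map_add (A : Oper V) (v w : V) : A (v + w) = A v + A w := ContinuousLinearMap.map_add A v w
lemma map_sub (A : Oper V) (v w : V) : A (v - w) = A v - A w := ContinuousLinearMap.map_sub A v w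
lemma map_smul (A : Oper V) (c : ℝ) (v : V) : A (c • v) = c • A v :=
  ContinuousLinearMap.map_smul A c v
lemma norm_apply_le (A : Oper V) (v : V) : ‖A v‖ ≤ ‖A‖ * ‖v‖ := ContinuousLinearMap.le_opNorm A v
-- Scaling extends the bound from the unit balls to c ‖v‖ ‖w‖, and then v = A w is inserted. This
-- converts bounds on bilinear forms into bounds on kernels.
lemma norm_le_of_inner_le (A : Oper V) {c : ℝ} (hc : 0 ≤ c)
    (h : ∀ v w, ‖v‖ ≤ 1 → ‖w‖ ≤ 1 → |inner ℝ v (A w)| ≤ c) : ‖A‖ ≤ c := by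
  have key : ∀ v w : V, |inner ℝ v (A w)| ≤ c * (‖v‖ * ‖w‖) := fun v w => by
    rcases eq_or_ne v 0 with rfl | hv
    · simp
    rcases eq_or_ne w 0 with rfl | hw
    · have : A (0 : V) = 0 := ContinuousLinearMap.map_zero A
      simp [this]
    have hv' : 0 < ‖v‖ := norm_pos_iff.2 hv
    have hw' : 0 < ‖w‖ := norm_pos_iff.2 hw
    have := h (‖v‖⁻¹ • v) (‖w‖⁻¹ • w) (by rw [norm_smul, norm_inv, norm_norm, inv_mul_cancel₀ (by positivity)])
      (by rw [norm_smul, norm_inv, norm_norm, inv_mul_cancel₀ (by positivity)])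
    rw [map_smul, inner_smul_left, inner_smul_right, abs_mul, abs_mul] at this
    simp only [abs_inv, abs_norm, conj_trivial] at this
    field_simp at this
    linarith
  refine ContinuousLinearMap.opNorm_le_bound (E := V) (F := V) _ hc fun w => ?_
  change ‖A w‖ ≤ _
  rcases eq_or_ne (A w) 0 with h0 | h0
  · rw [h0, norm_zero]; positivity
  have h1 := key (A w) w
  rw [real_inner_self_eq_norm_mul_norm, abs_of_nonneg (by positivity)] at h1
  have h2 : 0 < ‖A w‖ := norm_pos_iff.2 h0
  nlinarith

/-- Evaluation of operators, as a continuous bilinear map. -/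
noncomputable def applyCLM : Oper V →L[ℝ] V →L[ℝ] V :=
  LinearMap.mkContinuous
    { toFun := fun A => (A : V →L[ℝ] V)
      map_add' := fun _ _ => rfl
      map_smul' := fun _ _ => rfl } 1 fun A => by rw [one_mul]; exact le_rfl

@[fun_prop]
lemma continuous_apply {X : Type*} [TopologicalSpace X] {A : X → Oper V} {v : X → V}
    (hA : Continuous A) (hv : Continuous v) : Continuous fun x => A x (v x) :=
  (applyCLM.continuous.comp hA).clm_apply hv

variable [CompleteSpace V]

lemma inner_star_left (A : Oper V) (v w : V) : inner ℝ (star A v) w = inner ℝ v (A w) :=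
  ContinuousLinearMap.adjoint_inner_left (E := V) (F := V) A w v

lemma inner_star_right (A : Oper V) (v w : V) : inner ℝ v (star A w) = inner ℝ (A v) w :=
  ContinuousLinearMap.adjoint_inner_right (E := V) (F := V) A v w

end Oper

end Operators

/-! ### States as functionals on continuous functions -/

section Functionals

variable {V Ω : Type*} [NormedAddCommGroup V] [InnerProductSpace ℝ V]
  [TopologicalSpace Ω] [CompactSpace Ω]

/-- The functional `f ↦ ⟪v, f a⟫`. -/
noncomputable def diracFunctional (a : Ω) (v : V) : C(Ω, V) →L[ℝ] ℝ :=
  innerSL ℝ v ∘L ContinuousMap.evalCLM ℝ a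

omit [CompactSpace Ω] in
@[simp] lemma diracFunctional_apply (a : Ω) (v : V) (f : C(Ω, V)) :
    diracFunctional a v f = inner ℝ v (f a) := rfl

lemma norm_diracFunctional_le (a : Ω) (v : V) : ‖diracFunctional a v‖ ≤ ‖v‖ := by
  refine ContinuousLinearMap.opNorm_le_bound _ (norm_nonneg _) fun f => ?_
  exact (norm_inner_le_norm _ _).trans
    (mul_le_mul_of_nonneg_left (f.norm_coe_le_norm a) (norm_nonneg _))

lemma intervalIntegrable_inner_comp (ι : C(ℝ, Ω)) {g : ℝ → V} {a b : ℝ}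
    (hg : IntervalIntegrable g volume a b) (f : C(Ω, V)) :
    IntervalIntegrable (fun s => inner ℝ (g s) (f (ι s))) volume a b := by
  have hf : Continuous fun s => f (ι s) := by fun_prop
  have hm : AEStronglyMeasurable (fun s => inner ℝ (g s) (f (ι s)))
      (volume.restrict (uIoc a b)) :=
    hg.aestronglyMeasurable_restrict_uIoc.inner hf.aestronglyMeasurable
  refine (hg.norm.mul_const ‖f‖).mono_fun hm (.of_forall fun s => ?_)
  refine (norm_inner_le_norm _ _).trans ?_
  simp only [norm_mul, norm_norm]
  exact mul_le_mul_of_nonneg_left (f.norm_coe_le_norm _) (norm_nonneg _)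

lemma abs_integral_inner_comp_le (ι : C(ℝ, Ω)) {g : ℝ → V} {a b : ℝ}
    (hg : IntervalIntegrable g volume a b) (f : C(Ω, V)) :
    ‖∫ s in a..b, inner ℝ (g s) (f (ι s))‖ ≤ |∫ s in a..b, ‖g s‖| * ‖f‖ := by
  have h := intervalIntegral.norm_integral_le_abs_of_norm_le (a := a) (b := b) (μ := volume)
    (f := fun s => inner ℝ (g s) (f (ι s))) (g := fun s => ‖g s‖ * ‖f‖)
    (.of_forall fun s => (norm_inner_le_norm _ _).trans
      (mul_le_mul_of_nonneg_left (f.norm_coe_le_norm _) (norm_nonneg _)))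
    (hg.norm.mul_const ‖f‖)
  rwa [intervalIntegral.integral_mul_const, abs_mul, abs_norm] at h

/-- The functional `f ↦ ∫_a^b ⟪g s, f (ι s)⟫ ds`. -/
noncomputable def integralFunctional (ι : C(ℝ, Ω)) {g : ℝ → V} {a b : ℝ}
    (hg : IntervalIntegrable g volume a b) : C(Ω, V) →L[ℝ] ℝ :=
  LinearMap.mkContinuous
    { toFun := fun f => ∫ s in a..b, inner ℝ (g s) (f (ι s))
      map_add' := fun f h => by
        simp only [ContinuousMap.add_apply, inner_add_right]
        exact intervalIntegral.integral_add (intervalIntegrable_inner_comp ι hg f)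
          (intervalIntegrable_inner_comp ι hg h)
      map_smul' := fun c f => by
        simp only [ContinuousMap.smul_apply, inner_smul_right, RingHom.id_apply, smul_eq_mul,
          intervalIntegral.integral_const_mul] }
    |∫ s in a..b, ‖g s‖| (abs_integral_inner_comp_le ι hg)

lemma integralFunctional_apply (ι : C(ℝ, Ω)) {g : ℝ → V} {a b : ℝ}
    (hg : IntervalIntegrable g volume a b) (f : C(Ω, V)) :
    integralFunctional ι hg f = ∫ s in a..b, inner ℝ (g s) (f (ι s)) := rfl

lemma norm_integralFunctional_le (ι : C(ℝ, Ω)) {g : ℝ → V} {a b : ℝ}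
    (hg : IntervalIntegrable g volume a b) :
    ‖integralFunctional ι hg‖ ≤ |∫ s in a..b, ‖g s‖| :=
  LinearMap.mkContinuous_norm_le _ (abs_nonneg _) _

/-- The functional `ω₀` at time `τ`, carried along a trajectory `w` up to time `t`. -/
noncomputable def trajectoryFunctional (star : Ω) (ι : C(ℝ, Ω)) (ω₀ : C(Ω, V) →L[ℝ] ℝ)
    (w : C(ℝ, V)) (τ t : ℝ) : C(Ω, V) →L[ℝ] ℝ :=
  ω₀ + diracFunctional star (w t - w τ) + integralFunctional ι (w.continuous.intervalIntegrable τ t)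

/-- The initial functional cancels from increments: only the change of the present value and the
newly acquired memory remain. -/
lemma trajectoryFunctional_sub (star : Ω) (ι : C(ℝ, Ω)) (ω₀ : C(Ω, V) →L[ℝ] ℝ)
    (w : C(ℝ, V)) (τ t r : ℝ) :
    trajectoryFunctional star ι ω₀ w τ r - trajectoryFunctional star ι ω₀ w τ t
      = diracFunctional star (w r - w t)
        + integralFunctional ι (w.continuous.intervalIntegrable t r) := by
  ext f
  have hi : ∀ a b, IntervalIntegrable (fun s => inner ℝ (w s) (f (ι s))) volume a b :=
    fun a b => Continuous.intervalIntegrable (by fun_prop) _ _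
  have h := intervalIntegral.integral_add_adjacent_intervals (hi τ t) (hi t r)
  simp only [trajectoryFunctional, sub_apply, add_apply,
    diracFunctional_apply, integralFunctional_apply, inner_sub_left]
  linarith

lemma trajectoryFunctional_self (star : Ω) (ι : C(ℝ, Ω)) (ω₀ : C(Ω, V) →L[ℝ] ℝ)
    (w : C(ℝ, V)) (τ : ℝ) : trajectoryFunctional star ι ω₀ w τ τ = ω₀ := by
  ext f
  simp [trajectoryFunctional, integralFunctional_apply]

lemma norm_trajectoryFunctional_sub_le (star : Ω) (ι : C(ℝ, Ω)) (ω₀ : C(Ω, V) →L[ℝ] ℝ)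
    (w : C(ℝ, V)) (τ t r : ℝ) :
    ‖trajectoryFunctional star ι ω₀ w τ r - trajectoryFunctional star ι ω₀ w τ t‖
      ≤ ‖w r - w t‖ + |∫ s in t..r, ‖w s‖| := by
  rw [trajectoryFunctional_sub]
  have h1 := norm_diracFunctional_le star (w r - w t)
  have h2 := norm_integralFunctional_le ι (w.continuous.intervalIntegrable (μ := volume) t r)
  have h3 := norm_add_le (diracFunctional star (w r - w t))
    (integralFunctional ι (w.continuous.intervalIntegrable (μ := volume) t r))
  linarith

lemma continuous_trajectoryFunctional (star : Ω) (ι : C(ℝ, Ω)) (ω₀ : C(Ω, V) →L[ℝ] ℝ)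
    (w : C(ℝ, V)) (τ : ℝ) : Continuous (trajectoryFunctional star ι ω₀ w τ) := by
  rw [continuous_iff_continuousAt]
  intro t
  refine (tendsto_iff_norm_sub_tendsto_zero (E := C(Ω, V) →L[ℝ] ℝ)).2 ?_
  refine squeeze_zero (fun r => norm_nonneg (trajectoryFunctional star ι ω₀ w τ r -
    trajectoryFunctional star ι ω₀ w τ t)) (fun r => norm_trajectoryFunctional_sub_le star ι ω₀ w τ t r) ?_
  have h : Continuous fun r => ‖w r - w t‖ + |∫ s in t..r, ‖w s‖| := by
    have := intervalIntegral.continuous_primitive (μ := volume) (f := fun s => ‖w s‖)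
      (fun a b => Continuous.intervalIntegrable (by fun_prop) a b) t
    fun_prop
  have h' := h.tendsto t
  simpa using h'

/-- The test function is fixed for a reason: difference quotients of the memory part are averages of
point masses near ι t, which converge weakly but in general not in norm. -/
lemma hasDerivAt_trajectoryFunctional_apply (star : Ω) (ι : C(ℝ, Ω)) (ω₀ : C(Ω, V) →L[ℝ] ℝ)
    (w : C(ℝ, V)) (τ : ℝ) {t : ℝ} {w' : V} (hw : HasDerivAt w w' t) (f : C(Ω, V)) :
    HasDerivAt (fun r => trajectoryFunctional star ι ω₀ w τ r f)
      (inner ℝ w' (f star) + inner ℝ (w t) (f (ι t))) t := by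
  have h1 : HasDerivAt (fun r => inner ℝ (w r - w τ) (f star)) (inner ℝ w' (f star)) t := by
    simpa using (hw.sub_const (w τ)).inner ℝ (hasDerivAt_const t (f star))
  have h2 : HasDerivAt (fun r => ∫ s in τ..r, inner ℝ (w s) (f (ι s)))
      (inner ℝ (w t) (f (ι t))) t :=
    Continuous.integral_hasStrictDerivAt (by fun_prop) τ t |>.hasDerivAt
  exact ((h1.const_add (ω₀ f)).add h2)

/-! ### Integration of operator-valued kernels against states -/

section Lift

variable [CompleteSpace V]

/-- The function `a ↦ (F a)* v`. -/
noncomputable def adjointApply (F : C(Ω, Oper V)) : V →L[ℝ] C(Ω, V) :=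
  LinearMap.mkContinuous
    { toFun := fun v => ⟨fun a => star (F a) v, by fun_prop⟩
      map_add' := fun v w => by ext a; exact (star (F a)).map_add v w
      map_smul' := fun c v => by ext a; exact (star (F a)).map_smul c v } ‖F‖ fun v => by
    refine (ContinuousMap.norm_le _ (by positivity)).2 fun a => ?_
    refine ((star (F a)).norm_apply_le v).trans ?_
    rw [norm_star]
    exact mul_le_mul_of_nonneg_right (F.norm_coe_le_norm a) (norm_nonneg _)

@[simp] lemma adjointApply_apply (F : C(Ω, Oper V)) (v : V) (a : Ω) :
    adjointApply F v a = star (F a) v := rfl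

lemma norm_adjointApply_le (F : C(Ω, Oper V)) : ‖adjointApply F‖ ≤ ‖F‖ := by
  apply LinearMap.mkContinuous_norm_le
  exact norm_nonneg F

/-- The extension of a functional to operator-valued functions, with values in `V`. -/
noncomputable def liftFunctional :
    (C(Ω, V) →L[ℝ] ℝ) →L[ℝ] C(Ω, Oper V) →L[ℝ] V :=
  LinearMap.mkContinuous₂ (E := C(Ω, V) →L[ℝ] ℝ) (F := C(Ω, Oper V)) (G := V)
    (LinearMap.mk₂ ℝ
      (fun ω F => (InnerProductSpace.toDual ℝ V).symm (ω ∘L adjointApply F))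
      (fun ω₁ ω₂ F => by
        refine ext_inner_right ℝ fun v => ?_
        simp [inner_add_left, InnerProductSpace.toDual_symm_apply])
      (fun c ω F => by
        refine ext_inner_right ℝ fun v => ?_
        simp [inner_smul_left, InnerProductSpace.toDual_symm_apply])
      (fun ω F₁ F₂ => by
        refine ext_inner_right ℝ fun v => ?_
        have : adjointApply (F₁ + F₂) v = adjointApply F₁ v + adjointApply F₂ v := by
          ext a; simp [Oper.add_apply]
        simp [inner_add_left, InnerProductSpace.toDual_symm_apply, this])
      (fun c ω F => by
        refine ext_inner_right ℝ fun v => ?_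
        have : adjointApply (c • F) v = c • adjointApply F v := by
          ext a; simp [Oper.smul_apply]
        simp [inner_smul_left, InnerProductSpace.toDual_symm_apply, this])) 1 (fun ω F => by
    rw [one_mul, LinearMap.mk₂_apply, LinearIsometryEquiv.norm_map]
    exact (ContinuousLinearMap.opNorm_comp_le _ _).trans
      (mul_le_mul_of_nonneg_left (norm_adjointApply_le F) (norm_nonneg _)))

/-- The lifted vector is defined by Riesz representation. Identities for it are proved by pairing
with v and moving the operators to the other side. -/
lemma inner_liftFunctional (ω : C(Ω, V) →L[ℝ] ℝ) (F : C(Ω, Oper V)) (v : V) :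
    inner ℝ (liftFunctional ω F) v = ω (adjointApply F v) :=
  InnerProductSpace.toDual_symm_apply

lemma norm_liftFunctional_le (ω : C(Ω, V) →L[ℝ] ℝ) (F : C(Ω, Oper V)) :
    ‖liftFunctional ω F‖ ≤ ‖ω‖ * ‖F‖ := by
  change ‖(InnerProductSpace.toDual ℝ V).symm (ω ∘L adjointApply F)‖ ≤ _
  rw [LinearIsometryEquiv.norm_map]
  exact (ContinuousLinearMap.opNorm_comp_le _ _).trans
    (mul_le_mul_of_nonneg_left (norm_adjointApply_le F) (norm_nonneg _))

@[simp] lemma liftFunctional_dirac (a : Ω) (v : V) (F : C(Ω, Oper V)) :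
    liftFunctional (diracFunctional a v) F = F a v := by
  refine ext_inner_right ℝ fun x => ?_
  rw [inner_liftFunctional, diracFunctional_apply, adjointApply_apply, Oper.inner_star_right]

omit [CompleteSpace V] in
lemma intervalIntegrable_clm_comp_apply (ι : C(ℝ, Ω)) {g : ℝ → V} {a b : ℝ}
    (hg : IntervalIntegrable g volume a b) (F : C(Ω, Oper V)) :
    IntervalIntegrable (fun s => F (ι s) (g s)) volume a b := by
  have hf : Continuous fun s => F (ι s) := by fun_prop
  have hm : AEStronglyMeasurable (fun s => F (ι s) (g s)) (volume.restrict (uIoc a b)) :=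
    (Oper.applyCLM (V := V)).aestronglyMeasurable_comp₂
      hf.aestronglyMeasurable hg.aestronglyMeasurable_restrict_uIoc
  refine (hg.norm.const_mul ‖F‖).mono_fun hm (.of_forall fun s => ?_)
  refine ((F (ι s)).norm_apply_le _).trans ?_
  simp only [norm_mul, norm_norm]
  exact mul_le_mul_of_nonneg_right (F.norm_coe_le_norm (ι s)) (norm_nonneg (g s))

lemma liftFunctional_integral (ι : C(ℝ, Ω)) {g : ℝ → V} {a b : ℝ}
    (hg : IntervalIntegrable g volume a b) (F : C(Ω, Oper V)) :
    liftFunctional (integralFunctional ι hg) F = ∫ s in a..b, F (ι s) (g s) := by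
  refine ext_inner_right ℝ fun x => ?_
  rw [inner_liftFunctional, integralFunctional_apply, real_inner_comm]
  have h := (innerSL ℝ x).intervalIntegral_comp_comm (intervalIntegrable_clm_comp_apply ι hg F)
  simp only [innerSL_apply_apply] at h
  rw [← h]
  refine intervalIntegral.integral_congr fun s _ => ?_
  simp only [adjointApply_apply]
  rw [Oper.inner_star_right, real_inner_comm]

/-- The function `a ↦ ∫ P(a, b) dω(b)`, for a kernel `P` and a functional `ω`. -/
noncomputable def kernelApply :
    C(Ω × Ω, Oper V) →L[ℝ] (C(Ω, V) →L[ℝ] ℝ) →L[ℝ] C(Ω, V) :=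
  LinearMap.mkContinuous₂ (E := C(Ω × Ω, Oper V)) (F := C(Ω, V) →L[ℝ] ℝ) (G := C(Ω, V))
    (LinearMap.mk₂ ℝ
      (fun P ω => ⟨fun a => liftFunctional ω (P.curry a), by fun_prop⟩)
      (fun P₁ P₂ ω => by
        ext a
        exact map_add (liftFunctional ω) (P₁.curry a) (P₂.curry a))
      (fun c P ω => by
        ext a
        exact map_smul (liftFunctional ω) c (P.curry a))
      (fun P ω₁ ω₂ => by
        ext a
        change liftFunctional (ω₁ + ω₂) (P.curry a) =
          liftFunctional ω₁ (P.curry a) + liftFunctional ω₂ (P.curry a)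
        simp)
      (fun c P ω => by
        ext a
        change liftFunctional (c • ω) (P.curry a) = c • liftFunctional ω (P.curry a)
        simp)) 1 (fun P ω => by
    refine (ContinuousMap.norm_le _ (by positivity)).2 fun a => ?_
    refine (norm_liftFunctional_le ω (P.curry a)).trans ?_
    rw [one_mul, mul_comm]
    refine mul_le_mul_of_nonneg_right ?_ (norm_nonneg ω)
    exact (ContinuousMap.norm_le (P.curry a) (norm_nonneg P)).2 fun b => P.norm_coe_le_norm (a, b))

lemma kernelApply_apply (P : C(Ω × Ω, Oper V)) (ω : C(Ω, V) →L[ℝ] ℝ) (a : Ω) :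
    kernelApply P ω a = liftFunctional ω (P.curry a) := rfl

lemma norm_kernelApply_le (P : C(Ω × Ω, Oper V)) (ω : C(Ω, V) →L[ℝ] ℝ) :
    ‖kernelApply P ω‖ ≤ ‖P‖ * ‖ω‖ := by
  refine (ContinuousMap.norm_le _ (by positivity)).2 fun a => ?_
  refine (norm_liftFunctional_le ω (P.curry a)).trans ?_
  rw [mul_comm]
  refine mul_le_mul_of_nonneg_right ?_ (norm_nonneg ω)
  exact (ContinuousMap.norm_le (P.curry a) (norm_nonneg P)).2 fun b => P.norm_coe_le_norm (a, b)

lemma kernelApply_dirac (P : C(Ω × Ω, Oper V)) (b : Ω) (v : V) (a : Ω) :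
    kernelApply P (diracFunctional b v) a = P (a, b) v := by
  rw [kernelApply_apply, liftFunctional_dirac]; rfl

lemma kernelApply_integral (P : C(Ω × Ω, Oper V)) (ι : C(ℝ, Ω)) {g : ℝ → V} {s t : ℝ}
    (hg : IntervalIntegrable g volume s t) (a : Ω) :
    kernelApply P (integralFunctional ι hg) a = ∫ r in s..t, P (a, ι r) (g r) := by
  rw [kernelApply_apply, liftFunctional_integral]; rfl

/-- A kernel is symmetric if `P(b, a) = P(a, b)*`. -/
def IsSymmKernel (P : C(Ω × Ω, Oper V)) : Prop := ∀ a b, star (P (a, b)) = P (b, a)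

/-- Symmetry lets a point mass change sides, which amounts to Fubini for a point mass against an
arbitrary functional. -/
lemma kernelApply_dirac_comm {P : C(Ω × Ω, Oper V)} (hP : IsSymmKernel P)
    (ω : C(Ω, V) →L[ℝ] ℝ) (a : Ω) (v : V) :
    diracFunctional a v (kernelApply P ω) = ω (kernelApply P (diracFunctional a v)) := by
  rw [diracFunctional_apply, kernelApply_apply, real_inner_comm, inner_liftFunctional]
  congr 1
  ext b
  rw [kernelApply_dirac, adjointApply_apply, ← hP a b]
  rfl

lemma kernelApply_integral_comm {P : C(Ω × Ω, Oper V)} (hP : IsSymmKernel P)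
    (ω : C(Ω, V) →L[ℝ] ℝ) (ι : C(ℝ, Ω)) (w : C(ℝ, V)) (s t : ℝ) :
    integralFunctional ι (w.continuous.intervalIntegrable s t) (kernelApply P ω)
      = ω (kernelApply P (integralFunctional ι (w.continuous.intervalIntegrable s t))) := by
  -- Applying the kernel to the integral functional gives the Bochner integral in C(Ω, V) of its
  -- values on point masses. The functional ω passes under this integral, which reduces the claim to
  -- the Dirac case.
  let Φ : C(ℝ, C(Ω, V)) :=
    ContinuousMap.curry ⟨fun q : ℝ × Ω => P (q.2, ι q.1) (w q.1), by fun_prop⟩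
  have hΦ : IntervalIntegrable Φ volume s t := Φ.continuous.intervalIntegrable _ _
  have h1 : kernelApply P (integralFunctional ι (w.continuous.intervalIntegrable s t))
      = ∫ r in s..t, Φ r := by
    ext a
    rw [kernelApply_integral]
    exact (ContinuousMap.evalCLM ℝ a).intervalIntegral_comp_comm hΦ
  rw [h1, ← ω.intervalIntegral_comp_comm hΦ, integralFunctional_apply]
  refine intervalIntegral.integral_congr fun r _ => ?_
  change diracFunctional (ι r) (w r) (kernelApply P ω) = _
  rw [kernelApply_dirac_comm hP]
  congr 1
  ext a
  rw [kernelApply_dirac]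
  rfl

lemma abs_apply_kernelApply_le (ω ω' : C(Ω, V) →L[ℝ] ℝ) (P : C(Ω × Ω, Oper V)) :
    ‖ω (kernelApply P ω')‖ ≤ ‖ω‖ * ‖ω'‖ * ‖P‖ := by
  refine (ω.le_opNorm _).trans ?_
  calc ‖ω‖ * ‖kernelApply P ω'‖ ≤ ‖ω‖ * (‖P‖ * ‖ω'‖) :=
        mul_le_mul_of_nonneg_left (norm_kernelApply_le P ω') (norm_nonneg ω)
    _ = _ := by ring

/-- The quadratic form `ω ↦ ∬ ⟪dω(a), P(a, b) dω(b)⟫`, as a functional of the kernel `P`. -/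
noncomputable def kernelForm (ω : C(Ω, V) →L[ℝ] ℝ) : C(Ω × Ω, Oper V) →L[ℝ] ℝ :=
  LinearMap.mkContinuous
    { toFun := fun P => ω (kernelApply P ω)
      map_add' := fun P Q => by simp
      map_smul' := fun c P => by simp }
    (‖ω‖ * ‖ω‖) (abs_apply_kernelApply_le ω ω)

lemma kernelForm_apply (ω : C(Ω, V) →L[ℝ] ℝ) (P : C(Ω × Ω, Oper V)) :
    kernelForm ω P = ω (kernelApply P ω) := rfl

/-- The difference splits as b(ω - ω', ω) + b(ω', ω - ω') for the underlying bilinear form b,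
without symmetry. -/
lemma norm_kernelForm_sub_le (ω ω' : C(Ω, V) →L[ℝ] ℝ) :
    ‖kernelForm ω - kernelForm ω'‖ ≤ ‖ω - ω'‖ * (‖ω‖ + ‖ω'‖) := by
  refine ContinuousLinearMap.opNorm_le_bound _
    (mul_nonneg (norm_nonneg (ω - ω')) (add_nonneg (norm_nonneg ω) (norm_nonneg ω'))) fun P => ?_
  have e : (kernelForm ω - kernelForm ω') P
      = (ω - ω') (kernelApply P ω) + ω' (kernelApply P (ω - ω')) := by
    simp [kernelForm_apply]
  rw [e]
  refine (norm_add_le _ _).trans ?_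
  have h1 := abs_apply_kernelApply_le (ω - ω') ω P
  have h2 := abs_apply_kernelApply_le ω' (ω - ω') P
  linarith

end Lift

end Functionals

/-! ### The abstract delay system, its coefficient equations and completion of squares -/

section Systems

/-- A linear control system whose state is a vector-valued distribution on `Ω`: the current state
is located at `star`, the past value at the time `t` at `ι t`. -/
structure DelaySystem (V U Y Ω : Type*) [NormedAddCommGroup V] [InnerProductSpace ℝ V]
    [NormedAddCommGroup U] [InnerProductSpace ℝ U] [NormedAddCommGroup Y] [InnerProductSpace ℝ Y]
    [TopologicalSpace Ω] where
  star : Ω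
  ι : C(ℝ, Ω)
  k : C(ℝ × Ω, Oper V)
  χ : C(Ω, ℝ)
  χ_star : χ star = 1
  χ_ι : ∀ t, χ (ι t) = 0
  B : U →L[ℝ] V
  C : V →L[ℝ] Y

namespace DelaySystem

variable {V U Y Ω : Type*} [NormedAddCommGroup V] [InnerProductSpace ℝ V]
    [NormedAddCommGroup U] [InnerProductSpace ℝ U] [NormedAddCommGroup Y] [InnerProductSpace ℝ Y]
    [TopologicalSpace Ω] [CompactSpace Ω] [CompleteSpace V] [CompleteSpace U] [CompleteSpace Y]
  (S : DelaySystem V U Y Ω)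

/-- The operator `B B*`. -/
noncomputable def BB : Oper V := (S.B ∘L S.B† : V →L[ℝ] V)

/-- The operator `C* C`. -/
noncomputable def CC : Oper V := (S.C† ∘L S.C : V →L[ℝ] V)

omit [CompactSpace Ω] [CompleteSpace Y] in
lemma BB_apply (v : V) : S.BB v = S.B ((S.B†) v) := rfl

omit [CompactSpace Ω] [CompleteSpace U] in
lemma CC_apply (v : V) : S.CC v = (S.C†) (S.C v) := rfl

omit [CompactSpace Ω] [CompleteSpace Y] in
lemma star_BB : Star.star S.BB = S.BB := by
  refine Oper.ext fun v => ext_inner_right ℝ fun w => ?_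
  rw [Oper.inner_star_left, BB_apply, BB_apply, ← ContinuousLinearMap.adjoint_inner_left,
    ContinuousLinearMap.adjoint_inner_right]

omit [CompactSpace Ω] [CompleteSpace U] in
lemma star_CC : Star.star S.CC = S.CC := by
  refine Oper.ext fun v => ext_inner_right ℝ fun w => ?_
  rw [Oper.inner_star_left, CC_apply, CC_apply, ContinuousLinearMap.adjoint_inner_right,
    ContinuousLinearMap.adjoint_inner_left]

/-- The weight `χ` as an operator-valued function. -/
noncomputable def χOp : C(Ω, Oper V) := ⟨fun a => S.χ a • (1 : Oper V), by fun_prop⟩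

/-- The right-hand side of the Riccati equation as a function of `(t, a, b)`. -/
noncomputable def riccatiField (P : C(Ω × Ω, Oper V)) : C(ℝ × (Ω × Ω), Oper V) where
  toFun q := -(Star.star (S.k (q.1, q.2.1)) * P (S.star, q.2.2)
    + Star.star (P (S.star, q.2.1)) * S.k (q.1, q.2.2)
    + S.χ q.2.1 • P (S.ι q.1, q.2.2) + S.χ q.2.2 • Star.star (P (S.ι q.1, q.2.1))
    - Star.star (P (S.star, q.2.1)) * (S.BB * P (S.star, q.2.2))
    + (S.χ q.2.1 * S.χ q.2.2) • S.CC)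
  continuous_toFun := by fun_prop

/-- The right-hand side of the Riccati equation. -/
noncomputable def riccatiRHS (t : ℝ) (P : C(Ω × Ω, Oper V)) : C(Ω × Ω, Oper V) :=
  (S.riccatiField P).curry t

lemma riccatiRHS_apply (t : ℝ) (P : C(Ω × Ω, Oper V)) (a b : Ω) :
    S.riccatiRHS t P (a, b) = -(Star.star (S.k (t, a)) * P (S.star, b)
    + Star.star (P (S.star, a)) * S.k (t, b)
    + S.χ a • P (S.ι t, b) + S.χ b • Star.star (P (S.ι t, a))
    - Star.star (P (S.star, a)) * (S.BB * P (S.star, b))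
    + (S.χ a * S.χ b) • S.CC) := rfl

lemma continuous_riccatiRHS (P : C(Ω × Ω, Oper V)) : Continuous fun t => S.riccatiRHS t P :=
  (S.riccatiField P).curry.continuous

/-- The right-hand side of the equation for the coefficient due to the reference signal, as a
function of `a`. -/
noncomputable def signalRHS (t : ℝ) (P : C(Ω × Ω, Oper V)) (η : V) (x : C(Ω, V)) : C(Ω, V) :=
  -(adjointApply (S.k.curry t) (x S.star) + adjointApply S.χOp (x (S.ι t))
    - adjointApply (P.curry S.star) (S.BB (x S.star)) - adjointApply S.χOp η)

omit [CompleteSpace U] [CompleteSpace Y] in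
lemma adjointApply_χOp_apply (v : V) (a : Ω) : adjointApply S.χOp v a = S.χ a • v := by
  rw [adjointApply_apply]
  change Star.star (S.χ a • (1 : Oper V)) v = _
  rw [star_smul, star_one, Oper.smul_apply, star_trivial]
  rfl

omit [CompleteSpace Y] in
lemma signalRHS_apply (t : ℝ) (P : C(Ω × Ω, Oper V)) (η : V) (x : C(Ω, V)) (a : Ω) :
    S.signalRHS t P η x a = -(Star.star (S.k (t, a)) (x S.star) + S.χ a • x (S.ι t)
      - Star.star (P (S.star, a)) (S.BB (x S.star)) - S.χ a • η) := by
  simp only [signalRHS, ContinuousMap.neg_apply, ContinuousMap.sub_apply, ContinuousMap.add_apply,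
    adjointApply_χOp_apply]
  rfl

omit [CompleteSpace U] [CompleteSpace Y] in
lemma liftFunctional_const_mul (ω : C(Ω, V) →L[ℝ] ℝ) (A : Oper V) (F : C(Ω, Oper V)) :
    liftFunctional ω (ContinuousMap.const Ω A * F) = A (liftFunctional ω F) := by
  refine ext_inner_right ℝ fun v => ?_
  rw [inner_liftFunctional, ← Oper.inner_star_right, inner_liftFunctional]
  congr 1
  ext b
  change Star.star (A * F b) v = Star.star (F b) (Star.star A v)
  rw [star_mul, Oper.mul_apply]

/-- For fixed a, each term is a constant operator times a function of b, so the operator comes out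
of the integration against ω. The remaining integrals are Pω at `star` and at ι t, ∫ k dω and ∫ χ
dω. -/
lemma kernelApply_riccatiRHS (t : ℝ) (P : C(Ω × Ω, Oper V)) (ω : C(Ω, V) →L[ℝ] ℝ) :
    kernelApply (S.riccatiRHS t P) ω
      = -(adjointApply (S.k.curry t) (kernelApply P ω S.star)
        + adjointApply (P.curry S.star) (liftFunctional ω (S.k.curry t))
        + adjointApply S.χOp (kernelApply P ω (S.ι t))
        + adjointApply (P.curry (S.ι t)) (liftFunctional ω S.χOp)
        - adjointApply (P.curry S.star) (S.BB (kernelApply P ω S.star))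
        + adjointApply S.χOp (S.CC (liftFunctional ω S.χOp))) := by
  ext a
  have hcurry : (S.riccatiRHS t P).curry a = -(
      (ContinuousMap.const Ω (Star.star (S.k (t, a))) * P.curry S.star)
      + ContinuousMap.const Ω (Star.star (P (S.star, a))) * S.k.curry t
      + ContinuousMap.const Ω (S.χ a • (1 : Oper V)) * P.curry (S.ι t)
      + ContinuousMap.const Ω (Star.star (P (S.ι t, a))) * S.χOp
      - ContinuousMap.const Ω (Star.star (P (S.star, a)) * S.BB) * P.curry S.star
      + ContinuousMap.const Ω (S.χ a • S.CC) * S.χOp) := by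
    ext b
    change S.riccatiRHS t P (a, b) = _
    rw [riccatiRHS_apply]
    simp only [ContinuousMap.neg_apply, ContinuousMap.sub_apply, ContinuousMap.add_apply,
      ContinuousMap.mul_apply, ContinuousMap.const_apply, ContinuousMap.curry_apply, χOp,
      ContinuousMap.coe_mk, smul_mul_assoc, one_mul, mul_smul_comm, mul_one, mul_assoc, smul_smul,
      mul_comm (S.χ b)]
  rw [kernelApply_apply, hcurry, map_neg, map_add, map_sub, map_add, map_add, map_add,
    liftFunctional_const_mul, liftFunctional_const_mul, liftFunctional_const_mul,
    liftFunctional_const_mul, liftFunctional_const_mul, liftFunctional_const_mul]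
  simp only [ContinuousMap.neg_apply, ContinuousMap.sub_apply, ContinuousMap.add_apply,
    adjointApply_χOp_apply]
  rfl

/-- The quadratic value function in the state `ω`. -/
noncomputable def value (P : C(Ω × Ω, Oper V)) (x : C(Ω, V)) (M : ℝ) (ω : C(Ω, V) →L[ℝ] ℝ) : ℝ :=
  kernelForm ω P + 2 * ω x + M

/-- The costate at the current time. -/
noncomputable def costate (P : C(Ω × Ω, Oper V)) (x : C(Ω, V)) (ω : C(Ω, V) →L[ℝ] ℝ) : C(Ω, V) :=
  kernelApply P ω + x

/-- On the left stands the time derivative of the value along a trajectory: the first three terms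
come from the coefficients, the last from the motion of ω with velocity ∫ k dω + B u and new memory
∫ χ dω at ι t. The drift and memory terms cancel against the coefficient equations. With q = B*(Pω +
x)(star), what is left is 2⟨u, q⟩ + ‖q‖² minus the output cost, which completes to a square. -/
lemma value_derivative_eq (t : ℝ) (P : C(Ω × Ω, Oper V)) (x : C(Ω, V)) (η : Y) (u : U)
    (ω : C(Ω, V) →L[ℝ] ℝ) :
    kernelForm ω (S.riccatiRHS t P) + 2 * ω (S.signalRHS t P ((S.C†) η) x)
      + (‖(S.B†) (x S.star)‖ ^ 2 - ‖η‖ ^ 2)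
      + 2 * (inner ℝ (liftFunctional ω (S.k.curry t) + S.B u) (costate P x ω S.star)
        + inner ℝ (liftFunctional ω S.χOp) (costate P x ω (S.ι t)))
    = ‖u + (S.B†) (costate P x ω S.star)‖ ^ 2
      - (‖S.C (liftFunctional ω S.χOp) - η‖ ^ 2 + ‖u‖ ^ 2) := by
  have hP : ∀ a, liftFunctional ω (P.curry a) = kernelApply P ω a := fun a => rfl
  set q := kernelApply P ω S.star with hq
  set κ := liftFunctional ω (S.k.curry t) with hκ
  set w := liftFunctional ω S.χOp with hw
  have hB : ∀ v v' : V, inner ℝ v (S.BB v') = inner ℝ ((S.B†) v) ((S.B†) v') := fun v v' => by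
    rw [BB_apply, ContinuousLinearMap.adjoint_inner_left]
  have hC : ∀ v v' : V, inner ℝ v (S.CC v') = inner ℝ (S.C v) (S.C v') := fun v v' => by
    rw [CC_apply, ContinuousLinearMap.adjoint_inner_right]
  rw [kernelForm_apply, kernelApply_riccatiRHS, signalRHS]
  simp only [map_neg, map_add, map_sub, ← inner_liftFunctional, hP, ← hq, ← hκ, ← hw, costate,
    ContinuousMap.add_apply, hB, hC, ContinuousLinearMap.adjoint_inner_right]
  rw [norm_add_sq_real, norm_sub_sq_real, ← real_inner_self_eq_norm_sq ((S.B†) q + _),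
    ← real_inner_self_eq_norm_sq ((S.B†) (x S.star)), ← real_inner_self_eq_norm_sq (S.C w)]
  simp only [inner_add_left, inner_add_right, ContinuousLinearMap.adjoint_inner_right, map_add]
  have h1 := real_inner_comm q κ
  have h2 := real_inner_comm (kernelApply P ω (S.ι t)) w
  have h3 := real_inner_comm ((S.B†) q) ((S.B†) (x S.star))
  simp only [ContinuousLinearMap.adjoint_inner_right] at h3
  linarith

end DelaySystem

end Systems

/-! ### Absolute continuity and a weak product rule -/

section AbsoluteContinuity

/-- A function whose increments are controlled by those of an absolutely continuous function is
absolutely continuous. -/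
lemma AbsolutelyContinuousOnInterval.of_dist_le_mul {X Z : Type*} [PseudoMetricSpace X]
    [PseudoMetricSpace Z] {f : ℝ → X} {g : ℝ → Z} {a b c : ℝ}
    (hg : AbsolutelyContinuousOnInterval g a b)
    (h : ∀ r ∈ uIcc a b, ∀ t ∈ uIcc a b, dist (f r) (f t) ≤ c * dist (g r) (g t)) :
    AbsolutelyContinuousOnInterval f a b := by
  have hc := Filter.Tendsto.const_mul c hg
  rw [mul_zero] at hc
  refine squeeze_zero' (.of_forall fun E => Finset.sum_nonneg fun _ _ => dist_nonneg) ?_ hc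
  refine Filter.eventually_inf_principal.2 (.of_forall fun E hE => ?_)
  rw [Finset.mul_sum]
  exact Finset.sum_le_sum fun i hi => h _ (hE.1 i hi).1 _ (hE.1 i hi).2

end AbsoluteContinuity

section ProductRule

/-- Product rule for a family of functionals that is differentiable only pointwise. -/
lemma hasDerivAt_clm_apply_of_pointwise {E : Type*} [NormedAddCommGroup E] [NormedSpace ℝ E]
    {L : ℝ → E →L[ℝ] ℝ} {x : ℝ → E} {x' : E} {l t : ℝ} (hL : ContinuousAt L t)
    (hx : HasDerivAt x x' t) (hl : HasDerivAt (fun r => L r (x t)) l t) :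
    HasDerivAt (fun r => L r (x r)) (l + L t x') t := by
  -- The slopes of x converge in norm and L is norm continuous, so L need not be differentiable in
  -- norm for this term.
  have h : HasDerivAt (fun r => L r (x r - x t)) (L t x') t := by
    rw [hasDerivAt_iff_tendsto_slope] at hx ⊢
    have h1 := (isBoundedBilinearMap_apply.continuous.tendsto (L t, x')).comp
      ((Filter.Tendsto.mono_left hL (nhdsWithin_le_nhds (s := {t}ᶜ))).prodMk_nhds hx)
    refine h1.congr fun r => ?_
    simp [slope_def_module]
  refine (hl.add h).congr_of_eventuallyEq (.of_forall fun r => ?_)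
  simp

end ProductRule

/-! ### Differentiation of the value along trajectories -/

namespace DelaySystem

variable {V U Y Ω : Type*} [NormedAddCommGroup V] [InnerProductSpace ℝ V]
    [NormedAddCommGroup U] [InnerProductSpace ℝ U] [NormedAddCommGroup Y] [InnerProductSpace ℝ Y]
    [TopologicalSpace Ω] [CompactSpace Ω] [CompleteSpace V] [CompleteSpace U] [CompleteSpace Y]
  (S : DelaySystem V U Y Ω)

/-- The state at the time `t` of a trajectory `w` that starts at the time `τ` from `ω₀`. -/
noncomputable def stateAt (ω₀ : C(Ω, V) →L[ℝ] ℝ) (w : C(ℝ, V)) (τ t : ℝ) : C(Ω, V) →L[ℝ] ℝ :=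
  trajectoryFunctional S.star S.ι ω₀ w τ t

/-- `w` is the trajectory on `[τ, T]` of the initial state `ω₀` under the control `u`. -/
structure IsTrajectory (τ T : ℝ) (ω₀ : C(Ω, V) →L[ℝ] ℝ) (u : ℝ → U) (w : C(ℝ, V)) : Prop where
  initial : liftFunctional ω₀ S.χOp = w τ
  equation : ∀ t ∈ Icc τ T, w t = w τ + ∫ r in τ..t,
    (liftFunctional (S.stateAt ω₀ w τ r) (S.k.curry r) + S.B (u r))

omit [CompleteSpace V] [CompleteSpace U] [CompleteSpace Y] in
lemma continuous_stateAt (ω₀ : C(Ω, V) →L[ℝ] ℝ) (w : C(ℝ, V)) (τ : ℝ) :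
    Continuous (S.stateAt ω₀ w τ) := continuous_trajectoryFunctional _ _ _ _ _

omit [CompleteSpace U] [CompleteSpace Y] in
lemma liftFunctional_stateAt (ω₀ : C(Ω, V) →L[ℝ] ℝ) (w : C(ℝ, V)) (τ t : ℝ) (F : C(Ω, Oper V)) :
    liftFunctional (S.stateAt ω₀ w τ t) F
      = liftFunctional ω₀ F + F S.star (w t - w τ) + ∫ s in τ..t, F (S.ι s) (w s) := by
  rw [stateAt, trajectoryFunctional, map_add, map_add, add_apply,
    add_apply, liftFunctional_dirac, liftFunctional_integral]

-- The weight χ vanishes on the memory, so pairing with it reads off the current state.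
omit [CompleteSpace U] [CompleteSpace Y] in
lemma liftFunctional_stateAt_χOp {ω₀ : C(Ω, V) →L[ℝ] ℝ} {w : C(ℝ, V)} {τ : ℝ}
    (h : liftFunctional ω₀ S.χOp = w τ) (t : ℝ) :
    liftFunctional (S.stateAt ω₀ w τ t) S.χOp = w t := by
  have hs : ∀ (a : Ω) (v : V), S.χOp a v = S.χ a • v := fun a v => rfl
  rw [liftFunctional_stateAt, h]
  simp [hs, S.χ_star, S.χ_ι]

-- The quadratic form is expanded about the state at t. By symmetry the two linear terms coincide,
-- whence the factor 2. The increment of the state is O(r - t) in norm, so the quadratic remainder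
-- is O((r - t)²), although the state itself is differentiable only weakly.
omit [CompleteSpace U] [CompleteSpace Y] in
lemma hasDerivAt_kernelForm_stateAt {P : C(Ω × Ω, Oper V)} (hP : IsSymmKernel P)
    (ω₀ : C(Ω, V) →L[ℝ] ℝ) (w : C(ℝ, V)) (τ : ℝ) {t : ℝ} {w' : V} (hw : HasDerivAt w w' t) :
    HasDerivAt (fun r => kernelForm (S.stateAt ω₀ w τ r) P)
      (2 * (inner ℝ w' (kernelApply P (S.stateAt ω₀ w τ t) S.star)
        + inner ℝ (w t) (kernelApply P (S.stateAt ω₀ w τ t) (S.ι t)))) t := by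
  set ω := S.stateAt ω₀ w τ with hω
  have hdiff : ∀ r, ω r - ω t = diracFunctional S.star (w r - w t)
      + integralFunctional S.ι (w.continuous.intervalIntegrable t r) :=
    fun r => trajectoryFunctional_sub _ _ _ _ _ _ _
  have hcomm : ∀ r, (ω r - ω t) (kernelApply P (ω t)) = ω t (kernelApply P (ω r - ω t)) := by
    intro r
    rw [hdiff, add_apply, kernelApply_dirac_comm hP, kernelApply_integral_comm hP,
      map_add, map_add]
  have hexp : ∀ r, kernelForm (ω r) P = kernelForm (ω t) P
      + 2 * (ω r - ω t) (kernelApply P (ω t)) + (ω r - ω t) (kernelApply P (ω r - ω t)) := by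
    intro r
    have h := hcomm r
    simp only [kernelForm_apply, sub_apply, map_sub] at h ⊢
    linarith
  have h1 : HasDerivAt (fun r => (ω r - ω t) (kernelApply P (ω t)))
      (inner ℝ w' (kernelApply P (ω t) S.star) + inner ℝ (w t) (kernelApply P (ω t) (S.ι t))) t :=
    (hasDerivAt_trajectoryFunctional_apply S.star S.ι ω₀ w τ hw _).sub_const _
  have h2 : HasDerivAt (fun r => (ω r - ω t) (kernelApply P (ω r - ω t))) 0 t := by
    rw [hasDerivAt_iff_isLittleO]
    simp only [sub_self, smul_zero, sub_zero, map_zero]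
    have hO : (fun r => ‖ω r - ω t‖) =O[nhds t] fun r => r - t := by
      have hi : HasDerivAt (fun r => ∫ s in t..r, ‖w s‖) ‖w t‖ t :=
        (Continuous.integral_hasStrictDerivAt (by fun_prop) t t).hasDerivAt
      have hi' := hi.isBigO_sub.norm_left
      have hw' := hw.isBigO_sub.norm_left
      simp only [intervalIntegral.integral_same, sub_zero] at hi'
      refine Asymptotics.IsBigO.trans (.of_bound 1 (.of_forall fun r => ?_)) (hw'.add hi')
      rw [one_mul, Real.norm_of_nonneg (norm_nonneg (ω r - ω t)),
        Real.norm_of_nonneg (by positivity)]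
      exact norm_trajectoryFunctional_sub_le _ _ _ _ _ _ _
    have hO2 : (fun r => (ω r - ω t) (kernelApply P (ω r - ω t)))
        =O[nhds t] fun r => (r - t) * (r - t) := by
      refine Asymptotics.IsBigO.trans (.of_bound ‖P‖ (.of_forall fun r => ?_))
        (hO.mul hO)
      refine (abs_apply_kernelApply_le _ _ _).trans ?_
      rw [Real.norm_of_nonneg (mul_nonneg (norm_nonneg (ω r - ω t)) (norm_nonneg (ω r - ω t)))]
      linarith
    refine hO2.trans_isLittleO ?_
    have h0 : (fun r : ℝ => r - t) =o[nhds t] fun _ => (1 : ℝ) := by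
      rw [Asymptotics.isLittleO_one_iff]
      have : Continuous fun r : ℝ => r - t := by fun_prop
      simpa using this.tendsto t
    simpa using h0.mul_isBigO (Asymptotics.isBigO_refl (fun r : ℝ => r - t) (nhds t))
  have h3 := ((h1.const_mul 2).const_add (kernelForm (ω t) P)).add h2
  rw [add_zero] at h3
  exact h3.congr_of_eventuallyEq (.of_forall hexp)

omit [CompleteSpace U] [CompleteSpace Y] in
lemma continuous_kernelForm_stateAt (ω₀ : C(Ω, V) →L[ℝ] ℝ) (w : C(ℝ, V)) (τ : ℝ) :
    Continuous fun r => kernelForm (S.stateAt ω₀ w τ r) := by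
  have hω := S.continuous_stateAt ω₀ w τ
  rw [continuous_iff_continuousAt]
  intro t
  refine (tendsto_iff_norm_sub_tendsto_zero (E := C(Ω × Ω, Oper V) →L[ℝ] ℝ)).2 ?_
  refine squeeze_zero (fun r => norm_nonneg (kernelForm (S.stateAt ω₀ w τ r)
    - kernelForm (S.stateAt ω₀ w τ t))) (fun r => norm_kernelForm_sub_le _ _) ?_
  have h1 : Continuous fun r => ‖S.stateAt ω₀ w τ r - S.stateAt ω₀ w τ t‖ :=
    (continuous_norm (E := C(Ω, V) →L[ℝ] ℝ)).comp (hω.sub continuous_const)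
  have h2 : Continuous fun r => ‖S.stateAt ω₀ w τ r‖ :=
    (continuous_norm (E := C(Ω, V) →L[ℝ] ℝ)).comp hω
  have h0 : ‖S.stateAt ω₀ w τ t - S.stateAt ω₀ w τ t‖ = 0 := by
    rw [sub_self]
    exact norm_zero (E := C(Ω, V) →L[ℝ] ℝ)
  have h := (h1.mul (h2.add continuous_const)).tendsto (f := fun r => ‖S.stateAt ω₀ w τ r -
    S.stateAt ω₀ w τ t‖ * (‖S.stateAt ω₀ w τ r‖ + ‖S.stateAt ω₀ w τ t‖)) t
  rwa [h0, zero_mul] at h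

omit [CompleteSpace U] [CompleteSpace Y] in
lemma hasDerivAt_value_stateAt {P : ℝ → C(Ω × Ω, Oper V)} {x : ℝ → C(Ω, V)} {M : ℝ → ℝ}
    {P' : C(Ω × Ω, Oper V)} {x' : C(Ω, V)} {M' : ℝ} {t : ℝ} (hsymm : IsSymmKernel (P t))
    (hP : HasDerivAt P P' t) (hx : HasDerivAt x x' t) (hM : HasDerivAt M M' t)
    (ω₀ : C(Ω, V) →L[ℝ] ℝ) (w : C(ℝ, V)) (τ : ℝ) {w' : V} (hw : HasDerivAt w w' t) :
    HasDerivAt (fun r => value (P r) (x r) (M r) (S.stateAt ω₀ w τ r))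
      (kernelForm (S.stateAt ω₀ w τ t) P' + 2 * S.stateAt ω₀ w τ t x' + M'
        + 2 * (inner ℝ w' (costate (P t) (x t) (S.stateAt ω₀ w τ t) S.star)
          + inner ℝ (w t) (costate (P t) (x t) (S.stateAt ω₀ w τ t) (S.ι t)))) t := by
  have h1 := hasDerivAt_clm_apply_of_pointwise
    (S.continuous_kernelForm_stateAt ω₀ w τ).continuousAt hP
    (S.hasDerivAt_kernelForm_stateAt hsymm ω₀ w τ hw)
  have h2 := hasDerivAt_clm_apply_of_pointwise (S.continuous_stateAt ω₀ w τ).continuousAt hx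
    (hasDerivAt_trajectoryFunctional_apply S.star S.ι ω₀ w τ hw (x t))
  refine ((h1.add (h2.const_mul 2)).add hM).congr_deriv ?_
  simp only [costate, ContinuousMap.add_apply, inner_add_right]
  ring

end DelaySystem

/-! ### The energy identity -/

lemma exists_dist_le_mul_of_hasDerivWithinAt {E : Type*} [NormedAddCommGroup E] [NormedSpace ℝ E]
    {f f' : ℝ → E} {a b : ℝ} (hf : ∀ t ∈ Icc a b, HasDerivWithinAt f (f' t) (Icc a b) t)
    (hf' : ContinuousOn f' (Icc a b)) :
    ∃ c, 0 ≤ c ∧ ∀ r ∈ Icc a b, ∀ t ∈ Icc a b, ‖f r - f t‖ ≤ c * |r - t| := by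
  obtain ⟨c, hc⟩ := isCompact_Icc.exists_bound_of_continuousOn hf'
  refine ⟨max c 0, le_max_right _ _, fun r hr t ht => ?_⟩
  exact (convex_Icc a b).norm_image_sub_le_of_norm_hasDerivWithin_le hf
    (fun s hs => (hc s hs).trans (le_max_left _ _)) ht hr

namespace DelaySystem

variable {V U Y Ω : Type*} [NormedAddCommGroup V] [InnerProductSpace ℝ V]
    [NormedAddCommGroup U] [InnerProductSpace ℝ U] [NormedAddCommGroup Y] [InnerProductSpace ℝ Y]
    [TopologicalSpace Ω] [CompactSpace Ω] [CompleteSpace V] [CompleteSpace U] [CompleteSpace Y]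
  (S : DelaySystem V U Y Ω)

/-- `P`, `x`, `M` solve on `[a, T]` the equations of the coefficients of the value function, for
the reference signal `y`. -/
structure IsValueSolution (a T : ℝ) (y : ℝ → Y) (P : ℝ → C(Ω × Ω, Oper V)) (x : ℝ → C(Ω, V))
    (M : ℝ → ℝ) : Prop where
  kernel : ∀ t ∈ Icc a T, HasDerivWithinAt P (S.riccatiRHS t (P t)) (Icc a T) t
  symm : ∀ t ∈ Icc a T, IsSymmKernel (P t)
  signal : ∀ t ∈ Icc a T,
    HasDerivWithinAt x (S.signalRHS t (P t) ((S.C†) (y t)) (x t)) (Icc a T) t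
  const : ∀ t ∈ Icc a T,
    HasDerivWithinAt M (‖(S.B†) (x t S.star)‖ ^ 2 - ‖y t‖ ^ 2) (Icc a T) t

lemma IsValueSolution.mono {S : DelaySystem V U Y Ω} {a b T : ℝ} {y : ℝ → Y}
    {P : ℝ → C(Ω × Ω, Oper V)} {x : ℝ → C(Ω, V)} {M : ℝ → ℝ} (hab : a ≤ b)
    (h : S.IsValueSolution a T y P x M) : S.IsValueSolution b T y P x M where
  kernel t ht := (h.kernel t ⟨hab.trans ht.1, ht.2⟩).mono (Icc_subset_Icc_left hab)
  symm t ht := h.symm t ⟨hab.trans ht.1, ht.2⟩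
  signal t ht := (h.signal t ⟨hab.trans ht.1, ht.2⟩).mono (Icc_subset_Icc_left hab)
  const t ht := (h.const t ⟨hab.trans ht.1, ht.2⟩).mono (Icc_subset_Icc_left hab)

section Continuity

variable [T2Space Ω]

lemma continuous_riccatiRHS_uncurry :
    Continuous fun q : ℝ × C(Ω × Ω, Oper V) => S.riccatiRHS q.1 q.2 := by
  refine ContinuousMap.continuous_of_continuous_uncurry _ ?_
  change Continuous fun q : (ℝ × C(Ω × Ω, Oper V)) × (Ω × Ω) => S.riccatiRHS q.1.1 q.1.2 q.2
  have h : ∀ q : (ℝ × C(Ω × Ω, Oper V)) × (Ω × Ω), S.riccatiRHS q.1.1 q.1.2 q.2 = _ :=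
    fun q => S.riccatiRHS_apply q.1.1 q.1.2 q.2.1 q.2.2
  simp only [h]
  fun_prop

omit [CompleteSpace Y] in
lemma continuous_signalRHS_uncurry :
    Continuous fun q : ℝ × C(Ω × Ω, Oper V) × V × C(Ω, V) =>
      S.signalRHS q.1 q.2.1 q.2.2.1 q.2.2.2 := by
  refine ContinuousMap.continuous_of_continuous_uncurry _ ?_
  change Continuous fun q : (ℝ × C(Ω × Ω, Oper V) × V × C(Ω, V)) × Ω =>
    S.signalRHS q.1.1 q.1.2.1 q.1.2.2.1 q.1.2.2.2 q.2
  simp only [signalRHS_apply]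
  fun_prop

end Continuity

variable {S}

section Energy

variable [T2Space Ω] {τ T : ℝ} {y : ℝ → Y} {P : ℝ → C(Ω × Ω, Oper V)} {x : ℝ → C(Ω, V)}
  {M : ℝ → ℝ} {ω₀ : C(Ω, V) →L[ℝ] ℝ} {u : ℝ → U} {w : C(ℝ, V)}

omit [T2Space Ω] in
lemma IsValueSolution.continuousOn_kernel (h : S.IsValueSolution τ T y P x M) :
    ContinuousOn P (Icc τ T) := fun t ht => (h.kernel t ht).continuousWithinAt

omit [T2Space Ω] in
lemma IsValueSolution.continuousOn_signal (h : S.IsValueSolution τ T y P x M) :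
    ContinuousOn x (Icc τ T) := fun t ht => (h.signal t ht).continuousWithinAt

lemma IsValueSolution.continuousOn_riccatiRHS (h : S.IsValueSolution τ T y P x M) :
    ContinuousOn (fun t => S.riccatiRHS t (P t)) (Icc τ T) := by
  have h1 : ContinuousOn (fun t => (t, P t)) (Icc τ T) :=
    continuousOn_id.prodMk h.continuousOn_kernel
  have h2 := S.continuous_riccatiRHS_uncurry
  generalize S.riccatiRHS = F at h2 ⊢
  exact h2.comp_continuousOn h1

lemma IsValueSolution.continuousOn_signalRHS (h : S.IsValueSolution τ T y P x M)
    (hy : ContinuousOn y (Icc τ T)) :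
    ContinuousOn (fun t => S.signalRHS t (P t) ((S.C†) (y t)) (x t)) (Icc τ T) := by
  have h0 : ContinuousOn (fun t => (S.C†) (y t)) (Icc τ T) :=
    (S.C†).continuous.comp_continuousOn hy
  have h1 : ContinuousOn (fun t => (t, P t, (S.C†) (y t), x t)) (Icc τ T) :=
    continuousOn_id.prodMk (h.continuousOn_kernel.prodMk (h0.prodMk h.continuousOn_signal))
  have h2 := S.continuous_signalRHS_uncurry
  generalize S.signalRHS = F at h2 ⊢
  exact h2.comp_continuousOn h1

omit [T2Space Ω] in
lemma IsValueSolution.continuousOn_const (h : S.IsValueSolution τ T y P x M)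
    (hy : ContinuousOn y (Icc τ T)) :
    ContinuousOn (fun t => ‖(S.B†) (x t S.star)‖ ^ 2 - ‖y t‖ ^ 2) (Icc τ T) := by
  have h0 : Continuous fun z : C(Ω, V) => (S.B†) (z S.star) :=
    (S.B†).continuous.comp (continuous_eval_const S.star)
  have h1 : ContinuousOn (fun t => (S.B†) (x t S.star)) (Icc τ T) :=
    h0.comp_continuousOn h.continuousOn_signal
  exact (h1.norm.pow 2).sub (hy.norm.pow 2)

omit [T2Space Ω] [CompleteSpace U] [CompleteSpace Y] in
lemma intervalIntegrable_drift (hτ : τ ≤ T) (hu : IntervalIntegrable u volume τ T)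
    (ω₀ : C(Ω, V) →L[ℝ] ℝ) (w : C(ℝ, V)) :
    IntervalIntegrable (fun r => liftFunctional (S.stateAt ω₀ w τ r) (S.k.curry r) + S.B (u r))
      volume τ T := by
  have h1 : Continuous fun r => liftFunctional (S.stateAt ω₀ w τ r) (S.k.curry r) :=
    (liftFunctional.continuous.comp (S.continuous_stateAt ω₀ w τ)).clm_apply
      S.k.curry.continuous
  refine (h1.intervalIntegrable _ _).add ?_
  rw [intervalIntegrable_iff_integrableOn_Ioc_of_le hτ] at hu ⊢
  exact S.B.integrable_comp hu

omit [T2Space Ω] [CompleteSpace U] [CompleteSpace Y] in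
lemma abs_value_sub_le (P Q : C(Ω × Ω, Oper V)) (x z : C(Ω, V)) (M N : ℝ)
    (ω ω' : C(Ω, V) →L[ℝ] ℝ) :
    |value P x M ω - value Q z N ω'| ≤ ‖ω‖ * ‖ω‖ * ‖P - Q‖ + ‖ω - ω'‖ * (‖ω‖ + ‖ω'‖) * ‖Q‖
      + 2 * (‖ω‖ * ‖x - z‖) + 2 * (‖ω - ω'‖ * ‖z‖) + |M - N| := by
  have e : value P x M ω - value Q z N ω'
      = kernelForm ω (P - Q) + (kernelForm ω - kernelForm ω') Q
        + 2 * ω (x - z) + 2 * (ω - ω') z + (M - N) := by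
    simp only [value, map_sub, sub_apply]
    ring
  have t1 : |kernelForm ω (P - Q)| ≤ ‖ω‖ * ‖ω‖ * ‖P - Q‖ := abs_apply_kernelApply_le ω ω _
  have t2 : |(kernelForm ω - kernelForm ω') Q| ≤ ‖ω - ω'‖ * (‖ω‖ + ‖ω'‖) * ‖Q‖ :=
    ((kernelForm ω - kernelForm ω').le_opNorm Q).trans
      (mul_le_mul_of_nonneg_right (norm_kernelForm_sub_le ω ω') (norm_nonneg Q))
  have t3 : |ω (x - z)| ≤ ‖ω‖ * ‖x - z‖ := ω.le_opNorm _
  have t4 : |(ω - ω') z| ≤ ‖ω - ω'‖ * ‖z‖ := (ω - ω').le_opNorm _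
  rw [e]
  generalize kernelForm ω (P - Q) = k1 at *
  generalize (kernelForm ω - kernelForm ω') Q = k2 at *
  generalize ω (x - z) = k3 at *
  generalize (ω - ω') z = k4 at *
  have a1 := abs_add_le (k1 + k2 + 2 * k3 + 2 * k4) (M - N)
  have a2 := abs_add_le (k1 + k2 + 2 * k3) (2 * k4)
  have a3 := abs_add_le (k1 + k2) (2 * k3)
  have a4 := abs_add_le k1 k2
  rw [abs_mul, abs_two] at a2 a3
  linarith

/-- For an integrable control the trajectory is merely absolutely continuous, so the fundamental
theorem of calculus needs this property of the value. Its increments are dominated by those of ∫ (1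
+ ‖g‖), where g is the right-hand side of the state equation: the summand 1 pays for the Lipschitz
coefficients and the new memory, ‖g‖ for the present value. -/
lemma absolutelyContinuousOnInterval_value (hτ : τ ≤ T) (hy : ContinuousOn y (Icc τ T))
    (h : S.IsValueSolution τ T y P x M) (hu : IntervalIntegrable u volume τ T)
    (hw : S.IsTrajectory τ T ω₀ u w) :
    AbsolutelyContinuousOnInterval
      (fun t => value (P t) (x t) (M t) (S.stateAt ω₀ w τ t)) τ T := by
  have hPc := h.continuousOn_kernel
  have hxc := h.continuousOn_signal
  obtain ⟨cP, hcP0, hcP⟩ := exists_dist_le_mul_of_hasDerivWithinAt h.kernel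
    h.continuousOn_riccatiRHS
  obtain ⟨cx, hcx0, hcx⟩ := exists_dist_le_mul_of_hasDerivWithinAt h.signal
    (h.continuousOn_signalRHS hy)
  obtain ⟨cM, hcM0, hcM⟩ := exists_dist_le_mul_of_hasDerivWithinAt h.const
    (h.continuousOn_const hy)
  obtain ⟨bP, hbP⟩ := isCompact_Icc.exists_bound_of_continuousOn hPc
  obtain ⟨bx, hbx⟩ := isCompact_Icc.exists_bound_of_continuousOn hxc
  obtain ⟨bw, hbw⟩ := (isCompact_Icc (a := τ) (b := T)).exists_bound_of_continuousOn
    w.continuous.continuousOn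
  obtain ⟨bω, hbω⟩ := (isCompact_Icc (a := τ) (b := T)).exists_bound_of_continuousOn
    (E := C(Ω, V) →L[ℝ] ℝ) (S.continuous_stateAt ω₀ w τ).continuousOn
  have hτm : τ ∈ Icc τ T := ⟨le_rfl, hτ⟩
  have hbP0 : 0 ≤ bP := (norm_nonneg _).trans (hbP τ hτm)
  have hbx0 : 0 ≤ bx := (norm_nonneg _).trans (hbx τ hτm)
  have hbw0 : 0 ≤ bw := (norm_nonneg _).trans (hbw τ hτm)
  have hbω0 : 0 ≤ bω := (norm_nonneg (S.stateAt ω₀ w τ τ)).trans (hbω τ hτm)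
  set g : ℝ → V := fun r => liftFunctional (S.stateAt ω₀ w τ r) (S.k.curry r) + S.B (u r) with hg
  have hgi : IntervalIntegrable g volume τ T := intervalIntegrable_drift hτ hu ω₀ w
  have hGi : IntervalIntegrable (fun r => 1 + ‖g r‖) volume τ T :=
    (intervalIntegrable_const).add hgi.norm
  have hG := hGi.absolutelyContinuousOnInterval_intervalIntegral (c := τ) left_mem_uIcc
  have hsub : ∀ {q : ℝ → ℝ} {r t}, IntervalIntegrable q volume τ T → r ∈ Icc τ T → t ∈ Icc τ T →
      IntervalIntegrable q volume r t := fun hq hr ht =>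
    hq.mono_set (uIcc_subset_uIcc (by rwa [uIcc_of_le hτ]) (by rwa [uIcc_of_le hτ]))
  -- The constant collects the terms of `abs_value_sub_le`, the state being bounded by bω and its
  -- increment by (1 + bw) times that of the dominating integral.
  refine hG.of_dist_le_mul (c := bω * bω * cP + (2 * bω * bP + 2 * bx) * (1 + bw)
    + 2 * bω * cx + cM) ?_
  rw [uIcc_of_le hτ]
  -- it suffices to treat ordered pairs
  have key : ∀ r ∈ Icc τ T, ∀ t ∈ Icc τ T, t ≤ r →
      dist (value (P r) (x r) (M r) (S.stateAt ω₀ w τ r))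
        (value (P t) (x t) (M t) (S.stateAt ω₀ w τ t))
      ≤ (bω * bω * cP + (2 * bω * bP + 2 * bx) * (1 + bw) + 2 * bω * cx + cM)
        * dist (∫ s in τ..r, (1 + ‖g s‖)) (∫ s in τ..t, (1 + ‖g s‖)) := by
    intro r hr t ht htr
    have hI : (∫ s in τ..r, (1 + ‖g s‖)) - ∫ s in τ..t, (1 + ‖g s‖) = ∫ s in t..r, (1 + ‖g s‖) :=
      intervalIntegral.integral_interval_sub_left (hsub hGi hτm hr) (hsub hGi hτm ht)
    have hI' : ∫ s in t..r, (1 + ‖g s‖) = (r - t) + ∫ s in t..r, ‖g s‖ := by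
      rw [intervalIntegral.integral_add intervalIntegrable_const (hsub hgi.norm ht hr)]
      simp
    have hgn : 0 ≤ ∫ s in t..r, ‖g s‖ :=
      intervalIntegral.integral_nonneg htr fun _ _ => norm_nonneg _
    have hrt : 0 ≤ r - t := sub_nonneg.2 htr
    rw [Real.dist_eq, Real.dist_eq, hI, hI', abs_of_nonneg (add_nonneg hrt hgn)]
    set D := (r - t) + ∫ s in t..r, ‖g s‖ with hD
    have hrtD : |r - t| ≤ D := by rw [abs_of_nonneg hrt]; linarith
    have hD0 : 0 ≤ D := by linarith
    have hwD : ‖w r - w t‖ ≤ ∫ s in t..r, ‖g s‖ := by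
      rw [hw.equation r hr, hw.equation t ht, add_sub_add_left_eq_sub,
        intervalIntegral.integral_interval_sub_left]
      · exact intervalIntegral.norm_integral_le_integral_norm htr
      · exact hgi.mono_set (uIcc_subset_uIcc left_mem_uIcc (by rwa [uIcc_of_le hτ]))
      · exact hgi.mono_set (uIcc_subset_uIcc left_mem_uIcc (by rwa [uIcc_of_le hτ]))
    have hwi : |∫ s in t..r, ‖w s‖| ≤ bw * |r - t| := by
      rw [← Real.norm_eq_abs]
      refine intervalIntegral.norm_integral_le_of_norm_le_const fun s hs => ?_
      rw [uIoc_of_le htr] at hs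
      rw [norm_norm]
      exact hbw s ⟨ht.1.trans hs.1.le, hs.2.trans hr.2⟩
    have hωD : ‖S.stateAt ω₀ w τ r - S.stateAt ω₀ w τ t‖ ≤ (1 + bw) * D := by
      refine (norm_trajectoryFunctional_sub_le _ _ _ _ _ _ _).trans ?_
      nlinarith [mul_le_mul_of_nonneg_left hrtD hbw0]
    have nr := hbω r hr
    have nt := hbω t ht
    have hPD : ‖P r - P t‖ ≤ cP * D := (hcP r hr t ht).trans (by gcongr)
    have hxD : ‖x r - x t‖ ≤ cx * D := (hcx r hr t ht).trans (by gcongr)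
    have hMD : |M r - M t| ≤ cM * D := (hcM r hr t ht).trans (by gcongr)
    have n0r := norm_nonneg (S.stateAt ω₀ w τ r)
    have n0t := norm_nonneg (S.stateAt ω₀ w τ t)
    have n0 := norm_nonneg (S.stateAt ω₀ w τ r - S.stateAt ω₀ w τ t)
    have hmain := abs_value_sub_le (P r) (P t) (x r) (x t) (M r) (M t)
      (S.stateAt ω₀ w τ r) (S.stateAt ω₀ w τ t)
    generalize ‖S.stateAt ω₀ w τ r - S.stateAt ω₀ w τ t‖ = δ at *
    generalize ‖S.stateAt ω₀ w τ r‖ = ρ at *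
    generalize ‖S.stateAt ω₀ w τ t‖ = σ at *
    have hPt := hbP t ht
    have hxt := hbx t ht
    refine hmain.trans ?_
    calc ρ * ρ * ‖P r - P t‖ + δ * (ρ + σ) * ‖P t‖ + 2 * (ρ * ‖x r - x t‖) + 2 * (δ * ‖x t‖)
          + |M r - M t|
        ≤ bω * bω * (cP * D) + (1 + bw) * D * (bω + bω) * bP + 2 * (bω * (cx * D))
          + 2 * ((1 + bw) * D * bx) + cM * D := by gcongr
      _ = _ := by ring
  intro r hr t ht
  rcases le_total t r with htr | htr
  · exact key r hr t ht htr
  · rw [dist_comm, dist_comm (∫ s in τ..r, (1 + ‖g s‖))]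
    exact key t ht r hr htr

/-- The energy identity. -/
theorem value_sub_value_eq_integral (hτ : τ ≤ T) (hy : ContinuousOn y (Icc τ T))
    (h : S.IsValueSolution τ T y P x M) (hu : IntervalIntegrable u volume τ T)
    (hw : S.IsTrajectory τ T ω₀ u w) :
    value (P T) (x T) (M T) (S.stateAt ω₀ w τ T) - value (P τ) (x τ) (M τ) ω₀
      = ∫ t in τ..T, (‖u t + (S.B†) (costate (P t) (x t) (S.stateAt ω₀ w τ t) S.star)‖ ^ 2
        - (‖S.C (w t) - y t‖ ^ 2 + ‖u t‖ ^ 2)) := by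
  have hAC := absolutelyContinuousOnInterval_value hτ hy h hu hw
  have hself : S.stateAt ω₀ w τ τ = ω₀ := trajectoryFunctional_self _ _ _ _ _
  have hFTC := hAC.integral_deriv_eq_sub
  simp only [hself] at hFTC
  rw [← hFTC]
  refine intervalIntegral.integral_congr_ae ?_
  have hae := (intervalIntegrable_drift (S := S) hτ hu ω₀ w).ae_hasDerivAt_integral
  -- Two-sided derivatives need interior points; the left end τ is already excluded by the half-open
  -- interval.
  have hne : ∀ᵐ t : ℝ, t ≠ T := by simp [ae_iff, measure_singleton]
  filter_upwards [hae, hne] with t ht htT htm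
  rw [uIoc_of_le hτ] at htm
  have htI : t ∈ Icc τ T := ⟨htm.1.le, htm.2⟩
  have hnhds : Icc τ T ∈ nhds t := Icc_mem_nhds htm.1 (lt_of_le_of_ne htm.2 htT)
  have hwt := (ht (by rwa [uIcc_of_le hτ]) τ left_mem_uIcc).const_add (w τ)
  have hwt' := hwt.congr_of_eventuallyEq (f₁ := w)
    (by filter_upwards [hnhds] with r hr using hw.equation r hr)
  have hd := S.hasDerivAt_value_stateAt (h.symm t htI) ((h.kernel t htI).hasDerivAt hnhds)
    ((h.signal t htI).hasDerivAt hnhds) ((h.const t htI).hasDerivAt hnhds) ω₀ w τ hwt'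
  rw [hd.deriv]
  have hv := S.value_derivative_eq t (P t) (x t) (y t) (u t) (S.stateAt ω₀ w τ t)
  rw [S.liftFunctional_stateAt_χOp hw.initial] at hv
  exact hv

end Energy

end DelaySystem

/-! ### Open-loop and closed-loop trajectories -/

namespace DelaySystem

variable {V U Y Ω : Type*} [NormedAddCommGroup V] [InnerProductSpace ℝ V]
    [NormedAddCommGroup U] [InnerProductSpace ℝ U] [NormedAddCommGroup Y] [InnerProductSpace ℝ Y]
    [TopologicalSpace Ω] [CompactSpace Ω] [CompleteSpace V] [CompleteSpace U] [CompleteSpace Y]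
  (S : DelaySystem V U Y Ω)

section Trajectories

variable {τ T : ℝ}

-- This supplies the causal Lipschitz condition. The 2 comes from the point mass, whose coefficient
-- contains both w r and w τ, and T - τ from the memory.
omit [CompleteSpace V] [CompleteSpace U] [CompleteSpace Y] in
lemma norm_stateAt_sub_stateAt_le (ω₀ : C(Ω, V) →L[ℝ] ℝ) (w z : C(ℝ, V)) {r c : ℝ} (hr : r ∈ Icc τ T)
    (h : ∀ s ∈ Icc τ r, ‖w s - z s‖ ≤ c) :
    ‖S.stateAt ω₀ w τ r - S.stateAt ω₀ z τ r‖ ≤ (2 + (T - τ)) * c := by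
  have e : S.stateAt ω₀ w τ r - S.stateAt ω₀ z τ r
      = diracFunctional S.star ((w r - z r) - (w τ - z τ))
        + integralFunctional S.ι ((w - z).continuous.intervalIntegrable τ r) := by
    ext f
    have hi : ∀ w : C(ℝ, V), IntervalIntegrable (fun s => inner ℝ (w s) (f (S.ι s))) volume τ r :=
      fun w => Continuous.intervalIntegrable (by fun_prop) _ _
    have h := intervalIntegral.integral_sub (hi w) (hi z)
    simp only [stateAt, trajectoryFunctional, sub_apply, add_apply,
      diracFunctional_apply, integralFunctional_apply, inner_sub_left, ContinuousMap.sub_apply]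
      at h ⊢
    linarith
  have hτ : τ ≤ r := hr.1
  have hc : 0 ≤ c := (norm_nonneg _).trans (h τ ⟨le_rfl, hτ⟩)
  have h1 : ‖diracFunctional S.star ((w r - z r) - (w τ - z τ))‖ ≤ 2 * c := by
    refine (norm_diracFunctional_le _ _).trans ((norm_sub_le _ _).trans ?_)
    linarith [h r ⟨hτ, le_rfl⟩, h τ ⟨le_rfl, hτ⟩]
  have h2 : ‖integralFunctional S.ι ((w - z).continuous.intervalIntegrable (μ := volume) τ r)‖
      ≤ (T - τ) * c := by
    refine (norm_integralFunctional_le _ _).trans ?_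
    rw [← Real.norm_eq_abs]
    refine (intervalIntegral.norm_integral_le_of_norm_le_const (C := c) fun s hs => ?_).trans ?_
    · rw [uIoc_of_le hτ] at hs
      rw [norm_norm]
      exact h s ⟨hs.1.le, hs.2⟩
    · rw [abs_of_nonneg (sub_nonneg.2 hτ), mul_comm]
      exact mul_le_mul_of_nonneg_right (by linarith [hr.2]) hc
  rw [e]
  refine (norm_add_le (diracFunctional S.star ((w r - z r) - (w τ - z τ))) _).trans ?_
  linarith

omit [CompleteSpace V] [CompleteSpace U] [CompleteSpace Y] in
lemma stateAt_congr (ω₀ : C(Ω, V) →L[ℝ] ℝ) {w z : C(ℝ, V)} (h : EqOn w z (Icc τ T)) {r : ℝ}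
    (hr : r ∈ Icc τ T) : S.stateAt ω₀ w τ r = S.stateAt ω₀ z τ r := by
  have h0 := S.norm_stateAt_sub_stateAt_le (c := 0) ω₀ w z hr fun s hs => by
    rw [h ⟨hs.1, hs.2.trans hr.2⟩, sub_self, norm_zero]
  rw [mul_zero] at h0
  exact sub_eq_zero.1 (norm_le_zero_iff.1 h0)

omit [CompleteSpace U] [CompleteSpace Y] in
/-- Existence and uniqueness for Volterra equations driven by a functional of the state. -/
lemma exists_stateVolterra (hτ : τ ≤ T) (ω₀ : C(Ω, V) →L[ℝ] ℝ) (κ : C(ℝ, C(Ω, Oper V)))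
    (f : C(ℝ, V)) :
    ∃ w : C(ℝ, V),
      (∀ t ∈ Icc τ T, w t = f t + ∫ r in τ..t, liftFunctional (S.stateAt ω₀ w τ r) (κ r)) ∧
      ∀ z : C(ℝ, V),
        (∀ t ∈ Icc τ T, z t = f t + ∫ r in τ..t, liftFunctional (S.stateAt ω₀ z τ r) (κ r)) →
          EqOn z w (Icc τ T) := by
  obtain ⟨c, hc⟩ := (isCompact_Icc (a := τ) (b := T)).exists_bound_of_continuousOn
    κ.continuous.continuousOn
  have hc0 : 0 ≤ c := (norm_nonneg _).trans (hc τ ⟨le_rfl, hτ⟩)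
  let G : C(ℝ, V) → C(ℝ, V) := fun w =>
    ⟨fun r => liftFunctional (S.stateAt ω₀ w τ r) (κ r),
      (liftFunctional.continuous.comp (S.continuous_stateAt ω₀ w τ)).clm_apply κ.continuous⟩
  have hG : IsCausalLipschitz τ T ((2 + (T - τ)) * c) G := by
    intro w z r hr e he
    change ‖liftFunctional (S.stateAt ω₀ w τ r) (κ r) - liftFunctional (S.stateAt ω₀ z τ r) (κ r)‖
      ≤ _
    rw [← sub_apply, ← map_sub]
    refine (norm_liftFunctional_le _ _).trans ?_
    have h1 := S.norm_stateAt_sub_stateAt_le ω₀ w z hr he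
    have h2 := hc r hr
    have h3 := norm_nonneg (S.stateAt ω₀ w τ r - S.stateAt ω₀ z τ r)
    generalize ‖S.stateAt ω₀ w τ r - S.stateAt ω₀ z τ r‖ = δ at *
    calc δ * ‖κ r‖ ≤ ((2 + (T - τ)) * e) * c :=
          mul_le_mul h1 h2 (norm_nonneg _) (h3.trans h1)
      _ = _ := by ring
  have hL : 0 ≤ (2 + (T - τ)) * c := mul_nonneg (by linarith) hc0
  exact exists_volterraSolution hτ hL f hG

omit [CompleteSpace U] [CompleteSpace Y] in
/-- Every control determines the trajectory. -/
theorem exists_trajectory (hτ : τ ≤ T) (ω₀ : C(Ω, V) →L[ℝ] ℝ) {u : ℝ → U}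
    (hu : IntervalIntegrable u volume τ T) :
    ∃ w : C(ℝ, V), S.IsTrajectory τ T ω₀ u w ∧
      ∀ z, S.IsTrajectory τ T ω₀ u z → EqOn z w (Icc τ T) := by
  have hBu : IntervalIntegrable (fun r => S.B (u r)) volume τ T := by
    rw [intervalIntegrable_iff_integrableOn_Ioc_of_le hτ] at hu ⊢
    exact S.B.integrable_comp hu
  have hsub : ∀ {t}, t ∈ Icc τ T → uIcc τ t ⊆ uIcc τ T := fun ht =>
    uIcc_subset_uIcc left_mem_uIcc (by rwa [uIcc_of_le hτ])
  have hcont : ContinuousOn (fun t => ∫ r in τ..t, S.B (u r)) (Icc τ T) := by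
    have := intervalIntegral.continuousOn_primitive_interval' hBu left_mem_uIcc
    rwa [uIcc_of_le hτ] at this
  -- The integrated control becomes part of the forcing term, extended by constants outside [τ, T]
  -- to be continuous on ℝ.
  let f : C(ℝ, V) := ⟨fun t => liftFunctional ω₀ S.χOp
    + IccExtend hτ ((Icc τ T).domRestrict fun t => ∫ r in τ..t, S.B (u r)) t,
    continuous_const.add (hcont.domRestrict.Icc_extend')⟩
  have hf : ∀ t ∈ Icc τ T, f t = liftFunctional ω₀ S.χOp + ∫ r in τ..t, S.B (u r) := by
    intro t ht
    exact congrArg (liftFunctional ω₀ S.χOp + ·) (IccExtend_of_mem hτ _ ht)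
  have hτm : τ ∈ Icc τ T := ⟨le_rfl, hτ⟩
  have hlift : ∀ w : C(ℝ, V), ∀ a b, IntervalIntegrable
      (fun r => liftFunctional (S.stateAt ω₀ w τ r) (S.k.curry r)) volume a b := fun w a b =>
    ((liftFunctional.continuous.comp (S.continuous_stateAt ω₀ w τ)).clm_apply
      S.k.curry.continuous).intervalIntegrable a b
  have hiff : ∀ w : C(ℝ, V), S.IsTrajectory τ T ω₀ u w ↔ ∀ t ∈ Icc τ T,
      w t = f t + ∫ r in τ..t, liftFunctional (S.stateAt ω₀ w τ r) (S.k.curry r) := by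
    intro w
    constructor
    · intro h t ht
      rw [h.equation t ht, hf t ht, h.initial,
        intervalIntegral.integral_add (hlift w _ _) (hBu.mono_set (hsub ht))]
      abel
    · intro h
      have h0 : w τ = liftFunctional ω₀ S.χOp := by
        rw [h τ hτm, hf τ hτm]
        simp
      refine ⟨h0.symm, fun t ht => ?_⟩
      rw [intervalIntegral.integral_add (hlift w _ _) (hBu.mono_set (hsub ht)), h t ht, hf t ht, h0]
      abel
  obtain ⟨w, hw, huniq⟩ := S.exists_stateVolterra hτ ω₀ S.k.curry f
  exact ⟨w, (hiff w).2 hw, fun z hz => huniq z ((hiff z).1 hz)⟩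

omit [CompleteSpace V] [CompleteSpace U] [CompleteSpace Y] in
lemma IsTrajectory.congr_ae [CompleteSpace V] {S : DelaySystem V U Y Ω} {ω₀ : C(Ω, V) →L[ℝ] ℝ}
    {u v : ℝ → U} {w : C(ℝ, V)} (h : S.IsTrajectory τ T ω₀ u w)
    (huv : u =ᵐ[volume.restrict (Icc τ T)] v) : S.IsTrajectory τ T ω₀ v w := by
  refine ⟨h.initial, fun t ht => ?_⟩
  rw [h.equation t ht]
  congr 1
  refine intervalIntegral.integral_congr_ae ?_
  rw [Filter.EventuallyEq, ae_restrict_iff' measurableSet_Icc] at huv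
  filter_upwards [huv] with r hr hrt
  rw [uIoc_of_le ht.1] at hrt
  rw [hr ⟨hrt.1.le, hrt.2.trans ht.2⟩]

/-- The feedback control along `w`. -/
noncomputable def feedbackControl (P : ℝ → C(Ω × Ω, Oper V)) (x : ℝ → C(Ω, V))
    (ω₀ : C(Ω, V) →L[ℝ] ℝ) (w : C(ℝ, V)) (τ t : ℝ) : U :=
  -((S.B†) (costate (P t) (x t) (S.stateAt ω₀ w τ t) S.star))

omit [CompleteSpace Y] in
lemma continuousOn_feedbackControl {P : ℝ → C(Ω × Ω, Oper V)} {x : ℝ → C(Ω, V)}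
    (hP : ContinuousOn P (Icc τ T)) (hx : ContinuousOn x (Icc τ T)) (ω₀ : C(Ω, V) →L[ℝ] ℝ)
    (w : C(ℝ, V)) : ContinuousOn (S.feedbackControl P x ω₀ w τ) (Icc τ T) := by
  have h1 : ContinuousOn (fun t => kernelApply (P t) (S.stateAt ω₀ w τ t)) (Icc τ T) :=
    ((kernelApply (V := V) (Ω := Ω)).continuous.comp_continuousOn hP).clm_apply
      (S.continuous_stateAt ω₀ w τ).continuousOn
  have h2 : Continuous fun z : C(Ω, V) => -((S.B†) (z S.star)) :=
    ((S.B†).continuous.comp (continuous_eval_const S.star)).neg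
  exact h2.comp_continuousOn (h1.add hx)

omit [CompleteSpace Y] in
/-- Existence and uniqueness of the trajectory of the closed loop system. -/
theorem exists_closedLoop [T2Space Ω] (hτ : τ ≤ T) (ω₀ : C(Ω, V) →L[ℝ] ℝ) {P : ℝ → C(Ω × Ω, Oper V)}
    {x : ℝ → C(Ω, V)} (hP : ContinuousOn P (Icc τ T)) (hx : ContinuousOn x (Icc τ T)) :
    ∃ w : C(ℝ, V), S.IsTrajectory τ T ω₀ (S.feedbackControl P x ω₀ w τ) w ∧
      ∀ z, S.IsTrajectory τ T ω₀ (S.feedbackControl P x ω₀ z τ) z → EqOn z w (Icc τ T) := by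
  let Q : C(ℝ, C(Ω × Ω, Oper V)) :=
    ⟨IccExtend hτ ((Icc τ T).domRestrict P), hP.domRestrict.Icc_extend'⟩
  let z : C(ℝ, C(Ω, V)) := ⟨IccExtend hτ ((Icc τ T).domRestrict x), hx.domRestrict.Icc_extend'⟩
  have hQ : ∀ t ∈ Icc τ T, Q t = P t := fun t ht =>
    IccExtend_of_mem hτ ((Icc τ T).domRestrict P) ht
  have hz : ∀ t ∈ Icc τ T, z t = x t := fun t ht =>
    IccExtend_of_mem hτ ((Icc τ T).domRestrict x) ht
  -- Inserting the feedback replaces k by k - BB* P(star, ·) and adds the forcing -BB* x(star); the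
  -- closed loop is again a Volterra equation of the same type.
  have hF : Continuous fun q : ℝ × Ω => S.k q - S.BB * Q q.1 (S.star, q.2) := by fun_prop
  let κ : C(ℝ, C(Ω, Oper V)) := ContinuousMap.curry ⟨_, hF⟩
  have hκ : ∀ t, κ t = S.k.curry t - ContinuousMap.const Ω S.BB * (Q t).curry S.star := fun t => rfl
  have hBz : Continuous fun r => S.BB (z r S.star) := by fun_prop
  let f : C(ℝ, V) := ⟨fun t => liftFunctional ω₀ S.χOp - ∫ r in τ..t, S.BB (z r S.star),
    continuous_const.sub (intervalIntegral.continuous_primitive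
      (fun a b => hBz.intervalIntegrable a b) τ)⟩
  have hf : ∀ t, f t = liftFunctional ω₀ S.χOp - ∫ r in τ..t, S.BB (z r S.star) := fun t => rfl
  have hτm : τ ∈ Icc τ T := ⟨le_rfl, hτ⟩
  have hlift : ∀ w : C(ℝ, V), ∀ a b, IntervalIntegrable
      (fun r => liftFunctional (S.stateAt ω₀ w τ r) (κ r)) volume a b := fun w a b =>
    ((liftFunctional.continuous.comp (S.continuous_stateAt ω₀ w τ)).clm_apply
      κ.continuous).intervalIntegrable a b
  have hdrift : ∀ w : C(ℝ, V), ∀ t ∈ Icc τ T,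
      ∫ r in τ..t, (liftFunctional (S.stateAt ω₀ w τ r) (S.k.curry r)
        + S.B (S.feedbackControl P x ω₀ w τ r))
      = (∫ r in τ..t, liftFunctional (S.stateAt ω₀ w τ r) (κ r))
        - ∫ r in τ..t, S.BB (z r S.star) := by
    intro w t ht
    rw [← intervalIntegral.integral_sub (hlift w _ _) (hBz.intervalIntegrable _ _)]
    refine intervalIntegral.integral_congr fun r hr => ?_
    rw [uIcc_of_le ht.1] at hr
    have hr' : r ∈ Icc τ T := ⟨hr.1, hr.2.trans ht.2⟩
    simp only [hκ, map_sub, liftFunctional_const_mul, hQ r hr', hz r hr', feedbackControl, map_neg,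
      ← BB_apply, costate, ContinuousMap.add_apply, Oper.map_add, kernelApply_apply]
    abel
  have hiff : ∀ w : C(ℝ, V), S.IsTrajectory τ T ω₀ (S.feedbackControl P x ω₀ w τ) w ↔
      ∀ t ∈ Icc τ T, w t = f t + ∫ r in τ..t, liftFunctional (S.stateAt ω₀ w τ r) (κ r) := by
    intro w
    constructor
    · intro h t ht
      rw [h.equation t ht, hf t, h.initial, hdrift w t ht]
      abel
    · intro h
      have h0 : w τ = liftFunctional ω₀ S.χOp := by
        rw [h τ hτm, hf τ]
        simp
      refine ⟨h0.symm, fun t ht => ?_⟩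
      rw [hdrift w t ht, h t ht, hf t, h0]
      abel
  obtain ⟨w, hw, huniq⟩ := S.exists_stateVolterra hτ ω₀ κ f
  exact ⟨w, (hiff w).2 hw, fun z hz => huniq z ((hiff z).1 hz)⟩

end Trajectories

end DelaySystem

lemma HasDerivWithinAt.continuousMap_apply {X E : Type*} [TopologicalSpace X] [CompactSpace X]
    [NormedAddCommGroup E] [NormedSpace ℝ E] {f : ℝ → C(X, E)} {f' : C(X, E)} {s : Set ℝ} {t : ℝ}
    (h : HasDerivWithinAt f f' s t) (a : X) : HasDerivWithinAt (fun r => f r a) (f' a) s t :=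
  let e : C(X, E) →L[ℝ] E := ContinuousMap.evalCLM ℝ a
  e.hasFDerivAt.comp_hasDerivWithinAt t h

namespace DelaySystem

variable {V U Y Ω : Type*} [NormedAddCommGroup V] [InnerProductSpace ℝ V]
    [NormedAddCommGroup U] [InnerProductSpace ℝ U] [NormedAddCommGroup Y] [InnerProductSpace ℝ Y]
    [TopologicalSpace Ω] [CompactSpace Ω] [CompleteSpace V] [CompleteSpace U] [CompleteSpace Y]
  (S : DelaySystem V U Y Ω)

/-! ### Growth and Lipschitz bounds for the coefficient equations -/

section Estimates

lemma norm_riccatiRHS_sub_le (t : ℝ) (P Q : C(Ω × Ω, Oper V)) :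
    ‖S.riccatiRHS t P - S.riccatiRHS t Q‖
      ≤ (2 * ‖S.k.curry t‖ + 2 * ‖S.χ‖ + (‖P‖ + ‖Q‖) * ‖S.BB‖) * ‖P - Q‖ := by
  refine (ContinuousMap.norm_le _ (by positivity)).2 fun ⟨a, b⟩ => ?_
  have hk : ∀ a, ‖S.k (t, a)‖ ≤ ‖S.k.curry t‖ := (S.k.curry t).norm_coe_le_norm
  have hχ : ∀ a, ‖S.χ a‖ ≤ ‖S.χ‖ := S.χ.norm_coe_le_norm
  have hX : ∀ q, ‖P q - Q q‖ ≤ ‖P - Q‖ := (P - Q).norm_coe_le_norm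
  have hP : ∀ q, ‖P q‖ ≤ ‖P‖ := P.norm_coe_le_norm
  have hQ : ∀ q, ‖Q q‖ ≤ ‖Q‖ := Q.norm_coe_le_norm
  have e : (S.riccatiRHS t P - S.riccatiRHS t Q) (a, b)
      = -(Star.star (S.k (t, a)) * (P (S.star, b) - Q (S.star, b))
        + Star.star (P (S.star, a) - Q (S.star, a)) * S.k (t, b)
        + S.χ a • (P (S.ι t, b) - Q (S.ι t, b))
        + S.χ b • Star.star (P (S.ι t, a) - Q (S.ι t, a))
        - Star.star (P (S.star, a) - Q (S.star, a)) * (S.BB * P (S.star, b))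
        - Star.star (Q (S.star, a)) * (S.BB * (P (S.star, b) - Q (S.star, b)))) := by
    rw [ContinuousMap.sub_apply, riccatiRHS_apply, riccatiRHS_apply]
    simp only [star_sub, smul_sub, mul_sub, sub_mul]
    abel
  rw [e, norm_neg]
  have h1 : ‖Star.star (S.k (t, a)) * (P (S.star, b) - Q (S.star, b))‖
      ≤ ‖S.k.curry t‖ * ‖P - Q‖ := by
    refine (norm_mul_le _ _).trans ?_
    rw [norm_star]
    exact mul_le_mul (hk a) (hX _) (norm_nonneg _) (norm_nonneg _)
  have h2 : ‖Star.star (P (S.star, a) - Q (S.star, a)) * S.k (t, b)‖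
      ≤ ‖S.k.curry t‖ * ‖P - Q‖ := by
    refine (norm_mul_le _ _).trans ?_
    rw [norm_star, mul_comm]
    exact mul_le_mul (hk b) (hX _) (norm_nonneg _) (norm_nonneg _)
  have h3 : ‖S.χ a • (P (S.ι t, b) - Q (S.ι t, b))‖ ≤ ‖S.χ‖ * ‖P - Q‖ := by
    rw [norm_smul]
    exact mul_le_mul (hχ a) (hX _) (norm_nonneg _) (norm_nonneg _)
  have h4 : ‖S.χ b • Star.star (P (S.ι t, a) - Q (S.ι t, a))‖ ≤ ‖S.χ‖ * ‖P - Q‖ := by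
    rw [norm_smul, norm_star]
    exact mul_le_mul (hχ b) (hX _) (norm_nonneg _) (norm_nonneg _)
  have h5 : ‖Star.star (P (S.star, a) - Q (S.star, a)) * (S.BB * P (S.star, b))‖
      ≤ ‖P - Q‖ * (‖S.BB‖ * ‖P‖) := by
    refine (norm_mul_le _ _).trans ?_
    rw [norm_star]
    refine mul_le_mul (hX _) ((norm_mul_le _ _).trans ?_) (norm_nonneg _) (norm_nonneg _)
    exact mul_le_mul_of_nonneg_left (hP _) (norm_nonneg _)
  have h6 : ‖Star.star (Q (S.star, a)) * (S.BB * (P (S.star, b) - Q (S.star, b)))‖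
      ≤ ‖Q‖ * (‖S.BB‖ * ‖P - Q‖) := by
    refine (norm_mul_le _ _).trans ?_
    rw [norm_star]
    refine mul_le_mul (hQ _) ((norm_mul_le _ _).trans ?_) (norm_nonneg _) (norm_nonneg _)
    exact mul_le_mul_of_nonneg_left (hX _) (norm_nonneg _)
  refine (norm_sub_le_of_le (norm_sub_le_of_le (norm_add_le_of_le (norm_add_le_of_le
    (norm_add_le_of_le h1 h2) h3) h4) h5) h6).trans (le_of_eq ?_)
  ring

lemma norm_riccatiRHS_zero_le (t : ℝ) : ‖S.riccatiRHS t 0‖ ≤ ‖S.χ‖ * ‖S.χ‖ * ‖S.CC‖ := by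
  refine (ContinuousMap.norm_le _ (by positivity)).2 fun ⟨a, b⟩ => ?_
  have hχ : ∀ a, ‖S.χ a‖ ≤ ‖S.χ‖ := S.χ.norm_coe_le_norm
  rw [riccatiRHS_apply]
  simp only [ContinuousMap.zero_apply, mul_zero, star_zero, zero_mul, smul_zero, add_zero,
    sub_zero, zero_add, norm_neg, norm_smul, norm_mul]
  gcongr <;> exact hχ _

omit [CompleteSpace Y] in
lemma norm_signalRHS_le (t : ℝ) (P : C(Ω × Ω, Oper V)) (η : V) (x : C(Ω, V)) :
    ‖S.signalRHS t P η x‖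
      ≤ (‖S.k.curry t‖ + ‖S.χ‖ + ‖P‖ * ‖S.BB‖) * ‖x‖ + ‖S.χ‖ * ‖η‖ := by
  refine (ContinuousMap.norm_le _ (by positivity)).2 fun a => ?_
  have hk : ∀ a, ‖S.k (t, a)‖ ≤ ‖S.k.curry t‖ := (S.k.curry t).norm_coe_le_norm
  have hχ : ∀ a, ‖S.χ a‖ ≤ ‖S.χ‖ := S.χ.norm_coe_le_norm
  have hx : ∀ a, ‖x a‖ ≤ ‖x‖ := x.norm_coe_le_norm
  rw [signalRHS_apply, norm_neg]
  have h1 : ‖Star.star (S.k (t, a)) (x S.star)‖ ≤ ‖S.k.curry t‖ * ‖x‖ := by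
    refine (Oper.norm_apply_le _ _).trans ?_
    rw [norm_star]
    exact mul_le_mul (hk a) (hx _) (norm_nonneg _) (norm_nonneg _)
  have h2 : ‖S.χ a • x (S.ι t)‖ ≤ ‖S.χ‖ * ‖x‖ := by
    rw [norm_smul]
    exact mul_le_mul (hχ a) (hx _) (norm_nonneg _) (norm_nonneg _)
  have h3 : ‖Star.star (P (S.star, a)) (S.BB (x S.star))‖ ≤ ‖P‖ * (‖S.BB‖ * ‖x‖) := by
    refine (Oper.norm_apply_le _ _).trans ?_
    rw [norm_star]
    refine mul_le_mul (P.norm_coe_le_norm _) ((Oper.norm_apply_le _ _).trans ?_) (norm_nonneg _)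
      (norm_nonneg _)
    exact mul_le_mul_of_nonneg_left (hx _) (norm_nonneg _)
  have h4 : ‖S.χ a • η‖ ≤ ‖S.χ‖ * ‖η‖ := by
    rw [norm_smul]
    exact mul_le_mul_of_nonneg_right (hχ a) (norm_nonneg _)
  refine (norm_sub_le_of_le (norm_sub_le_of_le (norm_add_le_of_le h1 h2) h3) h4).trans
    (le_of_eq ?_)
  ring

-- For fixed P the field is jointly linear in the signal and the coefficient. The combination 1, -1
-- yields the Lipschitz bound, the general one the linearity of d₁ in y.
omit [CompleteSpace Y] in
lemma signalRHS_combination (t : ℝ) (P : C(Ω × Ω, Oper V)) (η ζ : V) (x z : C(Ω, V)) (c e : ℝ) :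
    S.signalRHS t P (c • η + e • ζ) (c • x + e • z)
      = c • S.signalRHS t P η x + e • S.signalRHS t P ζ z := by
  ext a
  simp only [signalRHS_apply, ContinuousMap.add_apply, ContinuousMap.smul_apply, Oper.map_add,
    Oper.map_smul, smul_add, smul_sub, smul_neg, smul_comm _ (S.χ a)]
  abel

omit [CompleteSpace Y] in
lemma norm_signalRHS_sub_le (t : ℝ) (P : C(Ω × Ω, Oper V)) (η : V) (x z : C(Ω, V)) :
    ‖S.signalRHS t P η x - S.signalRHS t P η z‖
      ≤ (‖S.k.curry t‖ + ‖S.χ‖ + ‖P‖ * ‖S.BB‖) * ‖x - z‖ := by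
  have h := S.signalRHS_combination t P η η x z 1 (-1)
  simp only [one_smul, neg_smul, ← sub_eq_add_neg, sub_self] at h
  rw [← h]
  simpa using S.norm_signalRHS_le t P 0 (x - z)

omit [CompleteSpace V] [CompleteSpace U] [CompleteSpace Y] in
lemma exists_norm_k_le (T : ℝ) : ∃ c, 0 ≤ c ∧ ∀ t ∈ Icc 0 T, ‖S.k.curry t‖ ≤ c := by
  obtain ⟨c, hc⟩ := (isCompact_Icc (a := (0 : ℝ)) (b := T)).exists_bound_of_continuousOn
    S.k.curry.continuous.continuousOn
  exact ⟨max c 0, le_max_right _ _, fun t ht => (hc t ht).trans (le_max_left _ _)⟩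

lemma riccatiRHS_locallyLipschitz (T R : ℝ) :
    ∃ K : ℝ, 0 ≤ K ∧ ∀ t ∈ Icc 0 T, ∀ P Q, ‖P‖ ≤ R → ‖Q‖ ≤ R →
      ‖S.riccatiRHS t P - S.riccatiRHS t Q‖ ≤ K * ‖P - Q‖ := by
  obtain ⟨c, hc0, hc⟩ := S.exists_norm_k_le T
  refine ⟨2 * c + 2 * ‖S.χ‖ + (|R| + |R|) * ‖S.BB‖, by positivity, fun t ht P Q hP hQ => ?_⟩
  refine (S.norm_riccatiRHS_sub_le t P Q).trans (mul_le_mul_of_nonneg_right ?_ (norm_nonneg _))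
  have h1 := hc t ht
  have h2 := hP.trans (le_abs_self R)
  have h3 := hQ.trans (le_abs_self R)
  gcongr

end Estimates

/-! ### Global solvability of the Riccati equation -/

section Riccati

variable {T : ℝ}

/-- Solutions of the Riccati equation are symmetric. -/
lemma isSymmKernel_of_riccati {a : ℝ} {P : ℝ → C(Ω × Ω, Oper V)} (hPT : P T = 0)
    (hP : ∀ t ∈ Icc a T, HasDerivWithinAt P (S.riccatiRHS t (P t)) (Icc a T) t) {t : ℝ}
    (ht : t ∈ Icc a T) : IsSymmKernel (P t) := by
  intro b c
  have hev : ∀ q, ∀ r ∈ Icc a T,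
      HasDerivWithinAt (fun r => P r q) (S.riccatiRHS r (P r) q) (Icc a T) r := fun q r hr =>
    (hP r hr).continuousMap_apply q
  -- The right-hand side uses only entries P(star, ·), P(ι t, ·) and their adjoints, so it is
  -- symmetric for every P. The defect of symmetry is therefore constant in time, and no uniqueness
  -- theorem is needed.
  have hd : ∀ r ∈ Icc a T, HasDerivWithinAt (fun r => Star.star (P r (b, c)) - P r (c, b)) 0
      (Icc a T) r := fun r hr => by
    refine ((hev (b, c) r hr).star.sub (hev (c, b) r hr)).congr_deriv ?_
    rw [riccatiRHS_apply, riccatiRHS_apply]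
    simp only [star_neg, star_add, star_sub, star_mul, star_smul, star_star, star_trivial, star_BB,
      star_CC, mul_assoc, mul_comm (S.χ c)]
    abel
  have h := (convex_Icc a T).norm_image_sub_le_of_norm_hasDerivWithin_le (C := 0) hd (by simp)
    (right_mem_Icc.2 (ht.1.trans ht.2)) ht
  simp only [hPT, ContinuousMap.zero_apply, star_zero, sub_zero, zero_mul, norm_le_zero_iff] at h
  exact sub_eq_zero.1 h

/-- The system without control. -/
def uncontrolled : DelaySystem V U Y Ω := { S with B := 0 }

/-- With B = 0 the quadratic term disappears and linear growth suffices. The solution represents the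
cost of the zero control for y = 0. -/
lemma exists_riccati_uncontrolled (hT : 0 ≤ T) :
    ∃ P : ℝ → C(Ω × Ω, Oper V), P T = 0 ∧ ∀ t ∈ Icc 0 T,
      HasDerivWithinAt P (S.uncontrolled.riccatiRHS t (P t)) (Icc 0 T) t := by
  obtain ⟨c, hc0, hc⟩ := S.uncontrolled.exists_norm_k_le T
  have hBB : S.uncontrolled.BB = 0 := Oper.ext fun v => rfl
  refine exists_backward_solution_of_linear_growth hT 0
    (fun P => (S.uncontrolled.continuous_riccatiRHS P).continuousOn)
    (S.uncontrolled.riccatiRHS_locallyLipschitz T) (c := 2 * c + 2 * ‖S.uncontrolled.χ‖)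
    (e := ‖S.uncontrolled.χ‖ * ‖S.uncontrolled.χ‖ * ‖S.uncontrolled.CC‖)
    (by positivity) (by positivity) fun t ht P => ?_
  have h1 := S.uncontrolled.norm_riccatiRHS_sub_le t P 0
  have h2 := S.uncontrolled.norm_riccatiRHS_zero_le t
  rw [hBB, norm_zero, add_zero, norm_zero, mul_zero, add_zero, sub_zero] at h1
  have h3 := norm_le_norm_sub_add (S.uncontrolled.riccatiRHS t P) (S.uncontrolled.riccatiRHS t 0)
  have h4 := mul_le_mul_of_nonneg_right (hc t ht) (norm_nonneg P)
  linarith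

/-- With zero terminal data and reference signal, the value function is the quadratic form of the
solution of the Riccati equation. -/
lemma isValueSolution_zero {a : ℝ} {P : ℝ → C(Ω × Ω, Oper V)} (hPT : P T = 0)
    (hP : ∀ t ∈ Icc a T, HasDerivWithinAt P (S.riccatiRHS t (P t)) (Icc a T) t) :
    S.IsValueSolution a T (fun _ => 0) P (fun _ => 0) (fun _ => 0) where
  kernel := hP
  symm _ ht := S.isSymmKernel_of_riccati hPT hP ht
  signal t _ := by
    have h := S.norm_signalRHS_le t (P t) 0 0
    rw [norm_zero, norm_zero, mul_zero, mul_zero, add_zero, norm_le_zero_iff] at h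
    rw [map_zero, h]
    exact hasDerivWithinAt_const _ _ _
  const t _ := by
    rw [ContinuousMap.zero_apply, map_zero, norm_zero, norm_zero, sub_self]
    exact hasDerivWithinAt_const _ _ _

-- The energy identity for y = 0, valid for every control: the form of P is the cost of u minus the
-- squared distance of u from the feedback. Different choices of u give different bounds.
variable {S} in
lemma kernelForm_eq_neg_integral [T2Space Ω] {τ : ℝ} (hτ : τ ≤ T) {P : ℝ → C(Ω × Ω, Oper V)}
    (hPT : P T = 0)
    (hP : ∀ t ∈ Icc τ T, HasDerivWithinAt P (S.riccatiRHS t (P t)) (Icc τ T) t)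
    {ω₀ : C(Ω, V) →L[ℝ] ℝ} {u : ℝ → U} {w : C(ℝ, V)} (hu : IntervalIntegrable u volume τ T)
    (hw : S.IsTrajectory τ T ω₀ u w) :
    kernelForm ω₀ (P τ) = -∫ t in τ..T, (‖u t - S.feedbackControl P (fun _ => 0) ω₀ w τ t‖ ^ 2
        - (‖S.C (w t)‖ ^ 2 + ‖u t‖ ^ 2)) := by
  have h := value_sub_value_eq_integral hτ continuousOn_const (S.isValueSolution_zero hPT hP) hu hw
  simp only [hPT, value, map_zero, mul_zero, add_zero, zero_sub, sub_zero] at h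
  simp only [feedbackControl, sub_neg_eq_add, ← h, neg_neg]

-- The feedback control makes the square vanish and leaves a nonnegative cost. The zero control
-- costs exactly the form of Q, from which a square is subtracted.
variable {S} in
lemma kernelForm_mem_Icc [T2Space Ω] {τ : ℝ} (hτ : τ ≤ T) {P Q : ℝ → C(Ω × Ω, Oper V)}
    (hPT : P T = 0)
    (hP : ∀ t ∈ Icc τ T, HasDerivWithinAt P (S.riccatiRHS t (P t)) (Icc τ T) t)
    (hQT : Q T = 0)
    (hQ : ∀ t ∈ Icc τ T, HasDerivWithinAt Q (S.uncontrolled.riccatiRHS t (Q t)) (Icc τ T) t)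
    (ω₀ : C(Ω, V) →L[ℝ] ℝ) :
    kernelForm ω₀ (P τ) ∈ Icc 0 (kernelForm ω₀ (Q τ)) := by
  have hPc : ContinuousOn P (Icc τ T) := fun t ht => (hP t ht).continuousWithinAt
  constructor
  · obtain ⟨w, hw, -⟩ := S.exists_closedLoop hτ ω₀ hPc (continuousOn_const (c := (0 : C(Ω, V))))
    have hc := S.continuousOn_feedbackControl hPc (continuousOn_const (c := (0 : C(Ω, V)))) ω₀ w
    rw [kernelForm_eq_neg_integral hτ hPT hP (hc.intervalIntegrable_of_Icc hτ) hw,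
      ← intervalIntegral.integral_neg]
    refine intervalIntegral.integral_nonneg hτ fun t _ => ?_
    rw [sub_self, norm_zero]
    have := sq_nonneg ‖S.C (w t)‖
    have := sq_nonneg ‖S.feedbackControl P (fun _ => 0) ω₀ w τ t‖
    linarith
  · have hu : IntervalIntegrable (fun _ => (0 : U)) volume τ T := intervalIntegrable_const
    obtain ⟨w, hw, -⟩ := S.exists_trajectory hτ ω₀ hu
    have hw' : S.uncontrolled.IsTrajectory τ T ω₀ (fun _ => (0 : U)) w := by
      refine ⟨hw.initial, fun t ht => ?_⟩
      have h := hw.equation t ht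
      simp only [map_zero] at h ⊢
      exact h
    have hc := S.continuousOn_feedbackControl hPc (continuousOn_const (c := (0 : C(Ω, V)))) ω₀ w
    have hz : ∀ t, S.uncontrolled.feedbackControl Q (fun _ => 0) ω₀ w τ t = 0 := fun t => by
      simp [feedbackControl, uncontrolled]
    have hCw : Continuous fun t => ‖S.C (w t)‖ ^ 2 := by fun_prop
    rw [kernelForm_eq_neg_integral hτ hPT hP hu hw, kernelForm_eq_neg_integral hτ hQT hQ hu hw',
      neg_le_neg_iff]
    simp only [hz, zero_sub, norm_neg, norm_zero]
    refine intervalIntegral.integral_mono_on hτ ?_ ?_ fun t _ => ?_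
    · exact (Continuous.intervalIntegrable (by
        change Continuous fun t => (0 : ℝ) ^ 2 - (‖S.C (w t)‖ ^ 2 + 0 ^ 2)
        fun_prop) _ _)
    · refine ContinuousOn.intervalIntegrable_of_Icc hτ ?_
      exact (hc.norm.pow 2).sub (hCw.add continuous_const).continuousOn
    · have := sq_nonneg ‖S.feedbackControl P (fun _ => 0) ω₀ w τ t‖
      change (0 : ℝ) ^ 2 - (‖S.C (w t)‖ ^ 2 + 0 ^ 2) ≤ _
      linarith

/-- Polarisation: on δ_a v ± δ_b w, of norm at most 2, the form lies in [0, 4‖Q‖], and by symmetry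
the difference of the two values is 4⟨v, P(a, b) w⟩. -/
lemma norm_le_of_kernelForm_mem_Icc {P Q : C(Ω × Ω, Oper V)} (hP : IsSymmKernel P)
    (h : ∀ ω : C(Ω, V) →L[ℝ] ℝ, kernelForm ω P ∈ Icc 0 (kernelForm ω Q)) : ‖P‖ ≤ ‖Q‖ := by
  refine (ContinuousMap.norm_le _ (norm_nonneg Q)).2 fun ⟨a, b⟩ => ?_
  refine Oper.norm_le_of_inner_le _ (norm_nonneg Q) fun v w hv hw => ?_
  have hbound : ∀ ω : C(Ω, V) →L[ℝ] ℝ, ‖ω‖ ≤ 2 → kernelForm ω P ∈ Icc 0 (4 * ‖Q‖) := fun ω hω => by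
    refine ⟨(h ω).1, (h ω).2.trans ((le_abs_self _).trans
      ((abs_apply_kernelApply_le ω ω Q).trans (mul_le_mul_of_nonneg_right ?_ (norm_nonneg Q))))⟩
    have h0 := norm_nonneg ω
    generalize ‖ω‖ = δ at *
    nlinarith
  have hn : ∀ (c : Ω) (x : V), ‖x‖ ≤ 1 → ‖diracFunctional c x‖ ≤ 1 :=
    fun c x hx => (norm_diracFunctional_le c x).trans hx
  have h1 := hbound (diracFunctional a v + diracFunctional b w) ((norm_add_le
    (diracFunctional a v) (diracFunctional b w)).trans (by linarith [hn a v hv, hn b w hw]))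
  have h2 := hbound (diracFunctional a v - diracFunctional b w) ((norm_sub_le
    (diracFunctional a v) (diracFunctional b w)).trans (by linarith [hn a v hv, hn b w hw]))
  have hs : inner ℝ w (P (b, a) v) = inner ℝ v (P (a, b) w) := by
    rw [← hP a b, Oper.inner_star_right, real_inner_comm]
  simp only [kernelForm_apply, map_add, map_sub, add_apply, sub_apply, diracFunctional_apply,
    kernelApply_dirac, hs, mem_Icc] at h1 h2
  rw [abs_le]
  constructor <;> linarith [h1.1, h1.2, h2.1, h2.2]

/-- Global solvability of the Riccati equation. -/
theorem exists_riccati [T2Space Ω] (hT : 0 ≤ T) :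
    ∃ P : ℝ → C(Ω × Ω, Oper V), P T = 0 ∧ ∀ t ∈ Icc 0 T,
      HasDerivWithinAt P (S.riccatiRHS t (P t)) (Icc 0 T) t := by
  obtain ⟨Q, hQT, hQ⟩ := S.exists_riccati_uncontrolled hT
  have hQc : ContinuousOn Q (Icc 0 T) := fun t ht => (hQ t ht).continuousWithinAt
  obtain ⟨R, hR⟩ := isCompact_Icc.exists_bound_of_continuousOn hQc
  refine exists_backward_solution_of_apriori_bound hT 0 R
    (fun P => (S.continuous_riccatiRHS P).continuousOn) (S.riccatiRHS_locallyLipschitz T) ?_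
  intro a ha P hPT hP t ht
  have hsub : Icc t T ⊆ Icc a T := Icc_subset_Icc_left ht.1
  have hsub0 : Icc t T ⊆ Icc 0 T := Icc_subset_Icc_left (ha.1.trans ht.1)
  -- The comparison is applied with initial time t, for each t separately.
  refine le_trans ?_ (hR t ⟨ha.1.trans ht.1, ht.2⟩)
  exact norm_le_of_kernelForm_mem_Icc (S.isSymmKernel_of_riccati hPT hP ht)
    (kernelForm_mem_Icc ht.2 hPT (fun r hr => (hP r (hsub hr)).mono hsub) hQT
      fun r hr => (hQ r (hsub0 hr)).mono hsub0)

end Riccati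

end DelaySystem

namespace DelaySystem

variable {V U Y Ω : Type*} [NormedAddCommGroup V] [InnerProductSpace ℝ V]
    [NormedAddCommGroup U] [InnerProductSpace ℝ U] [NormedAddCommGroup Y] [InnerProductSpace ℝ Y]
    [TopologicalSpace Ω] [CompactSpace Ω] [T2Space Ω] [CompleteSpace V] [CompleteSpace U]
    [CompleteSpace Y]
  (S : DelaySystem V U Y Ω)

/-! ### Coefficients due to the reference signal -/

section Signal

variable {T : ℝ} {P : ℝ → C(Ω × Ω, Oper V)}

omit [CompleteSpace Y] in
lemma continuousOn_signalRHS {P : ℝ → C(Ω × Ω, Oper V)} {η : ℝ → V} {x : ℝ → C(Ω, V)} {s : Set ℝ}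
    (hP : ContinuousOn P s) (hη : ContinuousOn η s) (hx : ContinuousOn x s) :
    ContinuousOn (fun t => S.signalRHS t (P t) (η t) (x t)) s := by
  have h1 : ContinuousOn (fun t => (t, P t, η t, x t)) s :=
    continuousOn_id.prodMk (hP.prodMk (hη.prodMk hx))
  have h2 := S.continuous_signalRHS_uncurry
  generalize S.signalRHS = F at h2 ⊢
  exact h2.comp_continuousOn h1

omit [T2Space Ω] [CompleteSpace Y] in
lemma signalRHS_lipschitz (hP : ContinuousOn P (Icc 0 T)) (η : ℝ → V) :
    ∃ K : ℝ, 0 ≤ K ∧ ∀ t ∈ Icc 0 T, ∀ x z,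
      ‖S.signalRHS t (P t) (η t) x - S.signalRHS t (P t) (η t) z‖ ≤ K * ‖x - z‖ := by
  obtain ⟨c, hc0, hc⟩ := S.exists_norm_k_le T
  obtain ⟨R, hR⟩ := isCompact_Icc.exists_bound_of_continuousOn hP
  refine ⟨c + ‖S.χ‖ + |R| * ‖S.BB‖, by positivity, fun t ht x z => ?_⟩
  refine (S.norm_signalRHS_sub_le t (P t) (η t) x z).trans
    (mul_le_mul_of_nonneg_right ?_ (norm_nonneg _))
  have h1 := hc t ht
  have h2 := (hR t ht).trans (le_abs_self R)
  gcongr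

omit [CompleteSpace Y] in
lemma exists_signal (hT : 0 ≤ T) (hP : ContinuousOn P (Icc 0 T)) {η : ℝ → V}
    (hη : ContinuousOn η (Icc 0 T)) :
    ∃ x : ℝ → C(Ω, V), x T = 0 ∧ ∀ t ∈ Icc 0 T,
      HasDerivWithinAt x (S.signalRHS t (P t) (η t) (x t)) (Icc 0 T) t := by
  obtain ⟨K, hK0, hK⟩ := S.signalRHS_lipschitz hP η
  obtain ⟨e, he⟩ := isCompact_Icc.exists_bound_of_continuousOn
    (S.continuousOn_signalRHS hP hη (continuousOn_const (c := 0)))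
  refine exists_backward_solution_of_linear_growth hT 0
    (fun x => S.continuousOn_signalRHS hP hη continuousOn_const)
    (fun _ => ⟨K, hK0, fun t ht x z _ _ => hK t ht x z⟩) (c := K) (e := |e|) hK0 (abs_nonneg e)
    fun t ht x => ?_
  have h1 := hK t ht x 0
  rw [sub_zero] at h1
  have h2 := norm_le_norm_sub_add (S.signalRHS t (P t) (η t) x) (S.signalRHS t (P t) (η t) 0)
  have h3 := (he t ht).trans (le_abs_self e)
  linarith

omit [T2Space Ω] [CompleteSpace Y] in
lemma signal_unique (hP : ContinuousOn P (Icc 0 T)) {η : ℝ → V} {a : ℝ} (ha : 0 ≤ a)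
    {x z : ℝ → C(Ω, V)}
    (hx : ∀ t ∈ Icc a T, HasDerivWithinAt x (S.signalRHS t (P t) (η t) (x t)) (Icc a T) t)
    (hz : ∀ t ∈ Icc a T, HasDerivWithinAt z (S.signalRHS t (P t) (η t) (z t)) (Icc a T) t)
    (hxz : x T = z T) : EqOn x z (Icc a T) := by
  obtain ⟨K, hK0, hK⟩ := S.signalRHS_lipschitz hP η
  exact backward_solution_unique (fun _ => ⟨K, hK0, fun t ht x z _ _ =>
    hK t ⟨ha.trans ht.1, ht.2⟩ x z⟩) hx hz hxz

/-- A primitive solves an equation whose right-hand side ignores the unknown, so the existence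
theorem also provides the one-sided derivatives at both ends. -/
lemma exists_backward_primitive {g : ℝ → ℝ} (hT : 0 ≤ T) (hg : ContinuousOn g (Icc 0 T)) :
    ∃ M : ℝ → ℝ, M T = 0 ∧ ∀ t ∈ Icc 0 T, HasDerivWithinAt M (g t) (Icc 0 T) t := by
  obtain ⟨e, he⟩ := isCompact_Icc.exists_bound_of_continuousOn hg
  refine exists_backward_solution_of_linear_growth (F := fun t _ => g t) hT 0 (fun _ => hg)
    (fun _ => ⟨0, le_rfl, fun t ht x z _ _ => by simp⟩) (c := 0) (e := |e|) le_rfl (abs_nonneg e)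
    fun t ht x => ?_
  rw [zero_mul, zero_add]
  exact (he t ht).trans (le_abs_self e)

/-- Existence of the coefficients of the value function. -/
theorem exists_valueSolution (hT : 0 ≤ T) (hPT : P T = 0)
    (hP : ∀ t ∈ Icc 0 T, HasDerivWithinAt P (S.riccatiRHS t (P t)) (Icc 0 T) t) {y : ℝ → Y}
    (hy : ContinuousOn y (Icc 0 T)) :
    ∃ (x : ℝ → C(Ω, V)) (M : ℝ → ℝ), x T = 0 ∧ M T = 0 ∧ S.IsValueSolution 0 T y P x M := by
  have hPc : ContinuousOn P (Icc 0 T) := fun t ht => (hP t ht).continuousWithinAt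
  obtain ⟨x, hxT, hx⟩ := S.exists_signal hT hPc ((S.C†).continuous.comp_continuousOn hy)
  have hxc : ContinuousOn x (Icc 0 T) := fun t ht => (hx t ht).continuousWithinAt
  have hB : Continuous fun z : C(Ω, V) => (S.B†) (z S.star) :=
    (S.B†).continuous.comp (continuous_eval_const S.star)
  obtain ⟨M, hMT, hM⟩ := exists_backward_primitive hT
    (((hB.comp_continuousOn hxc).norm.pow 2).sub (hy.norm.pow 2))
  exact ⟨x, M, hxT, hMT, hP, fun t ht => S.isSymmKernel_of_riccati hPT hP ht, hx, hM⟩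

variable {S}

omit [T2Space Ω] in
/-- The coefficients of the value function depend only on the future of the reference signal. -/
lemma IsValueSolution.eqOn {a : ℝ} (ha : 0 ≤ a) {y y' : ℝ → Y} {x x' : ℝ → C(Ω, V)} {M M' : ℝ → ℝ}
    (h : S.IsValueSolution 0 T y P x M) (h' : S.IsValueSolution 0 T y' P x' M')
    (hx : x T = x' T) (hM : M T = M' T) (hy : EqOn y y' (Icc a T)) :
    EqOn x x' (Icc a T) ∧ EqOn M M' (Icc a T) := by
  have e : EqOn x x' (Icc a T) := by
    refine S.signal_unique (η := fun t => (S.C†) (y t)) h.continuousOn_kernel ha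
      (h.mono ha).signal (fun t ht => ?_) hx
    simp only [hy ht]
    exact (h'.mono ha).signal t ht
  refine ⟨e, backward_solution_unique (F := fun t _ => ‖(S.B†) (x t S.star)‖ ^ 2 - ‖y t‖ ^ 2)
    (fun _ => ⟨0, le_rfl, fun t ht x z _ _ => by simp⟩) (h.mono ha).const (fun t ht => ?_) hM⟩
  simp only [hy ht, e ht]
  exact (h'.mono ha).const t ht

omit [T2Space Ω] in
/-- The coefficient due to the reference signal is linear in it. -/
lemma IsValueSolution.signal_combination {y z : ℝ → Y} {x₁ x₂ x₃ : ℝ → C(Ω, V)}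
    {M₁ M₂ M₃ : ℝ → ℝ} {c e : ℝ} (h₁ : S.IsValueSolution 0 T y P x₁ M₁)
    (h₂ : S.IsValueSolution 0 T z P x₂ M₂)
    (h₃ : S.IsValueSolution 0 T (fun t => c • y t + e • z t) P x₃ M₃)
    (h : x₃ T = c • x₁ T + e • x₂ T) : EqOn x₃ (fun t => c • x₁ t + e • x₂ t) (Icc 0 T) := by
  refine S.signal_unique h₁.continuousOn_kernel le_rfl h₃.signal (fun t ht => ?_) h
  rw [map_add, map_smul, map_smul, signalRHS_combination]
  exact ((h₁.signal t ht).const_smul c).add ((h₂.signal t ht).const_smul e)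

end Signal

/-! ### Optimal control of the abstract system -/

section Optimality

variable {S} {τ T : ℝ} {y : ℝ → Y} {P : ℝ → C(Ω × Ω, Oper V)} {x : ℝ → C(Ω, V)}
  {M : ℝ → ℝ} {ω₀ : C(Ω, V) →L[ℝ] ℝ} {u : ℝ → U} {w : C(ℝ, V)}

lemma _root_.MeasureTheory.MemLp.intervalIntegrable_norm_sq {E : Type*} [NormedAddCommGroup E]
    {f : ℝ → E} {a b : ℝ} (hab : a ≤ b) (hf : MemLp f 2 (volume.restrict (Icc a b))) :
    IntervalIntegrable (fun t => ‖f t‖ ^ 2) volume a b := by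
  rw [intervalIntegrable_iff_integrableOn_Icc_of_le hab]
  exact hf.integrable_norm_pow two_ne_zero

lemma _root_.MeasureTheory.MemLp.intervalIntegrable_of_two {E : Type*} [NormedAddCommGroup E]
    {f : ℝ → E} {a b : ℝ} (hab : a ≤ b) (hf : MemLp f 2 (volume.restrict (Icc a b))) :
    IntervalIntegrable f volume a b := by
  rw [intervalIntegrable_iff_integrableOn_Icc_of_le hab]
  exact hf.integrable one_le_two

lemma _root_.ContinuousOn.memLp_Icc {E : Type*} [NormedAddCommGroup E]
    {f : ℝ → E} {a b : ℝ} (hf : ContinuousOn f (Icc a b)) (q : ENNReal) :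
    MemLp f q (volume.restrict (Icc a b)) := by
  obtain ⟨c, hc⟩ := isCompact_Icc.exists_bound_of_continuousOn hf
  exact MemLp.of_bound (hf.aestronglyMeasurable_of_isCompact isCompact_Icc measurableSet_Icc) c
    ((ae_restrict_iff' measurableSet_Icc).2 (.of_forall hc))

/-- The cost of a control exceeds the value function by the squared distance of the control from
the feedback law. -/
theorem cost_eq_value_add (hτ : τ ≤ T) (hy : ContinuousOn y (Icc τ T))
    (h : S.IsValueSolution τ T y P x M) (hPT : P T = 0) (hxT : x T = 0) (hMT : M T = 0)
    (hu : MemLp u 2 (volume.restrict (Icc τ T))) (hw : S.IsTrajectory τ T ω₀ u w) :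
    ∫ t in τ..T, (‖S.C (w t) - y t‖ ^ 2 + ‖u t‖ ^ 2) = value (P τ) (x τ) (M τ) ω₀
      + ∫ t in τ..T, ‖u t - S.feedbackControl P x ω₀ w τ t‖ ^ 2 := by
  have h1 := value_sub_value_eq_integral hτ hy h (hu.intervalIntegrable_of_two hτ) hw
  have hc := S.continuousOn_feedbackControl h.continuousOn_kernel h.continuousOn_signal ω₀ w
  have hi := (hu.sub (hc.memLp_Icc 2)).intervalIntegrable_norm_sq hτ
  simp only [Pi.sub_apply] at hi
  have hCw : ContinuousOn (fun t => ‖S.C (w t) - y t‖ ^ 2) (Icc τ T) :=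
    (ContinuousOn.sub (by fun_prop) hy).norm.pow 2
  have hj := (hCw.intervalIntegrable_of_Icc (μ := volume) hτ).add (hu.intervalIntegrable_norm_sq hτ)
  have e : ∀ t, ‖u t + (S.B†) (costate (P t) (x t) (S.stateAt ω₀ w τ t) S.star)‖ ^ 2
      = ‖u t - S.feedbackControl P x ω₀ w τ t‖ ^ 2 := fun t => by
    rw [feedbackControl, sub_neg_eq_add]
  simp only [e] at h1
  rw [intervalIntegral.integral_sub hi hj, hPT, hxT, hMT] at h1
  simp only [value, map_zero, mul_zero, add_zero, zero_sub] at h1 ⊢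
  linarith

/-- A control whose cost is the value function is the feedback control along its trajectory. -/
lemma eq_feedbackControl_of_cost_le (hτ : τ ≤ T) (hy : ContinuousOn y (Icc τ T))
    (h : S.IsValueSolution τ T y P x M) (hPT : P T = 0) (hxT : x T = 0) (hMT : M T = 0)
    (hu : MemLp u 2 (volume.restrict (Icc τ T))) (hw : S.IsTrajectory τ T ω₀ u w)
    (hle : ∫ t in τ..T, (‖S.C (w t) - y t‖ ^ 2 + ‖u t‖ ^ 2) ≤ value (P τ) (x τ) (M τ) ω₀) :
    u =ᵐ[volume.restrict (Icc τ T)] S.feedbackControl P x ω₀ w τ := by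
  have hc := S.continuousOn_feedbackControl h.continuousOn_kernel h.continuousOn_signal ω₀ w
  have hi := (hu.sub (hc.memLp_Icc 2)).integrable_norm_pow two_ne_zero
  rw [cost_eq_value_add hτ hy h hPT hxT hMT hu hw] at hle
  have h0 : ∫ t in Icc τ T, ‖u t - S.feedbackControl P x ω₀ w τ t‖ ^ 2 = 0 := by
    rw [integral_Icc_eq_integral_Ioc, ← intervalIntegral.integral_of_le hτ]
    refine le_antisymm (by linarith) (intervalIntegral.integral_nonneg hτ fun t _ => sq_nonneg _)
  have h2 := (integral_eq_zero_iff_of_nonneg (fun t => sq_nonneg _) hi).1 h0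
  filter_upwards [h2] with t ht
  exact sub_eq_zero.1 (norm_eq_zero.1 (pow_eq_zero_iff two_ne_zero |>.1 ht))

/-- Existence, uniqueness and feedback form of the optimal control. -/
theorem exists_optimal (hτ : τ ≤ T) (hy : ContinuousOn y (Icc τ T))
    (h : S.IsValueSolution τ T y P x M) (hPT : P T = 0) (hxT : x T = 0) (hMT : M T = 0)
    (ω₀ : C(Ω, V) →L[ℝ] ℝ) :
    ∃ (u : ℝ → U) (w : C(ℝ, V)), (∀ t, u t = S.feedbackControl P x ω₀ w τ t) ∧
      ContinuousOn u (Icc τ T) ∧ S.IsTrajectory τ T ω₀ u w ∧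
      ∫ t in τ..T, (‖S.C (w t) - y t‖ ^ 2 + ‖u t‖ ^ 2) = value (P τ) (x τ) (M τ) ω₀ ∧
      ∀ (v : ℝ → U) (z : C(ℝ, V)), MemLp v 2 (volume.restrict (Icc τ T)) →
        S.IsTrajectory τ T ω₀ v z →
        value (P τ) (x τ) (M τ) ω₀ ≤ ∫ t in τ..T, (‖S.C (z t) - y t‖ ^ 2 + ‖v t‖ ^ 2) ∧
        (∫ t in τ..T, (‖S.C (z t) - y t‖ ^ 2 + ‖v t‖ ^ 2) ≤ value (P τ) (x τ) (M τ) ω₀ →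
          v =ᵐ[volume.restrict (Icc τ T)] u ∧ EqOn z w (Icc τ T)) := by
  obtain ⟨w, hw, hwu⟩ := S.exists_closedLoop hτ ω₀ h.continuousOn_kernel h.continuousOn_signal
  have hc := S.continuousOn_feedbackControl h.continuousOn_kernel h.continuousOn_signal ω₀ w
  refine ⟨S.feedbackControl P x ω₀ w τ, w, fun _ => rfl, hc, hw, ?_, fun v z hv hz => ⟨?_, ?_⟩⟩
  · rw [cost_eq_value_add hτ hy h hPT hxT hMT (hc.memLp_Icc 2) hw]
    simp
  · rw [cost_eq_value_add hτ hy h hPT hxT hMT hv hz]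
    exact le_add_of_nonneg_right (intervalIntegral.integral_nonneg hτ fun _ _ => sq_nonneg _)
  · intro hle
    have hvu := eq_feedbackControl_of_cost_le hτ hy h hPT hxT hMT hv hz hle
    -- A minimiser is almost everywhere the feedback along its own trajectory z, so z solves the
    -- closed loop and uniqueness there identifies it with w.
    have hzw := hwu z (hz.congr_ae hvu)
    refine ⟨?_, hzw⟩
    filter_upwards [hvu, ae_restrict_mem measurableSet_Icc] with t ht htI
    rw [ht, feedbackControl, feedbackControl, S.stateAt_congr ω₀ hzw htI]

end Optimality

end DelaySystem

/-! ### The tracking problem as a delay system -/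

namespace Oper

variable {V : Type*} [NormedAddCommGroup V] [InnerProductSpace ℝ V]

/-- A bounded operator as an element of `Oper V`. -/
def of (A : V →L[ℝ] V) : Oper V := A

/-- The bounded operator underlying an element of `Oper V`. -/
def toCLM (A : Oper V) : V →L[ℝ] V := A

lemma of_apply (A : V →L[ℝ] V) (v : V) : of A v = A v := rfl

lemma continuous_of : Continuous (of : (V →L[ℝ] V) → Oper V) := continuous_id

lemma continuous_toCLM : Continuous (toCLM : Oper V → V →L[ℝ] V) := continuous_id

lemma hasDerivWithinAt_toCLM {A : ℝ → Oper V} {A' : Oper V} {s : Set ℝ} {t : ℝ}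
    (h : HasDerivWithinAt A A' s t) : HasDerivWithinAt (fun r => (A r).toCLM) A'.toCLM s t := h

end Oper

namespace TrackingData

variable {d m p : ℕ} (S : TrackingData d m p) (hT : 0 ≤ S.T) (hN : ContinuousOn S.N (Icc 0 S.T))

/-- The tracking problem as a system with states on `[0, T]`, for the memory, and one more point,
for the current state. -/
noncomputable def delaySystem : DelaySystem (Vec d) (Vec m) (Vec p) (Icc 0 S.T ⊕ Unit) where
  star := Sum.inr ()
  ι := ⟨fun t => Sum.inl (projIcc 0 S.T hT t), by fun_prop⟩
  k :=
    let χ : C(Icc 0 S.T ⊕ Unit, ℝ) := ⟨Sum.elim 0 1, by fun_prop⟩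
    let σ : C(Icc 0 S.T ⊕ Unit, ℝ) := ⟨Sum.elim Subtype.val 0, by fun_prop⟩
    -- The constant extension of the kernel to ℝ is harmless: only k(t, ι s) with 0 ≤ s ≤ t ≤ T
    -- enters the equations.
    let N : C(ℝ, Oper (Vec d)) :=
      ⟨fun r => Oper.of (IccExtend hT ((Icc 0 S.T).domRestrict S.N) r),
        Oper.continuous_of.comp hN.domRestrict.Icc_extend'⟩
    ⟨fun q => χ q.2 • Oper.of S.A + (1 - χ q.2) • N (q.1 - σ q.2), by fun_prop⟩
  χ := ⟨Sum.elim 0 1, by fun_prop⟩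
  χ_star := rfl
  χ_ι _ := rfl
  B := S.B
  C := S.C

lemma delaySystem_k_star (t : ℝ) :
    (S.delaySystem hT hN).k (t, (S.delaySystem hT hN).star) = Oper.of S.A := by
  change (1 : ℝ) • Oper.of S.A + ((1 : ℝ) - 1) •
    Oper.of (IccExtend hT ((Icc 0 S.T).domRestrict S.N) (t - 0)) = _
  rw [one_smul, sub_self, zero_smul, add_zero]

lemma delaySystem_k_ι {s t : ℝ} (hs : 0 ≤ s) (hst : s ≤ t) (ht : t ≤ S.T) :
    (S.delaySystem hT hN).k (t, (S.delaySystem hT hN).ι s) = Oper.of (S.N (t - s)) := by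
  change (0 : ℝ) • Oper.of S.A + ((1 : ℝ) - 0) •
    Oper.of (IccExtend hT ((Icc 0 S.T).domRestrict S.N) (t - (projIcc 0 S.T hT s : ℝ))) = _
  rw [projIcc_of_mem hT ⟨hs, hst.trans ht⟩, zero_smul, zero_add, sub_zero, one_smul,
    IccExtend_of_mem hT _ ⟨by linarith, by linarith⟩]
  rfl

section Initial

variable {S} {τ : ℝ} {ξh : Vec d} {ξm : ℝ → Vec d}

/-- Square integrability of the memory is used only through integrability, which already makes the
datum a bounded functional. -/
lemma IsMemory.intervalIntegrable (hτ : 0 ≤ τ) (h : S.IsMemory τ ξm) :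
    IntervalIntegrable ξm volume 0 τ := by
  rw [intervalIntegrable_iff_integrableOn_Ioo_of_le hτ]
  exact h.integrable one_le_two

/-- The initial datum as a functional. -/
noncomputable def initialState (ξh : Vec d) (hξ : IntervalIntegrable ξm volume 0 τ) :
    C(Icc 0 S.T ⊕ Unit, Vec d) →L[ℝ] ℝ :=
  diracFunctional (S.delaySystem hT hN).star ξh
    + integralFunctional (S.delaySystem hT hN).ι hξ

variable {hT hN}

lemma liftFunctional_initialState (hξ : IntervalIntegrable ξm volume 0 τ)
    (F : C(Icc 0 S.T ⊕ Unit, Oper (Vec d))) :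
    liftFunctional (initialState hT hN ξh hξ) F = F (S.delaySystem hT hN).star ξh
      + ∫ s in (0 : ℝ)..τ, F ((S.delaySystem hT hN).ι s) (ξm s) := by
  rw [initialState, map_add, add_apply, liftFunctional_dirac, liftFunctional_integral]

lemma liftFunctional_initialState_χOp (hξ : IntervalIntegrable ξm volume 0 τ) :
    liftFunctional (initialState hT hN ξh hξ) (S.delaySystem hT hN).χOp = ξh := by
  have hs : ∀ a (v : Vec d), (S.delaySystem hT hN).χOp a v = (S.delaySystem hT hN).χ a • v :=
    fun a v => rfl
  rw [liftFunctional_initialState]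
  simp [hs, DelaySystem.χ_star, DelaySystem.χ_ι]

lemma liftFunctional_stateAt_k (hτ : 0 ≤ τ) (hξ : IntervalIntegrable ξm volume 0 τ)
    {w : C(ℝ, Vec d)} (hw : w τ = ξh) {r : ℝ} (hr : r ∈ Icc τ S.T) :
    liftFunctional ((S.delaySystem hT hN).stateAt (initialState hT hN ξh hξ) w τ r)
        ((S.delaySystem hT hN).k.curry r)
      = S.A (w r) + (∫ s in τ..r, S.N (r - s) (w s)) + ∫ s in (0 : ℝ)..τ, S.N (r - s) (ξm s) := by
  have h0 : ((S.delaySystem hT hN).k.curry r) (S.delaySystem hT hN).star = Oper.of S.A :=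
    S.delaySystem_k_star hT hN r
  have h1 : ∀ s ∈ Icc 0 r, ((S.delaySystem hT hN).k.curry r) ((S.delaySystem hT hN).ι s)
      = Oper.of (S.N (r - s)) := fun s hs => S.delaySystem_k_ι hT hN hs.1 hs.2 hr.2
  have e1 : ∫ s in (0 : ℝ)..τ, ((S.delaySystem hT hN).k.curry r) ((S.delaySystem hT hN).ι s) (ξm s)
      = ∫ s in (0 : ℝ)..τ, S.N (r - s) (ξm s) := by
    refine intervalIntegral.integral_congr fun s hs => ?_
    rw [uIcc_of_le hτ] at hs
    simp only [h1 s ⟨hs.1, hs.2.trans hr.1⟩, Oper.of_apply]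
  have e2 : ∫ s in τ..r, ((S.delaySystem hT hN).k.curry r) ((S.delaySystem hT hN).ι s) (w s)
      = ∫ s in τ..r, S.N (r - s) (w s) := by
    refine intervalIntegral.integral_congr fun s hs => ?_
    rw [uIcc_of_le hr.1] at hs
    simp only [h1 s ⟨hτ.trans hs.1, hs.2⟩, Oper.of_apply]
  rw [DelaySystem.liftFunctional_stateAt, liftFunctional_initialState, e1, e2, h0, hw,
    Oper.map_sub]
  simp only [Oper.of_apply]
  abel

/-- A solution is constrained only on [τ, T], whereas abstract trajectories are continuous on ℝ; any
z that agrees with w on [τ, T] serves. -/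
lemma isState_iff_isTrajectory (hτ : τ ∈ Icc 0 S.T) (hξ : IntervalIntegrable ξm volume 0 τ)
    {u : ℝ → Vec m} {w : ℝ → Vec d} {z : C(ℝ, Vec d)} (h : EqOn w z (Icc τ S.T)) :
    S.IsState τ ξh ξm u w ↔
      (S.delaySystem hT hN).IsTrajectory τ S.T (initialState hT hN ξh hξ) u z := by
  have hτm : τ ∈ Icc τ S.T := ⟨le_rfl, hτ.2⟩
  -- The integrands agree only if the point mass of the initial state matches z τ; either side of
  -- the equivalence supplies this at t = τ.
  have key : z τ = ξh → ∀ t ∈ Icc τ S.T,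
      ∫ r in τ..t, (liftFunctional ((S.delaySystem hT hN).stateAt (initialState hT hN ξh hξ) z τ r)
        ((S.delaySystem hT hN).k.curry r) + (S.delaySystem hT hN).B (u r))
      = ∫ r in τ..t, (S.A (w r) + (∫ s in τ..r, S.N (r - s) (w s)) + S.B (u r)
        + (∫ s in (0 : ℝ)..τ, S.N (r - s) (ξm s))) := by
    intro h0 t ht
    refine intervalIntegral.integral_congr fun r hr => ?_
    rw [uIcc_of_le ht.1] at hr
    have hr' : r ∈ Icc τ S.T := ⟨hr.1, hr.2.trans ht.2⟩
    have e : ∫ s in τ..r, S.N (r - s) (w s) = ∫ s in τ..r, S.N (r - s) (z s) := by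
      refine intervalIntegral.integral_congr fun s hs => ?_
      rw [uIcc_of_le hr.1] at hs
      simp only [h ⟨hs.1, hs.2.trans hr'.2⟩]
    simp only [liftFunctional_stateAt_k hτ.1 hξ h0 hr', h hr', e]
    change _ + _ + _ + S.B (u r) = _
    abel
  constructor
  · intro hs
    have h0 : z τ = ξh := by
      rw [← h hτm, hs.equation τ hτm]
      simp
    refine ⟨(liftFunctional_initialState_χOp hξ).trans h0.symm, fun t ht => ?_⟩
    rw [key h0 t ht, ← h ht, h0]
    exact hs.equation t ht
  · intro hz
    have h0 : z τ = ξh := hz.initial.symm.trans (liftFunctional_initialState_χOp hξ)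
    refine ⟨z.continuous.continuousOn.congr h, fun t ht => ?_⟩
    rw [h ht, hz.equation t ht, key h0 t ht, h0]

lemma IsState.exists_extension (hτ : τ ≤ S.T) {u : ℝ → Vec m} {w : ℝ → Vec d}
    (h : S.IsState τ ξh ξm u w) : ∃ z : C(ℝ, Vec d), EqOn w z (Icc τ S.T) :=
  ⟨⟨IccExtend hτ ((Icc τ S.T).domRestrict w), h.continuousOn.domRestrict.Icc_extend'⟩,
    fun _ ht => (IccExtend_of_mem hτ ((Icc τ S.T).domRestrict w) ht).symm⟩

lemma cost_congr (hτ : τ ≤ S.T) (y : ℝ → Vec p) (u : ℝ → Vec m) {w z : ℝ → Vec d}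
    (h : EqOn w z (Icc τ S.T)) : S.cost y τ u w = S.cost y τ u z := by
  refine intervalIntegral.integral_congr fun t ht => ?_
  rw [uIcc_of_le hτ] at ht
  simp only [h ht]

end Initial

end TrackingData

namespace Oper

variable {V : Type*} [NormedAddCommGroup V] [InnerProductSpace ℝ V]

lemma toCLM_add (A B : Oper V) : (A + B).toCLM = A.toCLM + B.toCLM := rfl

lemma toCLM_sub (A B : Oper V) : (A - B).toCLM = A.toCLM - B.toCLM := rfl

lemma toCLM_neg (A : Oper V) : (-A).toCLM = -A.toCLM := rfl

lemma toCLM_mul (A B : Oper V) : (A * B).toCLM = A.toCLM ∘L B.toCLM := rfl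

lemma toCLM_of (A : V →L[ℝ] V) : (of A).toCLM = A := rfl

lemma toCLM_star [CompleteSpace V] (A : Oper V) : (Star.star A).toCLM = A.toCLM† := rfl

end Oper

/-! ### Reading off the matrices and signal coefficients -/

namespace TrackingData

variable {d m p : ℕ} (S : TrackingData d m p) (hT : 0 ≤ S.T) (hN : ContinuousOn S.N (Icc 0 S.T))

section Coefficients

/-- The matrices `P₀` of a family of kernels. -/
noncomputable def matrix0 (P : ℝ → C((Icc 0 S.T ⊕ Unit) × (Icc 0 S.T ⊕ Unit), Oper (Vec d)))
    (τ : ℝ) : Mat d d :=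
  (P τ ((S.delaySystem hT hN).star, (S.delaySystem hT hN).star)).toCLM

/-- The matrices `P₁` of a family of kernels. -/
noncomputable def matrix1 (P : ℝ → C((Icc 0 S.T ⊕ Unit) × (Icc 0 S.T ⊕ Unit), Oper (Vec d)))
    (s τ : ℝ) : Mat d d :=
  (P τ ((S.delaySystem hT hN).star, (S.delaySystem hT hN).ι s)).toCLM

/-- The matrices `P₂` of a family of kernels. -/
noncomputable def matrix2 (P : ℝ → C((Icc 0 S.T ⊕ Unit) × (Icc 0 S.T ⊕ Unit), Oper (Vec d)))
    (s ν τ : ℝ) : Mat d d :=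
  (P τ ((S.delaySystem hT hN).ι s, (S.delaySystem hT hN).ι ν)).toCLM

variable {S} {hT} {hN}
variable {P P' : ℝ → C((Icc 0 S.T ⊕ Unit) × (Icc 0 S.T ⊕ Unit), Oper (Vec d))}

lemma continuousOn_matrix0 (h : ContinuousOn P (Icc 0 S.T)) :
    ContinuousOn (S.matrix0 hT hN P) (Icc 0 S.T) := by
  have h1 : ContinuousOn (fun τ => P τ ((S.delaySystem hT hN).star, (S.delaySystem hT hN).star))
      (Icc 0 S.T) := h.eval continuousOn_const
  exact Oper.continuous_toCLM.comp_continuousOn h1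

lemma continuousOn_matrix1 (h : ContinuousOn P (Icc 0 S.T)) :
    ContinuousOn (fun q : ℝ × ℝ => S.matrix1 hT hN P q.1 q.2) S.triangle := by
  have h1 : ContinuousOn (fun q : ℝ × ℝ =>
      P q.2 ((S.delaySystem hT hN).star, (S.delaySystem hT hN).ι q.1)) S.triangle :=
    (h.comp continuousOn_snd fun q hq => ⟨hq.1.trans hq.2.1, hq.2.2⟩).eval
      (Continuous.continuousOn (by fun_prop))
  exact Oper.continuous_toCLM.comp_continuousOn h1

lemma continuousOn_matrix2 (h : ContinuousOn P (Icc 0 S.T)) :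
    ContinuousOn (fun q : ℝ × ℝ × ℝ => S.matrix2 hT hN P q.1 q.2.1 q.2.2) S.prism := by
  have h1 : ContinuousOn (fun q : ℝ × ℝ × ℝ =>
      P q.2.2 ((S.delaySystem hT hN).ι q.1, (S.delaySystem hT hN).ι q.2.1)) S.prism :=
    (h.comp (f := fun q : ℝ × ℝ × ℝ => q.2.2) (by fun_prop)
      fun q hq => ⟨hq.1.trans hq.2.2.1, hq.2.2.2.2⟩).eval (Continuous.continuousOn (by fun_prop))
  exact Oper.continuous_toCLM.comp_continuousOn h1

/-- Continuity and differentiability in the sup norm give, by evaluation, joint continuity in all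
variables together with the derivative in τ. -/
lemma matricesC1 (hP' : ContinuousOn P' (Icc 0 S.T))
    (hP : ∀ t ∈ Icc 0 S.T, HasDerivWithinAt P (P' t) (Icc 0 S.T) t) :
    S.MatricesC1 (S.matrix0 hT hN P) (S.matrix1 hT hN P) (S.matrix2 hT hN P)
      (S.matrix0 hT hN P') (S.matrix1 hT hN P') (S.matrix2 hT hN P') := by
  have hPc : ContinuousOn P (Icc 0 S.T) := fun t ht => (hP t ht).continuousWithinAt
  refine ⟨continuousOn_matrix0 hPc, continuousOn_matrix0 hP', fun τ hτ => ?_,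
    continuousOn_matrix1 hPc, continuousOn_matrix1 hP', fun s τ hq => ?_,
    continuousOn_matrix2 hPc, continuousOn_matrix2 hP', fun s ν τ hq => ?_⟩
  · exact Oper.hasDerivWithinAt_toCLM ((hP τ hτ).continuousMap_apply _)
  · refine Oper.hasDerivWithinAt_toCLM (HasDerivWithinAt.mono ?_ (Icc_subset_Icc_left hq.1))
    exact (hP τ ⟨hq.1.trans hq.2.1, hq.2.2⟩).continuousMap_apply _
  · refine Oper.hasDerivWithinAt_toCLM (HasDerivWithinAt.mono ?_
      (Icc_subset_Icc_left (hq.1.trans (le_max_left s ν))))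
    exact (hP τ ⟨hq.1.trans hq.2.2.1, hq.2.2.2.2⟩).continuousMap_apply _

lemma adjoint_matrix0 {τ : ℝ} (h : IsSymmKernel (P τ)) :
    (S.matrix0 hT hN P τ)† = S.matrix0 hT hN P τ := by
  rw [matrix0, ← Oper.toCLM_star, h]

lemma adjoint_matrix2 {s ν τ : ℝ} (h : IsSymmKernel (P τ)) :
    (S.matrix2 hT hN P s ν τ)† = S.matrix2 hT hN P ν s τ := by
  rw [matrix2, ← Oper.toCLM_star, h, matrix2]

/-- The three equations are the kernel equation at (star, star), (star, s) and (s, ν); the values 1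
and 0 of χ decide which terms survive. -/
lemma riccatiSystem (hPT : P S.T = 0) (hsymm : ∀ t ∈ Icc 0 S.T, IsSymmKernel (P t)) :
    S.RiccatiSystem (S.matrix0 hT hN P) (S.matrix1 hT hN P) (S.matrix2 hT hN P)
      (S.matrix0 hT hN fun t => (S.delaySystem hT hN).riccatiRHS t (P t))
      (S.matrix1 hT hN fun t => (S.delaySystem hT hN).riccatiRHS t (P t))
      (S.matrix2 hT hN fun t => (S.delaySystem hT hN).riccatiRHS t (P t)) := by
  have hBB : (S.delaySystem hT hN).BB.toCLM = S.B ∘L S.B† := rfl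
  have hCC : (S.delaySystem hT hN).CC.toCLM = S.C† ∘L S.C := rfl
  refine ⟨fun τ hτ => ?_, fun s τ hq => ?_, fun s ν τ hq => ?_, ?_, fun s _ => ?_,
    fun s _ ν _ => ?_⟩
  · simp only [matrix0, matrix1, DelaySystem.riccatiRHS_apply, delaySystem_k_star, hsymm τ hτ _ _,
      DelaySystem.χ_star, one_smul, mul_one]
    -- The entry at (ι τ, star) is the adjoint of P₁(τ, τ).
    rw [← hsymm τ hτ (S.delaySystem hT hN).star ((S.delaySystem hT hN).ι τ)]
    simp only [Oper.toCLM_neg, Oper.toCLM_add, Oper.toCLM_sub, Oper.toCLM_mul, Oper.toCLM_star,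
      Oper.toCLM_of, hBB, hCC, ContinuousLinearMap.comp_assoc]
    abel
  · have hτ : τ ∈ Icc 0 S.T := ⟨hq.1.trans hq.2.1, hq.2.2⟩
    simp only [matrix0, matrix1, matrix2, DelaySystem.riccatiRHS_apply, delaySystem_k_star,
      S.delaySystem_k_ι hT hN hq.1 hq.2.1 hq.2.2,
      hsymm τ hτ (S.delaySystem hT hN).star (S.delaySystem hT hN).star,
      DelaySystem.χ_star, DelaySystem.χ_ι, one_smul, mul_zero, zero_smul, add_zero]
    simp only [Oper.toCLM_neg, Oper.toCLM_add, Oper.toCLM_sub, Oper.toCLM_mul, Oper.toCLM_star,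
      Oper.toCLM_of, hBB, ContinuousLinearMap.comp_assoc]
    abel
  · have hν := S.delaySystem_k_ι hT hN hq.2.1 hq.2.2.2.1 hq.2.2.2.2
    have hs := S.delaySystem_k_ι hT hN hq.1 hq.2.2.1 hq.2.2.2.2
    dsimp only at hν hs
    simp only [matrix1, matrix2, DelaySystem.riccatiRHS_apply, hs, hν, DelaySystem.χ_ι, mul_zero,
      zero_smul, add_zero]
    simp only [Oper.toCLM_neg, Oper.toCLM_add, Oper.toCLM_sub, Oper.toCLM_mul, Oper.toCLM_star,
      Oper.toCLM_of, hBB, ContinuousLinearMap.comp_assoc]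
    abel
  · rw [matrix0, hPT]; rfl
  · rw [matrix1, hPT]; rfl
  · rw [matrix2, hPT]; rfl

variable {x x' : ℝ → C(Icc 0 S.T ⊕ Unit, Vec d)} {M M' : ℝ → ℝ}

lemma signalC1 (hx' : ContinuousOn x' (Icc 0 S.T))
    (hx : ∀ t ∈ Icc 0 S.T, HasDerivWithinAt x (x' t) (Icc 0 S.T) t)
    (hM' : ContinuousOn M' (Icc 0 S.T))
    (hM : ∀ t ∈ Icc 0 S.T, HasDerivWithinAt M (M' t) (Icc 0 S.T) t) :
    S.SignalC1 (fun τ => x τ (S.delaySystem hT hN).star)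
      (fun s τ => x τ ((S.delaySystem hT hN).ι s)) M
      (fun τ => x' τ (S.delaySystem hT hN).star)
      (fun s τ => x' τ ((S.delaySystem hT hN).ι s)) M' := by
  have hxc : ContinuousOn x (Icc 0 S.T) := fun t ht => (hx t ht).continuousWithinAt
  have h2 : ∀ {x : ℝ → C(Icc 0 S.T ⊕ Unit, Vec d)}, ContinuousOn x (Icc 0 S.T) →
      ContinuousOn (fun q : ℝ × ℝ => x q.2 ((S.delaySystem hT hN).ι q.1)) S.triangle := fun h =>
    (h.comp continuousOn_snd fun q hq => ⟨hq.1.trans hq.2.1, hq.2.2⟩).eval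
      (Continuous.continuousOn (by fun_prop))
  refine ⟨hxc.eval continuousOn_const, hx'.eval continuousOn_const,
    fun τ hτ => (hx τ hτ).continuousMap_apply _, h2 hxc, h2 hx', fun s τ hq => ?_,
    fun t ht => (hM t ht).continuousWithinAt, hM', hM⟩
  exact ((hx τ ⟨hq.1.trans hq.2.1, hq.2.2⟩).continuousMap_apply _).mono (Icc_subset_Icc_left hq.1)

lemma signalSystem {y : ℝ → Vec p} (hsymm : ∀ t ∈ Icc 0 S.T, IsSymmKernel (P t))
    (hxT : x S.T = 0) (hMT : M S.T = 0) :
    S.SignalSystem y (S.matrix0 hT hN P) (S.matrix1 hT hN P)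
      (fun τ => x τ (S.delaySystem hT hN).star)
      (fun s τ => x τ ((S.delaySystem hT hN).ι s)) M
      (fun τ => (S.delaySystem hT hN).signalRHS τ (P τ) (((S.delaySystem hT hN).C†) (y τ)) (x τ)
        (S.delaySystem hT hN).star)
      (fun s τ => (S.delaySystem hT hN).signalRHS τ (P τ) (((S.delaySystem hT hN).C†) (y τ)) (x τ)
        ((S.delaySystem hT hN).ι s))
      (fun τ => ‖((S.delaySystem hT hN).B†) (x τ (S.delaySystem hT hN).star)‖ ^ 2 - ‖y τ‖ ^ 2) := by
  have hBB : ∀ v, (S.delaySystem hT hN).BB v = S.B ((S.B†) v) := fun v => rfl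
  refine ⟨fun τ hτ => ?_, fun s τ hq => ?_, fun τ _ => rfl, ?_, fun s _ => ?_, hMT⟩
  · rw [DelaySystem.signalRHS_apply, delaySystem_k_star, DelaySystem.χ_star, one_smul, one_smul,
      hsymm τ hτ, hBB, sub_apply]
    change -((S.A†) _ + _ - S.matrix0 hT hN P τ _ - (S.C†) _) + ((S.A†) _ -
      S.matrix0 hT hN P τ (S.B ((S.B†) _))) + _ - _ = 0
    abel
  · have hs := S.delaySystem_k_ι hT hN hq.1 hq.2.1 hq.2.2
    dsimp only at hs
    rw [DelaySystem.signalRHS_apply, hs, DelaySystem.χ_ι, zero_smul, zero_smul, add_zero, sub_zero,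
      hBB]
    change -(((S.N (τ - s))†) _ - ((S.matrix1 hT hN P s τ)†) _) + ((S.N (τ - s))†) _ -
      ((S.matrix1 hT hN P s τ)†) (S.B ((S.B†) _)) = 0
    abel
  · rw [hxT]; rfl
  · rw [hxT]; rfl

variable {τ : ℝ} {ξh : Vec d} {ξm : ℝ → Vec d}

/-- Inserting point mass plus memory into the form gives four terms; symmetry merges the two mixed
ones, whence the factor 2 before P₁. -/
lemma quadraticForm_eq_value (hξ : IntervalIntegrable ξm volume 0 τ) (hsymm : IsSymmKernel (P τ)) :
    quadraticForm (S.matrix0 hT hN P) (S.matrix1 hT hN P) (S.matrix2 hT hN P)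
      (fun τ => x τ (S.delaySystem hT hN).star) (fun s τ => x τ ((S.delaySystem hT hN).ι s)) M
      τ ξh ξm
    = DelaySystem.value (P τ) (x τ) (M τ) (initialState hT hN ξh hξ) := by
  have h1 := kernelApply_dirac_comm hsymm (integralFunctional (S.delaySystem hT hN).ι hξ)
    (S.delaySystem hT hN).star ξh
  have h2 : integralFunctional (S.delaySystem hT hN).ι hξ
      (kernelApply (P τ) (integralFunctional (S.delaySystem hT hN).ι hξ))
      = ∫ s in (0 : ℝ)..τ, ∫ ν in (0 : ℝ)..τ,
        inner ℝ (ξm s) (S.matrix2 hT hN P s ν τ (ξm ν)) := by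
    rw [integralFunctional_apply]
    refine intervalIntegral.integral_congr fun s _ => ?_
    simp only [kernelApply_integral]
    exact ((innerSL ℝ (ξm s)).intervalIntegral_comp_comm (intervalIntegrable_clm_comp_apply
      (S.delaySystem hT hN).ι hξ ((P τ).curry ((S.delaySystem hT hN).ι s)))).symm
  have h3 : integralFunctional (S.delaySystem hT hN).ι hξ (x τ)
      = ∫ s in (0 : ℝ)..τ, inner ℝ (ξm s) (x τ ((S.delaySystem hT hN).ι s)) := rfl
  simp only [diracFunctional_apply, kernelApply_integral] at h1
  simp only [DelaySystem.value, kernelForm_apply, initialState, map_add, add_apply,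
    h2, h3, ← h1, diracFunctional_apply, kernelApply_dirac, kernelApply_integral]
  rw [quadraticForm]
  change inner ℝ ξh (P τ (_, _) ξh) + 2 * inner ℝ ξh (∫ s in (0 : ℝ)..τ, P τ (_, _) (ξm s)) + _ + _
    + _ + _ = _
  ring

lemma feedback_eq_feedbackControl_self (hξ : IntervalIntegrable ξm volume 0 τ) (w : C(ℝ, Vec d)) :
    (S.delaySystem hT hN).feedbackControl P x (initialState hT hN ξh hξ) w τ τ
      = S.feedback (S.matrix0 hT hN P) (S.matrix1 hT hN P)
        (fun τ => x τ (S.delaySystem hT hN).star) τ ξh ξm := by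
  have h : (S.delaySystem hT hN).stateAt (initialState hT hN ξh hξ) w τ τ
    = initialState hT hN ξh hξ := trajectoryFunctional_self _ _ _ _ _
  rw [DelaySystem.feedbackControl, h, DelaySystem.costate, ContinuousMap.add_apply,
    kernelApply_apply, liftFunctional_initialState]
  rfl

lemma feedback_eq_feedbackControl (hτ : 0 ≤ τ) (hξ : IntervalIntegrable ξm volume 0 τ)
    {w : C(ℝ, Vec d)} (hw : w τ = ξh) {t : ℝ} (ht : τ ≤ t) :
    (S.delaySystem hT hN).feedbackControl P x (initialState hT hN ξh hξ) w τ t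
      = S.feedback (S.matrix0 hT hN P) (S.matrix1 hT hN P)
        (fun τ => x τ (S.delaySystem hT hN).star) t (w t) (S.extend τ ξm w) := by
  set D := S.delaySystem hT hN with hD
  -- At s = τ the extension takes the value of w rather than of the memory, a null set for the
  -- integrals.
  have hne : ∀ᵐ s : ℝ, s ≠ τ := by simp [ae_iff, measure_singleton]
  have e1 : ∀ᵐ s : ℝ, s ∈ uIoc 0 τ → ξm s = S.extend τ ξm w s := by
    filter_upwards [hne] with s hs hs'
    rw [uIoc_of_le hτ] at hs'
    rw [extend, if_pos (lt_of_le_of_ne hs'.2 hs)]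
  have e2 : ∀ᵐ s : ℝ, s ∈ uIoc τ t → w s = S.extend τ ξm w s := by
    refine .of_forall fun s hs => ?_
    rw [uIoc_of_le ht] at hs
    rw [extend, if_neg hs.1.not_gt]
  have i1 : IntervalIntegrable (S.extend τ ξm w) volume 0 τ :=
    hξ.congr_ae ((ae_restrict_iff' measurableSet_uIoc).2 e1)
  have i2 : IntervalIntegrable (S.extend τ ξm w) volume τ t :=
    (w.continuous.intervalIntegrable τ t).congr_ae ((ae_restrict_iff' measurableSet_uIoc).2 e2)
  have j1 := intervalIntegrable_clm_comp_apply D.ι i1 ((P t).curry D.star)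
  have j2 := intervalIntegrable_clm_comp_apply D.ι i2 ((P t).curry D.star)
  have f1 : ∫ s in (0 : ℝ)..τ, (P t).curry D.star (D.ι s) (ξm s)
      = ∫ s in (0 : ℝ)..τ, (P t).curry D.star (D.ι s) (S.extend τ ξm w s) := by
    refine intervalIntegral.integral_congr_ae ?_
    filter_upwards [e1] with s hs hs'
    rw [hs hs']
  have f2 : ∫ s in τ..t, (P t).curry D.star (D.ι s) (w s)
      = ∫ s in τ..t, (P t).curry D.star (D.ι s) (S.extend τ ξm w s) := by
    refine intervalIntegral.integral_congr_ae ?_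
    filter_upwards [e2] with s hs hs'
    rw [hs hs']
  have f3 := intervalIntegral.integral_add_adjacent_intervals j1 j2
  have hcost : kernelApply (P t) (D.stateAt (initialState hT hN ξh hξ) w τ t) D.star
      = (P t).curry D.star D.star (w t)
        + ∫ s in (0 : ℝ)..t, (P t).curry D.star (D.ι s) (S.extend τ ξm w s) := by
    rw [kernelApply_apply, DelaySystem.liftFunctional_stateAt, liftFunctional_initialState, f1, f2,
      ← f3, hw, Oper.map_sub]
    abel
  rw [DelaySystem.feedbackControl, DelaySystem.costate, ContinuousMap.add_apply, hcost]
  rfl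

end Coefficients

end TrackingData

/-! ### The optimal tracking control -/

namespace TrackingData

variable {d m p : ℕ} {S : TrackingData d m p} {hT : 0 ≤ S.T} {hN : ContinuousOn S.N (Icc 0 S.T)}
  {y : ℝ → Vec p} {P : ℝ → C((Icc 0 S.T ⊕ Unit) × (Icc 0 S.T ⊕ Unit), Oper (Vec d))}
  {x : ℝ → C(Icc 0 S.T ⊕ Unit, Vec d)} {M : ℝ → ℝ}

/-- The value function and the optimal control in terms of a solution of the Riccati equation. -/
theorem optimal_control {τ : ℝ} (hτ' : τ ∈ Icc 0 S.T) (hyτ : ContinuousOn y (Icc τ S.T))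
    (hv : (S.delaySystem hT hN).IsValueSolution τ S.T y P x M) (hPT : P S.T = 0)
    (hxT : x S.T = 0) (hMT : M S.T = 0) {ξh : Vec d} {ξm : ℝ → Vec d}
    (hξ : IntervalIntegrable ξm volume 0 τ) :
    (∀ u, S.IsControl τ u → ∃ w, S.IsState τ ξh ξm u w ∧
      ∀ w', S.IsState τ ξh ξm u w' → EqOn w' w (Icc τ S.T)) ∧
    IsLeast (S.costValues y τ ξh ξm)
      (quadraticForm (S.matrix0 hT hN P) (S.matrix1 hT hN P) (S.matrix2 hT hN P)
        (fun τ => x τ (S.delaySystem hT hN).star) (fun s τ => x τ ((S.delaySystem hT hN).ι s)) M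
        τ ξh ξm) ∧
    ∃ (u : ℝ → Vec m) (w : ℝ → Vec d),
      S.IsOptimal y τ ξh ξm u w ∧
      ContinuousOn u (Icc τ S.T) ∧
      (∀ u' w', S.IsOptimal y τ ξh ξm u' w' →
        u' =ᵐ[volume.restrict (Icc τ S.T)] u ∧ EqOn w' w (Icc τ S.T)) ∧
      u τ = S.feedback (S.matrix0 hT hN P) (S.matrix1 hT hN P)
        (fun τ => x τ (S.delaySystem hT hN).star) τ ξh ξm ∧
      ∀ t ∈ Icc τ S.T, u t = S.feedback (S.matrix0 hT hN P) (S.matrix1 hT hN P)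
        (fun τ => x τ (S.delaySystem hT hN).star) t (w t) (S.extend τ ξm w) := by
  have hτT : τ ≤ S.T := hτ'.2
  have hstate : ∀ {u : ℝ → Vec m} {w : ℝ → Vec d} {z : C(ℝ, Vec d)}, EqOn w z (Icc τ S.T) →
      (S.IsState τ ξh ξm u w ↔
        (S.delaySystem hT hN).IsTrajectory τ S.T (initialState hT hN ξh hξ) u z) := fun h =>
    isState_iff_isTrajectory hτ' hξ h
  have hself : ∀ z : C(ℝ, Vec d), EqOn z z (Icc τ S.T) := fun z => eqOn_refl _ _
  obtain ⟨u, w, hu, huc, hw, hcost, hopt⟩ :=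
    DelaySystem.exists_optimal hτT hyτ hv hPT hxT hMT (initialState hT hN ξh hξ)
  have hw0 : w τ = ξh := hw.initial.symm.trans (liftFunctional_initialState_χOp hξ)
  rw [quadraticForm_eq_value hξ (hv.symm τ ⟨le_rfl, hτT⟩)]
  generalize DelaySystem.value (P τ) (x τ) (M τ) (initialState hT hN ξh hξ) = W at *
  have hcostu : S.cost y τ u w = W := hcost
  have huL : S.IsControl τ u := huc.memLp_Icc 2
  have hwS : S.IsState τ ξh ξm u w := (hstate (hself w)).2 hw
  have hle : ∀ v z, S.IsControl τ v → S.IsState τ ξh ξm v z → W ≤ S.cost y τ v z ∧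
      (S.cost y τ v z ≤ W → v =ᵐ[volume.restrict (Icc τ S.T)] u ∧ EqOn z w (Icc τ S.T)) := by
    intro v z hvL hz
    obtain ⟨z', hzz'⟩ := hz.exists_extension hτT
    rw [cost_congr hτT y v hzz']
    obtain ⟨h1, h2⟩ := hopt v z' hvL ((hstate hzz').1 hz)
    exact ⟨h1, fun h => ⟨(h2 h).1, hzz'.trans (h2 h).2⟩⟩
  refine ⟨fun v hvL => ?_, ⟨⟨u, w, huL, hwS, hcostu.symm⟩, ?_⟩, u, w,
    ⟨huL, hwS, fun v z hvL hz => hcostu.le.trans (hle v z hvL hz).1⟩, huc, fun v z hvz => ?_,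
    ?_, fun t ht => ?_⟩
  · obtain ⟨z, hz, hzu⟩ := (S.delaySystem hT hN).exists_trajectory hτT (initialState hT hN ξh hξ)
      (hvL.intervalIntegrable_of_two hτT)
    refine ⟨z, (hstate (hself z)).2 hz, fun z' hz' t ht => ?_⟩
    obtain ⟨z'', he⟩ := hz'.exists_extension hτT
    exact (he ht).trans (hzu z'' ((hstate he).1 hz') ht)
  · rintro c ⟨v, z, hvL, hz, rfl⟩
    exact (hle v z hvL hz).1
  · exact (hle v z hvz.isControl hvz.isState).2 ((hvz.le u w huL hwS).trans hcostu.le)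
  · rw [hu]
    exact feedback_eq_feedbackControl_self hξ w
  · rw [hu]
    exact feedback_eq_feedbackControl hτ'.1 hξ hw0 ht.1

end TrackingData

theorem mainTheorem1 {d m p : ℕ} (S : TrackingData d m p) (hT : 0 < S.T)
    (hN : ContinuousOn S.N (Icc 0 S.T)) :
    -- the matrices, chosen before (hence independent of) the reference signal and initial data
    ∃ (P0 : ℝ → Mat d d) (P1 : ℝ → ℝ → Mat d d) (P2 : ℝ → ℝ → ℝ → Mat d d)
      (P0' : ℝ → Mat d d) (P1' : ℝ → ℝ → Mat d d) (P2' : ℝ → ℝ → ℝ → Mat d d),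
      S.MatricesC1 P0 P1 P2 P0' P1' P2' ∧
      S.RiccatiSystem P0 P1 P2 P0' P1' P2' ∧
      (∀ τ ∈ Icc 0 S.T, P0 τ = (P0 τ)†) ∧
      (∀ s ν τ, (s, ν, τ) ∈ S.prism → P2 s ν τ = (P2 ν s τ)†) ∧
      -- the coefficients, as functions of the reference signal
      ∃ (d1 : (ℝ → Vec p) → ℝ → Vec d) (d2 : (ℝ → Vec p) → ℝ → ℝ → Vec d)
        (M : (ℝ → Vec p) → ℝ → ℝ),
        -- dependence on the future of the reference signal only
        (∀ y z : ℝ → Vec p, ContinuousOn y (Icc 0 S.T) → ContinuousOn z (Icc 0 S.T) →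
          ∀ τ ∈ Icc 0 S.T, EqOn y z (Icc τ S.T) →
            d1 y τ = d1 z τ ∧ (∀ s ∈ Icc 0 τ, d2 y s τ = d2 z s τ) ∧ M y τ = M z τ) ∧
        -- the term of the optimal control due to the reference signal is linear in it
        (∀ y z : ℝ → Vec p, ContinuousOn y (Icc 0 S.T) → ContinuousOn z (Icc 0 S.T) →
          ∀ a b : ℝ, ∀ τ ∈ Icc 0 S.T,
            d1 (fun t => a • y t + b • z t) τ = a • d1 y τ + b • d1 z τ) ∧
        -- no contribution if the reference signal is zero
        (∀ τ ∈ Icc 0 S.T, d1 (fun _ => 0) τ = 0 ∧ (∀ s ∈ Icc 0 τ, d2 (fun _ => 0) s τ = 0) ∧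
          M (fun _ => 0) τ = 0) ∧
        ∀ y : ℝ → Vec p, ContinuousOn y (Icc 0 S.T) →
          -- regularity and equations of the coefficients
          (∃ (d1' : ℝ → Vec d) (d2' : ℝ → ℝ → Vec d) (M' : ℝ → ℝ),
            S.SignalC1 (d1 y) (d2 y) (M y) d1' d2' M' ∧
            S.SignalSystem y P0 P1 (d1 y) (d2 y) (M y) d1' d2' M') ∧
          ∀ τ ∈ Ico 0 S.T, ∀ (ξh : Vec d) (ξm : ℝ → Vec d), S.IsMemory τ ξm →
            -- every control determines the state
            (∀ u, S.IsControl τ u → ∃ w, S.IsState τ ξh ξm u w ∧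
              ∀ w', S.IsState τ ξh ξm u w' → EqOn w' w (Icc τ S.T)) ∧
            -- the value function
            IsLeast (S.costValues y τ ξh ξm)
              (TrackingData.quadraticForm P0 P1 P2 (d1 y) (d2 y) (M y) τ ξh ξm) ∧
            -- the optimal control: existence, continuity, uniqueness, and feedback form at the
            -- initial time and at each later time
            ∃ (u : ℝ → Vec m) (w : ℝ → Vec d),
              S.IsOptimal y τ ξh ξm u w ∧
              ContinuousOn u (Icc τ S.T) ∧
              (∀ u' w', S.IsOptimal y τ ξh ξm u' w' →
                u' =ᵐ[volume.restrict (Icc τ S.T)] u ∧ EqOn w' w (Icc τ S.T)) ∧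
              u τ = S.feedback P0 P1 (d1 y) τ ξh ξm ∧
              ∀ t ∈ Icc τ S.T,
                u t = S.feedback P0 P1 (d1 y) t (w t) (S.extend τ ξm w) := by
  obtain ⟨P, hPT, hP⟩ := (S.delaySystem hT.le hN).exists_riccati hT.le
  have hPc : ContinuousOn P (Icc 0 S.T) := fun t ht => (hP t ht).continuousWithinAt
  have hsymm : ∀ t ∈ Icc 0 S.T, IsSymmKernel (P t) := fun t ht =>
    (S.delaySystem hT.le hN).isSymmKernel_of_riccati hPT hP ht
  -- The coefficients must be functions of an arbitrary signal before continuity is assumed; 0 is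
  -- the default for discontinuous ones.
  have hex : ∀ y : ℝ → Vec p, ∃ (x : ℝ → C(Icc 0 S.T ⊕ Unit, Vec d)) (M : ℝ → ℝ),
      ContinuousOn y (Icc 0 S.T) →
        x S.T = 0 ∧ M S.T = 0 ∧ (S.delaySystem hT.le hN).IsValueSolution 0 S.T y P x M := by
    intro y
    by_cases hy : ContinuousOn y (Icc 0 S.T)
    · obtain ⟨x, M, h⟩ := (S.delaySystem hT.le hN).exists_valueSolution hT.le hPT hP hy
      exact ⟨x, M, fun _ => h⟩
    · exact ⟨0, 0, fun h => absurd h hy⟩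
  choose x M hxM using hex
  -- The zero signal is used only to obtain some value solution, from which continuity of the
  -- Riccati right-hand side follows.
  have hR : ContinuousOn (fun t => (S.delaySystem hT.le hN).riccatiRHS t (P t)) (Icc 0 S.T) := by
    obtain ⟨_, _, h⟩ := hxM (fun _ => 0) continuousOn_const
    exact h.continuousOn_riccatiRHS
  refine ⟨S.matrix0 hT.le hN P, S.matrix1 hT.le hN P, S.matrix2 hT.le hN P, _, _, _,
    TrackingData.matricesC1 hR hP, TrackingData.riccatiSystem hPT hsymm,
    fun τ hτ => (TrackingData.adjoint_matrix0 (hsymm τ hτ)).symm,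
    fun s ν τ hq => (TrackingData.adjoint_matrix2
      (hsymm τ ⟨hq.1.trans hq.2.2.1, hq.2.2.2.2⟩)).symm,
    fun y τ => x y τ (S.delaySystem hT.le hN).star,
    fun y s τ => x y τ ((S.delaySystem hT.le hN).ι s), M, ?_, ?_, ?_, ?_⟩
  · intro y z hy hz τ hτ hyz
    obtain ⟨hxT, hMT, h⟩ := hxM y hy
    obtain ⟨hxT', hMT', h'⟩ := hxM z hz
    obtain ⟨e1, e2⟩ := h.eqOn hτ.1 h' (hxT.trans hxT'.symm) (hMT.trans hMT'.symm) hyz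
    have e1' := e1 (left_mem_Icc.2 hτ.2)
    exact ⟨by simp only [e1'], fun s _ => by simp only [e1'], e2 (left_mem_Icc.2 hτ.2)⟩
  · intro y z hy hz a b τ hτ
    obtain ⟨hxT, hMT, h⟩ := hxM y hy
    obtain ⟨hxT', hMT', h'⟩ := hxM z hz
    have hyz : ContinuousOn (fun t => a • y t + b • z t) (Icc 0 S.T) :=
      (hy.const_smul a).add (hz.const_smul b)
    obtain ⟨hxT'', hMT'', h''⟩ := hxM _ hyz
    have e := h.signal_combination h' h'' (by simp [hxT, hxT', hxT'']) hτ
    simp only [e]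
    rfl
  · intro τ hτ
    obtain ⟨hxT, hMT, h⟩ := hxM (fun _ => 0) continuousOn_const
    -- The chosen coefficients for y = 0 are compared with the identically zero solution by
    -- uniqueness.
    obtain ⟨e1, e2⟩ := h.eqOn le_rfl ((S.delaySystem hT.le hN).isValueSolution_zero hPT hP) hxT hMT
      fun _ _ => rfl
    exact ⟨by simp only [e1 hτ]; rfl, fun s _ => by simp only [e1 hτ]; rfl, e2 hτ⟩
  · intro y hy
    obtain ⟨hxT, hMT, h⟩ := hxM y hy
    refine ⟨⟨_, _, _, TrackingData.signalC1 (h.continuousOn_signalRHS hy) h.signal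
      (h.continuousOn_const hy) h.const, TrackingData.signalSystem hsymm hxT hMT⟩, ?_⟩
    intro τ hτ ξh ξm hξm
    exact TrackingData.optimal_control ⟨hτ.1, hτ.2.le⟩ (hy.mono (Icc_subset_Icc_left hτ.1))
      (h.mono hτ.1) hPT hxT hMT (hξm.intervalIntegrable hτ.1)
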